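/- All digraphs are finite, without loops and without parallel arcs; digons $[p,q]=\{pq,qp\}$ are allowed. For a digraph $D$, let $\vec\chi(D)$ be the least number of colours in a vertex colouring of $D$ such that every colour class induces an acyclic subdigraph, and let $\lambda(D)$ be the maximum, over all ordered pairs of distinct vertices $(p,q)$, of the maximum number of pairwise arc-disjoint directed $pq$-paths. $D$ is biconnected if its underlying undirected graph is connected and has no cutvertex, and it is strong if there is a directed path from each vertex to each other vertex. $D$ is $k$-extremal if it is biconnected, strong, and $\vec\chi(D)=\lambda(D)+1=k+1$. Let $D_B$ be a digraph containing a digon $[a,b]$. Let $D_{AC}$ be a digraph with $V(D_{AC})=A\cup C$ and $A\cap C=\{x\}$. Let $t,w\in A\setminus\{x\}$ and $u,v\in C\setminus\{x\}$ ($t=w$ and $u=v$ are allowed) be such that $tu$ and $vw$ are arcs of $D_{AC}$ and are the only arcs between $A\setminus\{x\}$ and $C\setminus\{x\}$, in either direction. Suppose that $t$ and $w$ are in the same connected component of (the underlying graph of) $D_{AC}[A]\setminus x$, and $u$ and $v$ are in the same connected component of $D_{AC}[C]\setminus x$. The parallel Hajós join of $D_{AC}$ and $D_B$ with respect to $(t,u,v,w,[a,b])$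 is the digraph obtained from disjoint copies of $D_B-[a,b]$ (the digraph $D_B$ with the two arcs $ab$ and $ba$ removed), $D_{AC}[A]$ and $D_{AC}[C]$ by identifying the copy of $x$ in $D_{AC}[A]$ with $a$ and the copy of $x$ in $D_{AC}[C]$ with $b$, and adding the arcs $tu$ and $vw$. **Lemma 7.2.** Let $k\ge 3$, and let $D$ be a parallel Hajós join of two digraphs $D_{AC}$ and $D_B$. Then $D$ is $k$-extremal if and only if both $D_{AC}$ and $D_B$ are $k$-extremal. -/

import Mathlib

/-!
Digraphs are Mathlib's `Digraph V` on a finite vertex type `V`. Mathlib's digraphs have no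
parallel arcs but may have loops; loops are excluded by `Digraph.IsLoopless`.
-/

namespace Digraph

variable {V : Type*} (D : Digraph V)

/-- `D` has no loops. Digons (pairs of opposite arcs) are allowed. -/
def IsLoopless : Prop := ∀ v, ¬ D.Adj v v

/-- `l = [x₁, …, x_p]` is an `xy`-dipath: its vertices are pairwise distinct, consecutive vertices
are joined by arcs, the first vertex is `x` and the last one is `y`. -/
def IsDipath (x y : V) (l : List V) : Prop :=
  l.Nodup ∧ l.IsChain D.Adj ∧ l.head? = some x ∧ l.getLast? = some y

/-- `l = [x₁, …, x_p]` (with `p ≥ 1`) is a directed cycle `x₁ → x₂ → ⋯ → x_p → x₁` on pairwise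
distinct vertices. In a loopless digraph `p ≥ 2`. -/
def IsDicycle (l : List V) : Prop :=
  ∃ h : l ≠ [], l.Nodup ∧ l.IsChain D.Adj ∧ D.Adj (l.getLast h) (l.head h)

/-- A digraph is acyclic if it has no directed cycle. -/
def IsAcyclic : Prop := ∀ l : List V, ¬ D.IsDicycle l

/-- The subdigraph `D[X]` induced by a set `X` of vertices. -/
def induceOn (X : Set V) : Digraph X where
  Adj p q := D.Adj p q

/-- A `k`-dicolouring: every colour class induces an acyclic subdigraph. -/
def IsDicolouring {k : ℕ} (φ : V → Fin k) : Prop :=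
  ∀ i : Fin k, (D.induceOn {v | φ v = i}).IsAcyclic

/-- The dichromatic number: the least `k` such that `D` has a `k`-dicolouring. (For a finite
loopless digraph the set is nonempty.) -/
noncomputable def dichromaticNumber : ℕ :=
  sInf {k : ℕ | ∃ φ : V → Fin k, D.IsDicolouring φ}

/-- The set of arcs used by a dipath given as a list of vertices. -/
def pathArcs (l : List V) : Set (V × V) := {e | e ∈ l.zip l.tail}

/-- There are `n` pairwise arc-disjoint `xy`-dipaths. (For `x ≠ y` every `xy`-dipath has an arc,
so that these dipaths are pairwise different.) -/
def HasArcDisjointDipaths (x y : V) (n : ℕ) : Prop :=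
  ∃ P : Fin n → List V, (∀ i, D.IsDipath x y (P i)) ∧
    Pairwise fun i j => Disjoint (pathArcs (P i)) (pathArcs (P j))

/-- The local arc-connectivity `λ(x, y)`, for distinct `x` and `y`: the maximum number of pairwise
arc-disjoint `xy`-dipaths. -/
noncomputable def localArcConnectivity (x y : V) : ℕ :=
  sSup {n : ℕ | D.HasArcDisjointDipaths x y n}

/-- The maximum local arc-connectivity `λ(D)`: the maximum of `λ(x, y)` over all pairs of distinct
vertices. -/
noncomputable def maxLocalArcConnectivity : ℕ :=
  sSup {n : ℕ | ∃ x y : V, x ≠ y ∧ n = D.localArcConnectivity x y}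

/-- `D` is strong: for all `x`, `y` there is an `xy`-dipath (and, by symmetry, a `yx`-dipath). -/
def IsStrong : Prop := ∀ x y : V, ∃ l : List V, D.IsDipath x y l

/-- `D` is biconnected: its underlying graph is connected and has no cutvertex, that is, it stays
connected after the deletion of any one vertex (the empty graph not being disconnected). -/
def IsBiconnected : Prop :=
  D.toSimpleGraphInclusive.Connected ∧
    ∀ v : V, (D.toSimpleGraphInclusive.induce {z | z ≠ v}).Preconnected

/-- `D` is `k`-extremal: it is biconnected and strong, and its dichromatic number equals
`λ(D) + 1 = k + 1`. -/
def IsExtremal (k : ℕ) : Prop :=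
  D.IsBiconnected ∧ D.IsStrong ∧
    D.dichromaticNumber = D.maxLocalArcConnectivity + 1 ∧
    D.maxLocalArcConnectivity + 1 = k + 1

/-- The data with respect to which a parallel Hajós join of `DAC` and `DB` is taken:

* `V(DAC) = A ∪ C` with `A ∩ C = {x}`;
* `tu` and `vw` are arcs of `DAC` with `t, w ∈ A \ x` and `u, v ∈ C \ x`, and they are the only
  arcs between `A \ x` and `C \ x` (`t = w` and `u = v` are possible);
* `t` and `w` are in the same connected component of `DAC[A] \ x`, and `u` and `v` are in the same
  connected component of `DAC[C] \ x`;
* `[a, b]` is a digon of `DB`. -/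
structure ParallelHajosData {V W : Type*} (DAC : Digraph V) (DB : Digraph W) where
  (A C : Set V)
  (x t u v w : V)
  (a b : W)
  union_eq : A ∪ C = Set.univ
  inter_eq : A ∩ C = {x}
  t_mem : t ∈ A \ {x}
  w_mem : w ∈ A \ {x}
  u_mem : u ∈ C \ {x}
  v_mem : v ∈ C \ {x}
  adj_A_C : ∀ y ∈ A \ {x}, ∀ z ∈ C \ {x}, DAC.Adj y z ↔ y = t ∧ z = u
  adj_C_A : ∀ z ∈ C \ {x}, ∀ y ∈ A \ {x}, DAC.Adj z y ↔ z = v ∧ y = w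
  reachable_A : (DAC.toSimpleGraphInclusive.induce (A \ {x})).Reachable ⟨t, t_mem⟩ ⟨w, w_mem⟩
  reachable_C : (DAC.toSimpleGraphInclusive.induce (C \ {x})).Reachable ⟨u, u_mem⟩ ⟨v, v_mem⟩
  adj_ab : DB.Adj a b
  adj_ba : DB.Adj b a

namespace ParallelHajosData

variable {V W : Type*} {DAC : Digraph V} {DB : Digraph W} (P : ParallelHajosData DAC DB)

/-- Arcs of the parallel Hajós join. The vertices are those of `DAC` other than `x` (`Sum.inl`)
and those of `DB` (`Sum.inr`). The copy of `x` in `DAC[A]` is identified with `a` and the copy of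
`x` in `DAC[C]` is identified with `b`; the digon `[a, b]` of `DB` is deleted. -/
def JoinAdj : {y : V // y ≠ P.x} ⊕ W → {y : V // y ≠ P.x} ⊕ W → Prop
  | Sum.inl y, Sum.inl z => DAC.Adj y z
  | Sum.inl y, Sum.inr q =>
      DAC.Adj y P.x ∧ ((y : V) ∈ P.A ∧ q = P.a ∨ (y : V) ∈ P.C ∧ q = P.b)
  | Sum.inr p, Sum.inl z =>
      DAC.Adj P.x z ∧ ((z : V) ∈ P.A ∧ p = P.a ∨ (z : V) ∈ P.C ∧ p = P.b)
  | Sum.inr p, Sum.inr q =>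
      DB.Adj p q ∧ ¬ (p = P.a ∧ q = P.b) ∧ ¬ (p = P.b ∧ q = P.a)

/-- The digraph obtained from disjoint copies of `DB - [a, b]`, `DAC[A]` and `DAC[C]` by
identifying the copy of `x` in `DAC[A]` with `a` and the copy of `x` in `DAC[C]` with `b`,
and keeping the two arcs `tu` and `vw`. -/
def join : Digraph ({y : V // y ≠ P.x} ⊕ W) where
  Adj := P.JoinAdj

end ParallelHajosData

/-- `D` is (isomorphic to) a parallel Hajós join of `DAC` and `DB`. -/
def IsParallelHajosJoin {U V W : Type*} (D : Digraph U) (DAC : Digraph V) (DB : Digraph W) :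
    Prop :=
  ∃ P : ParallelHajosData DAC DB, Nonempty (D.Adj ≃r P.join.Adj)

end Digraph

/-! Extremality is first turned into a statement about cuts, `Core`: no k-dicolouring, any two
vertices separated in either direction by a cut of at most k arcs, no empty proper cut, no
cutvertex. The link is Menger's theorem together with a colour-rotation argument: if both sides of a
cut are coloured but the whole is not k-colourable, all k colour differences occur on arcs leaving
the set. Consequently an extremal digraph is arc-critical (`Core.eq_of_not_col`), all its proper
cuts have at least k arcs, and by a theorem of Lovász it is balanced (`excess_eq_zero`).

From the parts to the join, the hard point is that no k-dicolouring exists. If a and b get different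
colours, the colouring restricts to one of D_B. If they get the same colour, it colours both sides
of D_AC consistently at x, and a monochromatic cycle of D_AC could be broken only by splitting x
into a and b. `Split.reach_of_core` excludes this: either there are monochromatic cycles through x
by tu and by vw, which combine into a closed walk a, t, u, b, v, w, a, or one closed walk uses tu
and vw and each side once. Its proof needs a colouring of a side without a monochromatic path from x
to t (`Split.exists_col_not_reach`, by balance and the linking of t with w), and a walk backwards
through tight sets, each entered by at most one monochromatic arc (`Split.false_of_unique_entry`).
Cuts of the parts pull back to the join along two collapsing maps.

From the join to the parts, colourings are pasted after permuting colours. A cut separating a from b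
has at least k - 1 arcs inside the copy of D_B, so, since k is at least 3, a tight one cannot split
a side (`Join.side_of_tight`). Hence vertices of D_AC can be separated by tight cuts that keep a and
b together, and these descend to D_AC. -/

namespace ArcSet

open Relation

open scoped Classical

variable {V : Type*}

/-! ### Cuts and excess of arc sets -/

/-- The arcs of `E` leaving `X`. -/
noncomputable def leaving (E : Finset (V × V)) (X : Set V) : Finset (V × V) :=
  E.filter fun e => e.1 ∈ X ∧ e.2 ∉ X

lemma mem_leaving {E : Finset (V × V)} {X : Set V} {e : V × V} :
    e ∈ leaving E X ↔ e ∈ E ∧ e.1 ∈ X ∧ e.2 ∉ X := Finset.mem_filter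

/-- The number of arcs of `E` leaving `X`. -/
noncomputable def cut (E : Finset (V × V)) (X : Set V) : ℕ := (leaving E X).card

/-- The number of arcs of `E` leaving `X` minus the number of arcs of `E` entering `X`. -/
noncomputable def excess (E : Finset (V × V)) (X : Set V) : ℤ :=
  ∑ e ∈ E, ((if e.1 ∈ X then 1 else 0) - (if e.2 ∈ X then 1 else 0))

/-- The step relation of an arc set. -/
def Step (E : Finset (V × V)) (p q : V) : Prop := (p, q) ∈ E

lemma cut_eq_sum (E : Finset (V × V)) (X : Set V) :
    cut E X = ∑ e ∈ E, if e.1 ∈ X ∧ e.2 ∉ X then 1 else 0 := by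
  rw [cut, leaving, Finset.card_filter]

lemma cut_mono {E F : Finset (V × V)} (h : E ⊆ F) (X : Set V) : cut E X ≤ cut F X :=
  Finset.card_le_card (Finset.filter_subset_filter _ h)

/-- The arcs entering `X` are counted throughout as `cut E Xᶜ`. -/
lemma excess_eq_cut_sub (E : Finset (V × V)) (X : Set V) :
    excess E X = cut E X - cut E Xᶜ := by
  rw [cut_eq_sum, cut_eq_sum, excess]
  push_cast
  rw [← Finset.sum_sub_distrib]
  refine Finset.sum_congr rfl fun e _ => ?_
  by_cases h1 : e.1 ∈ X <;> by_cases h2 : e.2 ∈ X <;> simp [h1, h2]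

lemma excess_compl (E : Finset (V × V)) (X : Set V) : excess E Xᶜ = - excess E X := by
  rw [excess_eq_cut_sub, excess_eq_cut_sub, compl_compl]; ring

/-- Unlike `cut`, which is only submodular, `excess` is modular, so uncrossing with it loses
nothing. -/
lemma excess_inter_add_union (E : Finset (V × V)) (X Y : Set V) :
    excess E (X ∩ Y) + excess E (X ∪ Y) = excess E X + excess E Y := by
  simp only [excess, ← Finset.sum_add_distrib]
  refine Finset.sum_congr rfl fun e _ => ?_
  by_cases h1 : e.1 ∈ X <;> by_cases h2 : e.2 ∈ X <;> by_cases h3 : e.1 ∈ Y <;>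
    by_cases h4 : e.2 ∈ Y <;> simp [h1, h2, h3, h4]

lemma excess_sdiff_arcs {E F : Finset (V × V)} (h : F ⊆ E) (X : Set V) :
    excess (E \ F) X = excess E X - excess F X := by
  rw [excess, excess, excess, ← Finset.sum_sdiff h]; ring

lemma cut_inter_add_union_le (E : Finset (V × V)) (X Y : Set V) :
    cut E (X ∩ Y) + cut E (X ∪ Y) ≤ cut E X + cut E Y := by
  simp only [cut_eq_sum, ← Finset.sum_add_distrib]
  refine Finset.sum_le_sum fun e _ => ?_
  by_cases h1 : e.1 ∈ X <;> by_cases h2 : e.2 ∈ X <;> by_cases h3 : e.1 ∈ Y <;>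
    by_cases h4 : e.2 ∈ Y <;> simp [h1, h2, h3, h4]

/-- An arc from `Y \ X` to `X \ Y` leaves `Y` but neither the intersection nor the union, which
makes submodularity strict. -/
lemma cut_inter_add_union_lt {E : Finset (V × V)} {X Y : Set V} {g : V × V} (hg : g ∈ E)
    (h1 : g.1 ∈ Y) (h2 : g.1 ∉ X) (h3 : g.2 ∈ X) (h4 : g.2 ∉ Y) :
    cut E (X ∩ Y) + cut E (X ∪ Y) < cut E X + cut E Y := by
  simp only [cut_eq_sum, ← Finset.sum_add_distrib]
  refine Finset.sum_lt_sum (fun e _ => ?_) ⟨g, hg, by simp [h1, h2, h3, h4]⟩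
  by_cases h1 : e.1 ∈ X <;> by_cases h2 : e.2 ∈ X <;> by_cases h3 : e.1 ∈ Y <;>
    by_cases h4 : e.2 ∈ Y <;> simp [h1, h2, h3, h4]

lemma exists_of_cut_pos {E : Finset (V × V)} {X : Set V} (h : 0 < cut E X) :
    ∃ e ∈ E, e.1 ∈ X ∧ e.2 ∉ X := by
  obtain ⟨e, he⟩ := Finset.card_pos.1 h
  exact ⟨e, mem_leaving.1 he⟩

lemma cut_pos_of_mem {E : Finset (V × V)} {X : Set V} {e : V × V} (he : e ∈ E) (h1 : e.1 ∈ X)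
    (h2 : e.2 ∉ X) : 0 < cut E X :=
  Finset.card_pos.2 ⟨e, mem_leaving.2 ⟨he, h1, h2⟩⟩

lemma cut_eq_zero {E : Finset (V × V)} {X : Set V} (h : cut E X = 0) {e : V × V} (he : e ∈ E)
    (h1 : e.1 ∈ X) : e.2 ∈ X := by
  by_contra h2
  have := cut_pos_of_mem he h1 h2
  omega

/-- Reachability from every set leaving arcs. -/
lemma reach_of_cuts {E : Finset (V × V)} {s t : V}
    (h : ∀ X : Set V, s ∈ X → t ∉ X → ∃ e ∈ E, e.1 ∈ X ∧ e.2 ∉ X) :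
    ReflTransGen (Step E) s t := by
  by_contra hn
  obtain ⟨e, he, h1, h2⟩ := h {y | ReflTransGen (Step E) s y} ReflTransGen.refl hn
  exact h2 (ReflTransGen.tail h1 he)

lemma exists_leaving_of_reach {R : V → V → Prop} {s t : V} (h : ReflTransGen R s t) {X : Set V}
    (hs : s ∈ X) (ht : t ∉ X) : ∃ p q, R p q ∧ p ∈ X ∧ q ∉ X ∧
      ReflTransGen R s p ∧ ReflTransGen R q t := by
  induction h with
  | refl => exact absurd hs ht
  | @tail b c hab hbc ih =>
    by_cases hb : b ∈ X
    · exact ⟨b, c, hbc, hb, ht, hab, ReflTransGen.refl⟩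
    · obtain ⟨p, q, h1, h2, h3, h4, h5⟩ := ih hb
      exact ⟨p, q, h1, h2, h3, h4, h5.tail hbc⟩

/-! ### Dipaths -/

lemma exists_nodup_chain {R : V → V → Prop} {s t : V} (h : ReflTransGen R s t) :
    ∃ l : List V, l.Nodup ∧ l.IsChain R ∧ l.head? = some s ∧ l.getLast? = some t := by
  induction h using ReflTransGen.head_induction_on with
  | refl => exact ⟨[t], by simp⟩
  | @head a b hab _ ih =>
    obtain ⟨l, h1, h2, h3, h4⟩ := ih
    by_cases ha : a ∈ l
    · obtain ⟨l1, l2, rfl⟩ := List.append_of_mem ha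
      refine ⟨a :: l2, (List.nodup_append.1 h1).2.1, (List.isChain_append.1 h2).2.1, rfl, ?_⟩
      simpa using h4
    · cases l with
      | nil => simp at h3
      | cons c l =>
        simp only [List.head?_cons, Option.some.injEq] at h3
        subst h3
        refine ⟨a :: c :: l, List.nodup_cons.2 ⟨ha, h1⟩, List.isChain_cons_cons.2 ⟨hab, h2⟩, rfl,
          by simpa using h4⟩

/-- The arcs traversed by a list of vertices. -/
noncomputable def arcsOf (l : List V) : Finset (V × V) := (l.zip l.tail).toFinset

lemma fst_mem_of_mem_arcsOf {l : List V} {e : V × V} (h : e ∈ arcsOf l) : e.1 ∈ l := by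
  rw [arcsOf, List.mem_toFinset] at h
  exact (List.of_mem_zip h).1

lemma arcsOf_cons_cons (a b : V) (l : List V) :
    arcsOf (a :: b :: l) = insert (a, b) (arcsOf (b :: l)) := by
  simp [arcsOf]

lemma mem_of_mem_arcsOf {R : V → V → Prop} {l : List V} (h : l.IsChain R) {e : V × V}
    (he : e ∈ arcsOf l) : R e.1 e.2 := by
  induction l with
  | nil => simp [arcsOf] at he
  | cons a l ih =>
    cases l with
    | nil => simp [arcsOf] at he
    | cons b l =>
      rw [List.isChain_cons_cons] at h
      rw [arcsOf_cons_cons, Finset.mem_insert] at he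
      rcases he with rfl | he
      · exact h.1
      · exact ih h.2 he

/-- The contributions of inner vertices telescope. Distinctness of the vertices matters because
`arcsOf` is a set and would merge repeated arcs. -/
lemma excess_arcsOf {l : List V} {s t : V} (hn : l.Nodup) (hs : l.head? = some s)
    (ht : l.getLast? = some t) (X : Set V) :
    excess (arcsOf l) X = (if s ∈ X then 1 else 0) - (if t ∈ X then 1 else 0) := by
  induction l generalizing s with
  | nil => simp at hs
  | cons a l ih =>
    simp only [List.head?_cons, Option.some.injEq] at hs
    subst hs
    cases l with
    | nil =>
      simp only [List.getLast?_singleton, Option.some.injEq] at ht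
      subst ht
      simp [arcsOf, excess]
    | cons b l =>
      have hab : (a, b) ∉ arcsOf (b :: l) := fun h =>
        (List.nodup_cons.1 hn).1 (fst_mem_of_mem_arcsOf h)
      have := ih (s := b) (List.nodup_cons.1 hn).2 rfl (by simpa using ht)
      rw [arcsOf_cons_cons, excess, Finset.sum_insert hab]
      rw [excess] at this
      rw [this]; ring

/-- An arc set carrying a path has a subset with the excess function of a path. -/
lemma exists_path_arcs {E : Finset (V × V)} {s t : V} (h : ReflTransGen (Step E) s t) :
    ∃ P ⊆ E, ∀ X : Set V, excess P X = (if s ∈ X then 1 else 0) - (if t ∈ X then 1 else 0) := by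
  obtain ⟨l, h1, h2, h3, h4⟩ := exists_nodup_chain h
  exact ⟨arcsOf l, fun e he => mem_of_mem_arcsOf h2 he, excess_arcsOf h1 h3 h4⟩

/-! ### Menger's theorem for arc-disjoint dipaths -/

/-- Paths can be peeled off greedily, since a path lowers the excess of every separating set by
exactly one. Cut sizes would not do: a path may cross a cut several times. -/
lemma paths_of_excess (n : ℕ) (E : Finset (V × V)) (s t : V)
    (h : ∀ X : Set V, s ∈ X → t ∉ X → (n : ℤ) ≤ excess E X) :
    ∃ P : Fin n → List V, (∀ i, (P i).Nodup ∧ (P i).IsChain (Step E) ∧ (P i).head? = some s ∧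
      (P i).getLast? = some t) ∧ Pairwise fun i j => Disjoint (arcsOf (P i)) (arcsOf (P j)) := by
  induction n generalizing E with
  | zero => exact ⟨fun i => i.elim0, fun i => i.elim0, fun i => i.elim0⟩
  | succ n ih =>
    have hr : ReflTransGen (Step E) s t := by
      refine reach_of_cuts fun X hs ht => exists_of_cut_pos ?_
      have := h X hs ht
      rw [excess_eq_cut_sub] at this
      push_cast at this
      omega
    obtain ⟨l, h1, h2, h3, h4⟩ := exists_nodup_chain hr
    have hl : arcsOf l ⊆ E := fun e he => mem_of_mem_arcsOf h2 he
    obtain ⟨P, hP, hd⟩ := ih (E \ arcsOf l) (fun X hs ht => by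
      have := h X hs ht
      rw [excess_sdiff_arcs hl, excess_arcsOf h1 h3 h4]
      simp only [hs, ht, if_true, if_false]
      push_cast at this
      omega)
    have hdl : ∀ i, Disjoint (arcsOf l) (arcsOf (P i)) := fun i => by
      rw [Finset.disjoint_left]
      intro e he he'
      have : e ∈ E \ arcsOf l := mem_of_mem_arcsOf (hP i).2.1 he'
      exact (Finset.mem_sdiff.1 this).2 he
    refine ⟨Fin.cons l P, fun i => ?_, fun i j hij => ?_⟩
    · refine Fin.cases ?_ (fun i => ?_) i
      · exact ⟨h1, h2, h3, h4⟩
      · simp only [Fin.cons_succ]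
        refine ⟨(hP i).1, (hP i).2.1.imp ?_, (hP i).2.2⟩
        intro p q hpq
        exact (Finset.mem_sdiff.1 hpq).1
    · revert hij
      refine Fin.cases ?_ (fun i => ?_) i <;> refine Fin.cases ?_ (fun j => ?_) j
      · simp
      · intro _; simpa using hdl j
      · intro _; simpa using (hdl i).symm
      · intro hij
        simpa using hd (fun h => hij (by rw [h]))

/-- Inside an arc set all of whose `s`-`t` cuts have at least `n` arcs there is one in which the
excess of every cut is at least `n`. -/
lemma exists_excess_of_cuts (n : ℕ) (E : Finset (V × V)) (s t : V)
    (h : ∀ X : Set V, s ∈ X → t ∉ X → n ≤ cut E X) :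
    ∃ F ⊆ E, ∀ X : Set V, s ∈ X → t ∉ X → (n : ℤ) ≤ excess F X := by
  -- In an inclusion-minimal `F` every arc leaves a tight set (`tight`), and strict submodularity
  -- then shows that no arc enters a tight set (`noenter`).
  obtain ⟨F, hFE, hF⟩ := exists_minimal_le_of_wellFoundedLT
    (fun F : Finset (V × V) => ∀ X : Set V, s ∈ X → t ∉ X → n ≤ cut F X) E h
  have tight : ∀ e ∈ F, ∃ Y : Set V, s ∈ Y ∧ t ∉ Y ∧ cut F Y = n ∧ e.1 ∈ Y ∧ e.2 ∉ Y := by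
    intro e he
    by_contra hcon
    push Not at hcon
    have : F ≤ F.erase e := hF.2 (y := F.erase e) (fun Y hs ht => by
      by_cases hY : e.1 ∈ Y ∧ e.2 ∉ Y
      · have h1 := hF.1 Y hs ht
        have h2 : cut F Y ≠ n := fun h => hY.2 (hcon Y hs ht h hY.1)
        have h3 : cut (F.erase e) Y = cut F Y - 1 := by
          rw [cut, leaving, Finset.filter_erase, Finset.card_erase_of_mem, cut, leaving]
          exact Finset.mem_filter.2 ⟨he, hY⟩
        omega
      · have h3 : cut (F.erase e) Y = cut F Y := by
          rw [cut, leaving, Finset.filter_erase, Finset.erase_eq_of_notMem, cut, leaving]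
          exact fun h => hY (Finset.mem_filter.1 h).2
        rw [h3]; exact hF.1 Y hs ht) (Finset.erase_subset e F)
    exact absurd (this he) (by simp)
  have noenter : ∀ Y : Set V, s ∈ Y → t ∉ Y → cut F Y = n → ∀ e ∈ F, e.1 ∉ Y → e.2 ∉ Y := by
    intro Y hs ht hY e he h1 h2
    obtain ⟨Z, hsZ, htZ, hZ, h3, h4⟩ := tight e he
    have := cut_inter_add_union_lt (X := Y) (Y := Z) he h3 h1 h2 h4
    have h5 := hF.1 (Y ∩ Z) ⟨hs, hsZ⟩ (fun h => ht h.1)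
    have h6 := hF.1 (Y ∪ Z) (Or.inl hs) (fun h => h.elim ht htZ)
    omega
  refine ⟨F, hFE, fun X hs ht => ?_⟩
  -- Induction on the number of entering arcs. An arc entering `X` leaves some tight `Y`; as no arc
  -- enters `Y`, both `X ∩ Y` and `X ∪ Y` have fewer entering arcs, and modularity with the excess
  -- `n` of `Y` returns the bound to `X`.
  induction hm : cut F Xᶜ using Nat.strong_induction_on generalizing X with
  | _ m ih =>
    by_cases hm0 : m = 0
    · rw [excess_eq_cut_sub, hm, hm0]
      have := hF.1 X hs ht
      push_cast; omega
    · obtain ⟨g, hg, hg1, hg2⟩ := exists_of_cut_pos (E := F) (X := Xᶜ) (by omega)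
      obtain ⟨Y, hsY, htY, hY, h1, h2⟩ := tight g hg
      have hno := noenter Y hsY htY hY
      have hlt : ∀ Z : Set V, g ∉ leaving F Zᶜ →
          (∀ e ∈ F, e.1 ∉ Z → e.2 ∈ Z → e.1 ∉ X ∧ e.2 ∈ X) → cut F Zᶜ < m := by
        intro Z hgZ hsub
        rw [← hm]
        refine Finset.card_lt_card ⟨fun e he => ?_, fun hh => ?_⟩
        · rw [mem_leaving] at he ⊢
          have := hsub e he.1 he.2.1 (not_not.1 he.2.2)
          exact ⟨he.1, this.1, not_not.2 this.2⟩
        · exact hgZ (hh (mem_leaving.2 ⟨hg, hg1, hg2⟩))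
      rw [Set.mem_compl_iff] at hg1
      rw [Set.mem_compl_iff, not_not] at hg2
      have hi := ih _ (hlt (X ∩ Y) (by simp [mem_leaving, h2]) (by
        intro e he h3 h4
        refine ⟨fun h5 => ?_, h4.1⟩
        exact hno e he (fun h6 => h3 ⟨h5, h6⟩) h4.2)) (X ∩ Y) ⟨hs, hsY⟩ (fun h => ht h.1) rfl
      have hu := ih _ (hlt (X ∪ Y) (by simp [mem_leaving, h1]) (by
        intro e he h3 h4
        refine ⟨fun h5 => h3 (Or.inl h5), h4.resolve_right ?_⟩
        exact hno e he (fun h6 => h3 (Or.inr h6)))) (X ∪ Y) (Or.inl hs)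
          (fun h => h.elim ht htY) rfl
      have hYe : excess F Y = n := by
        rw [excess_eq_cut_sub, hY]
        have : cut F Yᶜ = 0 := by
          rw [cut, Finset.card_eq_zero, Finset.eq_empty_iff_forall_notMem]
          intro e he
          simp only [mem_leaving, Set.mem_compl_iff, not_not] at he
          exact hno e he.1 he.2.1 he.2.2
        rw [this]; simp
      have := excess_inter_add_union F X Y
      omega

theorem menger (n : ℕ) (E : Finset (V × V)) (s t : V)
    (h : ∀ X : Set V, s ∈ X → t ∉ X → n ≤ cut E X) :
    ∃ P : Fin n → List V, (∀ i, (P i).Nodup ∧ (P i).IsChain (Step E) ∧ (P i).head? = some s ∧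
      (P i).getLast? = some t) ∧ Pairwise fun i j => Disjoint (arcsOf (P i)) (arcsOf (P j)) := by
  obtain ⟨F, hFE, hF⟩ := exists_excess_of_cuts n E s t h
  obtain ⟨P, hP, hd⟩ := paths_of_excess n F s t hF
  exact ⟨P, fun i => ⟨(hP i).1, (hP i).2.1.imp fun p q hpq => hFE hpq, (hP i).2.2⟩, hd⟩

/-! ### Lovász's theorem on balanced digraphs -/

lemma excess_union_of_disjoint (E : Finset (V × V)) {X Y : Set V} (h : Disjoint X Y) :
    excess E (X ∪ Y) = excess E X + excess E Y := by
  have := excess_inter_add_union E X Y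
  rw [Set.disjoint_iff_inter_eq_empty.1 h] at this
  simpa [excess] using this

/-- Call a set tight if exactly `k` arcs enter it. A maximal tight `Y ⊆ S` has at least `k` leaving
arcs, hence nonnegative excess. A tight set meeting `Y` could be merged into it by submodularity, so
the points of `S \ Y` are covered by tight sets inside `S \ Y`, and induction applies. -/
lemma excess_nonneg_of_cover {E : Finset (V × V)} [Finite V] {a : V} {k : ℕ} {S₀ : Set V}
    (ha : a ∈ S₀)
    (hk : ∀ X : Set V, (∃ p ∈ S₀, p ∈ X) → (∃ q ∈ S₀, q ∉ X) → k ≤ cut E X) (S : Set V)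
    (hS : S ⊆ S₀ \ {a}) (hc : ∀ z ∈ S, ∃ Y ⊆ S, z ∈ Y ∧ cut E Yᶜ = k) :
    0 ≤ excess E S := by
  induction hn : S.ncard using Nat.strong_induction_on generalizing S with
  | _ n ih =>
    rcases S.eq_empty_or_nonempty with rfl | ⟨z, hz⟩
    · simp [excess]
    · obtain ⟨Y₀, hY₀⟩ := hc z hz
      obtain ⟨Y, hYY, hY⟩ := exists_maximal_ge_of_wellFoundedGT
        (fun Y : Set V => Y ⊆ S ∧ Y.Nonempty ∧ cut E Yᶜ = k) Y₀
          ⟨hY₀.1, ⟨z, hY₀.2.1⟩, hY₀.2.2⟩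
      obtain ⟨⟨hYS, ⟨y, hy⟩, hYk⟩, hmax⟩ := hY
      have hSY : Y ∪ S \ Y = S := Set.union_sdiff_cancel hYS
      have hex := excess_union_of_disjoint E (X := Y) (Y := S \ Y) disjoint_sdiff_self_right
      rw [hSY] at hex
      have h1 : 0 ≤ excess E Y := by
        rw [excess_eq_cut_sub, hYk]
        have := hk Y ⟨y, (hS (hYS hy)).1, hy⟩ ⟨a, ha, fun h => (hS (hYS h)).2 rfl⟩
        omega
      have hcard : (S \ Y).ncard < n := by
        rw [← hn]
        exact Set.ncard_lt_ncard ⟨Set.sdiff_subset, fun h => (h (hYS hy)).2 hy⟩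
      have h2 := ih _ hcard (S \ Y) (Set.sdiff_subset.trans hS) (fun z hz => by
        obtain ⟨Z, hZS, hzZ, hZk⟩ := hc z hz.1
        refine ⟨Z, fun q hq => ⟨hZS hq, fun hqY => ?_⟩, hzZ, hZk⟩
        have hle : Y ⊆ Y ∪ Z := Set.subset_union_left
        refine hz.2 (hmax (y := Y ∪ Z) ⟨Set.union_subset hYS hZS, ⟨y, Or.inl hy⟩, ?_⟩ hle
          (Or.inr hzZ))
        have hsub := cut_inter_add_union_le E Yᶜ Zᶜ
        rw [← Set.compl_union, ← Set.compl_inter, hYk, hZk] at hsub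
        have h3 := hk (Y ∪ Z)ᶜ ⟨a, ha, fun h => h.elim (fun h => (hS (hYS h)).2 rfl)
          (fun h => (hS (hZS h)).2 rfl)⟩ ⟨y, (hS (hYS hy)).1, fun h => h (Or.inl hy)⟩
        have h4 := hk (Y ∩ Z)ᶜ ⟨a, ha, fun h => (hS (hYS h.1)).2 rfl⟩
          ⟨q, (hS (hYS hqY)).1, fun h => h ⟨hqY, hq⟩⟩
        omega) rfl
      omega

lemma excess_eq_sum [Fintype V] (E : Finset (V × V)) (X : Set V) :
    excess E X = ∑ v : V, if v ∈ X then excess E {v} else 0 := by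
  have : ∀ v, (if v ∈ X then excess E {v} else 0) =
      ∑ e ∈ E, ((if e.1 = v then (if e.1 ∈ X then 1 else 0) else 0) -
        (if e.2 = v then (if e.2 ∈ X then 1 else 0) else 0) : ℤ) := by
    intro v
    by_cases hv : v ∈ X
    · simp only [hv, if_true, excess, Set.mem_singleton_iff]
      refine Finset.sum_congr rfl fun e _ => ?_
      by_cases h1 : e.1 = v <;> by_cases h2 : e.2 = v <;> simp [h1, h2, hv]
    · simp only [hv, if_false]
      symm
      refine Finset.sum_eq_zero fun e _ => ?_
      by_cases h1 : e.1 = v <;> by_cases h2 : e.2 = v <;> simp [h1, h2, hv]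
  rw [Finset.sum_congr rfl fun v _ => this v, Finset.sum_comm, excess]
  refine Finset.sum_congr rfl fun e _ => ?_
  rw [Finset.sum_sub_distrib]
  simp

/-- If all cuts separating `S₀` have at least `k` arcs and any two vertices of `S₀` are separated
in both directions by cuts with at most `k` arcs, then the arc set is balanced. -/
theorem excess_eq_zero [Finite V] {E : Finset (V × V)} {k : ℕ} {S₀ : Set V}
    (hE : ∀ e ∈ E, e.1 ∈ S₀ ∧ e.2 ∈ S₀)
    (hk : ∀ X : Set V, (∃ p ∈ S₀, p ∈ X) → (∃ q ∈ S₀, q ∉ X) → k ≤ cut E X)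
    (hl : ∀ p ∈ S₀, ∀ q ∈ S₀, p ≠ q → ∃ X : Set V, p ∈ X ∧ q ∉ X ∧ cut E X ≤ k) (X : Set V) :
    excess E X = 0 := by
  have := Fintype.ofFinite V
  -- Complements of small cuts around `a` cover `S₀ \ {a}`, whose excess is therefore nonnegative;
  -- that of `S₀` is zero. Nonpositive excess then spreads from vertices to all sets, and
  -- complementation turns it into equality.
  have h1 : ∀ a, excess E {a} ≤ 0 := by
    intro a
    by_cases ha : a ∈ S₀
    · have h2 := excess_nonneg_of_cover ha hk (S₀ \ {a}) subset_rfl (fun z hz => by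
        obtain ⟨X, haX, hzX, hX⟩ := hl a ha z hz.1 (fun h => hz.2 h.symm)
        refine ⟨Xᶜ ∩ S₀, fun y hy => ⟨hy.2, fun h => hy.1 (h ▸ haX)⟩, ⟨hzX, hz.1⟩, ?_⟩
        have h3 : cut E (Xᶜ ∩ S₀)ᶜ = cut E X := by
          unfold cut
          congr 1
          ext e
          rw [mem_leaving, mem_leaving]
          refine and_congr_right fun he => ?_
          simp [hE e he]
        rw [h3]
        exact le_antisymm hX (hk X ⟨a, ha, haX⟩ ⟨z, hz.1, hzX⟩))
      have h3 : excess E S₀ = 0 := by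
        refine Finset.sum_eq_zero fun e he => ?_
        simp [(hE e he).1, (hE e he).2]
      have h4 := excess_union_of_disjoint E (X := S₀ \ {a}) (Y := {a}) disjoint_sdiff_self_left
      rw [Set.sdiff_union_of_subset (by simpa using ha), h3] at h4
      omega
    · refine le_of_eq (Finset.sum_eq_zero fun e he => ?_)
      have h2 : e.1 ≠ a := fun h => ha (h ▸ (hE e he).1)
      have h3 : e.2 ≠ a := fun h => ha (h ▸ (hE e he).2)
      simp [h2, h3]
  have h2 : ∀ X : Set V, excess E X ≤ 0 := by
    intro X
    rw [excess_eq_sum]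
    refine Finset.sum_nonpos fun v _ => ?_
    split_ifs
    · exact h1 v
    · exact le_rfl
  have h3 := h2 Xᶜ
  rw [excess_compl] at h3
  have := h2 X
  omega

/-! ### Acyclic relations -/

/-- The monochromatic arcs of `E`. -/
def Mono {C : Type*} (E : Finset (V × V)) (φ : V → C) (p q : V) : Prop := (p, q) ∈ E ∧ φ p = φ q

def Acyc {α : Type*} (R : α → α → Prop) : Prop := ∀ v, ¬ TransGen R v v

/-- `E` has a `k`-dicolouring. -/
def Col (k : ℕ) (E : Finset (V × V)) : Prop := ∃ φ : V → Fin k, Acyc (Mono E φ)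

/-- The arcs of `E` inside `X`. -/
noncomputable def restr (E : Finset (V × V)) (X : Set V) : Finset (V × V) :=
  E.filter fun e => e.1 ∈ X ∧ e.2 ∈ X

lemma mem_restr {E : Finset (V × V)} {X : Set V} {e : V × V} :
    e ∈ restr E X ↔ e ∈ E ∧ e.1 ∈ X ∧ e.2 ∈ X := Finset.mem_filter

lemma restr_subset (E : Finset (V × V)) (X : Set V) : restr E X ⊆ E := Finset.filter_subset _ _

section Relations

variable {α β : Type*} {R S : α → α → Prop}

lemma Acyc.lift {R' : β → β → Prop} (h : Acyc R') (f : α → β)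
    (hf : ∀ p q, R p q → R' (f p) (f q)) : Acyc R :=
  fun v hv => h (f v) (TransGen.lift f hf v v hv)

lemma Acyc.mono (h : Acyc S) (hRS : ∀ p q, R p q → S p q) : Acyc R := h.lift id hRS

lemma reach_congr {C : Type*} {φ : α → C} (hφ : ∀ p q, R p q → φ p = φ q) {p q : α}
    (h : ReflTransGen R p q) : φ p = φ q := by
  induction h with
  | refl => rfl
  | tail _ h ih => exact ih.trans (hφ _ _ h)

lemma transGen_add_arc {p q y z : α} (h : TransGen (fun a b => R a b ∨ a = p ∧ b = q) y z) :
    TransGen R y z ∨ ReflTransGen R y p ∧ ReflTransGen R q z := by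
  induction h with
  | single h =>
    rcases h with h | ⟨rfl, rfl⟩
    · exact Or.inl (.single h)
    · exact Or.inr ⟨.refl, .refl⟩
  | tail _ h ih =>
    rcases h with h | ⟨rfl, rfl⟩
    · exact ih.imp (fun h' => h'.tail h) (fun h' => ⟨h'.1, h'.2.tail h⟩)
    · exact Or.inr ⟨ih.elim TransGen.to_reflTransGen And.left, .refl⟩

lemma reach_add_arc {p q y z : α} (h : ReflTransGen (fun a b => R a b ∨ a = p ∧ b = q) y z) :
    ReflTransGen R y z ∨ ReflTransGen R y p ∧ ReflTransGen R q z := by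
  rcases reflTransGen_iff_eq_or_transGen.1 h with rfl | h
  · exact Or.inl .refl
  · exact (transGen_add_arc h).imp TransGen.to_reflTransGen id

lemma Acyc.add_arc (h : Acyc R) {p q : α} (hqp : ¬ ReflTransGen R q p) :
    Acyc (fun a b => R a b ∨ a = p ∧ b = q) := fun v hv =>
  (transGen_add_arc hv).elim (h v) fun h' => hqp (h'.2.trans h'.1)

/-- A walk can change relation only at `x`, and acyclicity forbids a return to `x`, so it changes at
most once. -/
lemma transGen_glue {A C : Set α} {x : α} (hAC : ∀ y ∈ A, y ∈ C → y = x)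
    (hR : ∀ p q, R p q → p ∈ A ∧ q ∈ A) (hS : ∀ p q, S p q → p ∈ C ∧ q ∈ C)
    (hRa : Acyc R) (hSa : Acyc S) {y z : α} (h : TransGen (fun a b => R a b ∨ S a b) y z) :
    (y ∈ A ∧ z ∈ A ∧ TransGen R y z) ∨ (y ∈ C ∧ z ∈ C ∧ TransGen S y z) ∨
      (y ∈ A ∧ z ∈ C ∧ TransGen R y x ∧ TransGen S x z) ∨
      (y ∈ C ∧ z ∈ A ∧ TransGen S y x ∧ TransGen R x z) := by
  induction h with
  | single h =>
    rcases h with h | h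
    · exact Or.inl ⟨(hR _ _ h).1, (hR _ _ h).2, .single h⟩
    · exact Or.inr (Or.inl ⟨(hS _ _ h).1, (hS _ _ h).2, .single h⟩)
  | @tail b c _ h ih =>
    rcases h with h | h
    · obtain ⟨hb, hc⟩ := hR _ _ h
      rcases ih with ⟨hy, _, h1⟩ | ⟨hy, hb', h1⟩ | ⟨hy, hb', h1, h2⟩ | ⟨hy, _, h1, h2⟩
      · exact Or.inl ⟨hy, hc, h1.tail h⟩
      · obtain rfl := hAC b hb hb'
        exact Or.inr (Or.inr (Or.inr ⟨hy, hc, h1, .single h⟩))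
      · obtain rfl := hAC b hb hb'
        exact absurd h2 (hSa _)
      · exact Or.inr (Or.inr (Or.inr ⟨hy, hc, h1, h2.tail h⟩))
    · obtain ⟨hb, hc⟩ := hS _ _ h
      rcases ih with ⟨hy, hb', h1⟩ | ⟨hy, _, h1⟩ | ⟨hy, _, h1, h2⟩ | ⟨hy, hb', h1, h2⟩
      · obtain rfl := hAC b hb' hb
        exact Or.inr (Or.inr (Or.inl ⟨hy, hc, h1, .single h⟩))
      · exact Or.inr (Or.inl ⟨hy, hc, h1.tail h⟩)
      · exact Or.inr (Or.inr (Or.inl ⟨hy, hc, h1, h2.tail h⟩))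
      · obtain rfl := hAC b hb' hb
        exact absurd h2 (hRa _)

lemma Acyc.glue {A C : Set α} {x : α} (hAC : ∀ y ∈ A, y ∈ C → y = x)
    (hR : ∀ p q, R p q → p ∈ A ∧ q ∈ A) (hS : ∀ p q, S p q → p ∈ C ∧ q ∈ C)
    (hRa : Acyc R) (hSa : Acyc S) : Acyc (fun a b => R a b ∨ S a b) := by
  intro v hv
  rcases transGen_glue hAC hR hS hRa hSa hv with h | h | ⟨h1, h2, h3, h4⟩ | ⟨h1, h2, h3, h4⟩
  · exact hRa v h.2.2
  · exact hSa v h.2.2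
  · obtain rfl := hAC v h1 h2
    exact hRa _ h3
  · obtain rfl := hAC v h2 h1
    exact hSa _ h3

/-- Two acyclic relations meeting in the two points `a`, `b` only, the first of which does not join
`a` and `b`, have an acyclic union. -/
lemma Acyc.glue_two {A B : Set α} {a b : α} (hAB : ∀ y ∈ A, y ∈ B → y = a ∨ y = b)
    (hR : ∀ p q, R p q → p ∈ A ∧ q ∈ A) (hS : ∀ p q, S p q → p ∈ B ∧ q ∈ B)
    (hRa : Acyc R) (hSa : Acyc S) (hab : ¬ TransGen R a b) (hba : ¬ TransGen R b a) :
    Acyc (fun p q => R p q ∨ S p q) := by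
  have no : ∀ s s', (s = a ∨ s = b) → (s' = a ∨ s' = b) → ¬ TransGen R s s' := by
    rintro s s' (rfl | rfl) (rfl | rfl)
    exacts [hRa _, hab, hba, hRa _]
  -- Once a walk from `a` or `b` takes a step of `R`, it cannot come back to `a` or `b`, the only
  -- points where it could switch to `S` again.
  have key : ∀ s z, (s = a ∨ s = b) → TransGen (fun p q => R p q ∨ S p q) s z →
      TransGen S s z ∨ ∃ s', (s' = a ∨ s' = b) ∧ TransGen R s' z := by
    intro s z hs h
    induction h with
    | single h => exact h.elim (fun h => Or.inr ⟨s, hs, .single h⟩) (fun h => Or.inl (.single h))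
    | @tail y z hy h ih =>
      rcases h with h | h
      · rcases ih with ih | ⟨s', hs', ih⟩
        · obtain ⟨w, _, hw⟩ := TransGen.tail'_iff.1 ih
          exact Or.inr ⟨y, hAB y (hR _ _ h).1 (hS _ _ hw).2, .single h⟩
        · exact Or.inr ⟨s', hs', ih.tail h⟩
      · rcases ih with ih | ⟨s', hs', ih⟩
        · exact Or.inl (ih.tail h)
        · obtain ⟨w, _, hw⟩ := TransGen.tail'_iff.1 ih
          exact absurd ih (no s' y hs' (hAB y (hR _ _ hw).2 (hS _ _ h).1))
  have noS : ∀ s, (s = a ∨ s = b) → ¬ TransGen (fun p q => R p q ∨ S p q) s s := by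
    intro s hs h
    rcases key s s hs h with h | ⟨s', hs', h⟩
    · exact hSa s h
    · exact no s' s hs' hs h
  have pass : ∀ y z, TransGen (fun p q => R p q ∨ S p q) y z → TransGen R y z ∨ TransGen S y z ∨
      ∃ s, (s = a ∨ s = b) ∧ ReflTransGen (fun p q => R p q ∨ S p q) y s ∧
        ReflTransGen (fun p q => R p q ∨ S p q) s z := by
    intro y z h
    induction h with
    | single h => exact h.elim (fun h => Or.inl (.single h)) (fun h => Or.inr (Or.inl (.single h)))
    | @tail z z' hz h ih =>
      rcases ih with ih | ih | ⟨s, hs, h1, h2⟩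
      · rcases h with h | h
        · exact Or.inl (ih.tail h)
        · obtain ⟨w, _, hw⟩ := TransGen.tail'_iff.1 ih
          exact Or.inr (Or.inr ⟨z, hAB z (hR _ _ hw).2 (hS _ _ h).1, hz.to_reflTransGen,
            .single (Or.inr h)⟩)
      · rcases h with h | h
        · obtain ⟨w, _, hw⟩ := TransGen.tail'_iff.1 ih
          exact Or.inr (Or.inr ⟨z, hAB z (hR _ _ h).1 (hS _ _ hw).2, hz.to_reflTransGen,
            .single (Or.inl h)⟩)
        · exact Or.inr (Or.inl (ih.tail h))
      · exact Or.inr (Or.inr ⟨s, hs, h1, h2.tail h⟩)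
  intro v hv
  rcases pass v v hv with h | h | ⟨s, hs, h1, h2⟩
  · exact hRa v h
  · exact hSa v h
  · exact noS s hs ((TransGen.trans_right h2 hv).trans_left h1)

/-- A cycle that meets a set never left by `R` stays inside it. -/
lemma Acyc.of_closed {X : Set α} (hX : ∀ p q, R p q → p ∈ X → q ∈ X)
    (h1 : Acyc fun p q => R p q ∧ p ∈ X ∧ q ∈ X)
    (h2 : Acyc fun p q => R p q ∧ p ∉ X ∧ q ∉ X) : Acyc R := by
  intro v hv
  by_cases hvX : v ∈ X
  · have : ∀ z, TransGen R v z → z ∈ X ∧ TransGen (fun p q => R p q ∧ p ∈ X ∧ q ∈ X) v z := by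
      intro z hz
      induction hz with
      | single h => exact ⟨hX _ _ h hvX, .single ⟨h, hvX, hX _ _ h hvX⟩⟩
      | tail _ h ih => exact ⟨hX _ _ h ih.1, ih.2.tail ⟨h, ih.1, hX _ _ h ih.1⟩⟩
    exact h1 v (this v hv).2
  · have : ∀ z, TransGen R z v → z ∉ X ∧ TransGen (fun p q => R p q ∧ p ∉ X ∧ q ∉ X) z v := by
      intro z hz
      induction hz using TransGen.head_induction_on with
      | single h => exact ⟨fun hz => hvX (hX _ _ h hz), .single ⟨h, fun hz => hvX (hX _ _ h hz), hvX⟩⟩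
      | head h _ ih =>
        have hz := fun hz => ih.1 (hX _ _ h hz)
        exact ⟨hz, ih.2.head ⟨h, hz, ih.1⟩⟩
    exact h2 v (this v hv).2

end Relations

/-! ### Cuts in arc sets that are not dicolourable -/

lemma Col.mono {k : ℕ} {E F : Finset (V × V)} (h : Col k F) (hEF : E ⊆ F) : Col k E := by
  obtain ⟨φ, hφ⟩ := h
  exact ⟨φ, hφ.mono fun p q hpq => ⟨hEF hpq.1, hpq.2⟩⟩

lemma Acyc.comp_injective {C C' : Type*} {E : Finset (V × V)} {φ : V → C} (h : Acyc (Mono E φ))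
    {σ : C → C'} (hσ : Function.Injective σ) : Acyc (Mono E fun v => σ (φ v)) :=
  h.mono fun _ _ hpq => ⟨hpq.1, hσ hpq.2⟩

/-- Rotate the colours on `X` by `j`. Both sides stay acyclic, so if no arc leaving `X` became
monochromatic, `X` would be closed under monochromatic steps and the rotated map a dicolouring. -/
lemma exists_shift {k : ℕ} [NeZero k] {E : Finset (V × V)} (hE : ¬ Col k E) {X : Set V}
    {φ : V → Fin k} (h1 : Acyc (Mono (restr E X) φ)) (h2 : Acyc (Mono (restr E Xᶜ) φ))
    (j : Fin k) : ∃ e ∈ leaving E X, φ e.2 - φ e.1 = j := by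
  by_contra hcon
  push Not at hcon
  refine hE ⟨fun v => if v ∈ X then φ v + j else φ v, Acyc.of_closed (X := X) ?_ ?_ ?_⟩
  · rintro p q ⟨hpq, hc⟩ hp
    by_contra hq
    refine hcon (p, q) (mem_leaving.2 ⟨hpq, hp, hq⟩) ?_
    simp only [hp, hq, if_true, if_false] at hc
    simp [← hc]
  · refine h1.mono ?_
    rintro p q ⟨⟨hpq, hc⟩, hp, hq⟩
    simp only [hp, hq, if_true] at hc
    exact ⟨mem_restr.2 ⟨hpq, hp, hq⟩, add_right_cancel hc⟩
  · refine h2.mono ?_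
    rintro p q ⟨⟨hpq, hc⟩, hp, hq⟩
    simp only [hp, hq, if_false] at hc
    exact ⟨mem_restr.2 ⟨hpq, hp, hq⟩, hc⟩

lemma le_cut_of_acyc {k : ℕ} [NeZero k] {E : Finset (V × V)} (hE : ¬ Col k E) {X : Set V}
    {φ : V → Fin k} (h1 : Acyc (Mono (restr E X) φ)) (h2 : Acyc (Mono (restr E Xᶜ) φ)) :
    k ≤ cut E X := by
  have : (Finset.univ : Finset (Fin k)) ⊆ (leaving E X).image fun e => φ e.2 - φ e.1 := by
    intro j _
    obtain ⟨e, he, hj⟩ := exists_shift hE h1 h2 j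
    exact Finset.mem_image.2 ⟨e, he, hj⟩
  have := (Finset.card_le_card this).trans Finset.card_image_le
  rwa [Finset.card_univ, Fintype.card_fin] at this

/-- In a cut of at most `k` arcs each of the `k` colour differences occurs exactly once, in
particular the difference zero. -/
lemma eq_of_mono_leaving {k : ℕ} [NeZero k] {E : Finset (V × V)} (hE : ¬ Col k E) {X : Set V}
    {φ : V → Fin k} (h1 : Acyc (Mono (restr E X) φ)) (h2 : Acyc (Mono (restr E Xᶜ) φ))
    (hX : cut E X ≤ k) {e e' : V × V} (he : e ∈ leaving E X) (he' : e' ∈ leaving E X)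
    (hm : φ e.1 = φ e.2) (hm' : φ e'.1 = φ e'.2) : e = e' := by
  have hsub : (Finset.univ : Finset (Fin k)) ⊆ (leaving E X).image fun e => φ e.2 - φ e.1 := by
    intro j _
    obtain ⟨e, he, hj⟩ := exists_shift hE h1 h2 j
    exact Finset.mem_image.2 ⟨e, he, hj⟩
  have hinj := Finset.card_image_iff.1 (le_antisymm (Finset.card_image_le
    (s := leaving E X) (f := fun e => φ e.2 - φ e.1)) (by
      have := Finset.card_le_card hsub
      rw [Finset.card_univ, Fintype.card_fin] at this
      exact hX.trans this))
  refine hinj he he' ?_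
  simp [hm, hm']

/-- The vertices incident with an arc. -/
def verts (K : Finset (V × V)) : Set V := {v | ∃ e ∈ K, e.1 = v ∨ e.2 = v}

lemma fst_mem_verts {K : Finset (V × V)} {e : V × V} (he : e ∈ K) : e.1 ∈ verts K :=
  ⟨e, he, Or.inl rfl⟩

lemma snd_mem_verts {K : Finset (V × V)} {e : V × V} (he : e ∈ K) : e.2 ∈ verts K :=
  ⟨e, he, Or.inr rfl⟩

lemma col_of_ssubset {k : ℕ} {K : Finset (V × V)} (hK : Minimal (fun K => ¬ Col k K) K)
    {F : Finset (V × V)} (hF : F ⊆ K) (hne : F ≠ K) : Col k F := by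
  by_contra h
  exact hne (le_antisymm hF (hK.2 h hF))

/-- As `X` separates vertices of `K`, the arcs inside `X` and those inside its complement are proper
subsets of `K`. Both are colourable, and the rotation argument applies to the pasted colouring. -/
lemma le_cut_of_minimal {k : ℕ} [NeZero k] {K : Finset (V × V)}
    (hK : Minimal (fun K => ¬ Col k K) K) (X : Set V) (hp : ∃ p ∈ verts K, p ∈ X)
    (hq : ∃ q ∈ verts K, q ∉ X) : k ≤ cut K X := by
  have h1 : Col k (restr K X) := by
    refine col_of_ssubset hK (restr_subset K X) fun h => ?_
    obtain ⟨q, ⟨e, he, heq⟩, hq⟩ := hq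
    rw [← h, mem_restr] at he
    rcases heq with rfl | rfl
    exacts [hq he.2.1, hq he.2.2]
  have h2 : Col k (restr K Xᶜ) := by
    refine col_of_ssubset hK (restr_subset K _) fun h => ?_
    obtain ⟨q, ⟨e, he, heq⟩, hq⟩ := hp
    rw [← h, mem_restr] at he
    rcases heq with rfl | rfl
    exacts [he.2.1 hq, he.2.2 hq]
  obtain ⟨φ₁, hφ₁⟩ := h1
  obtain ⟨φ₂, hφ₂⟩ := h2
  refine le_cut_of_acyc (φ := fun v => if v ∈ X then φ₁ v else φ₂ v) hK.1 (hφ₁.mono ?_)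
    (hφ₂.mono ?_)
  · rintro p q ⟨hpq, hc⟩
    have := mem_restr.1 hpq
    simp only at this
    simp only [this.2.1, this.2.2, if_true] at hc
    exact ⟨hpq, hc⟩
  · rintro p q ⟨hpq, hc⟩
    have := mem_restr.1 hpq
    simp only [Set.mem_compl_iff] at this
    simp only [this.2.1, this.2.2, if_false] at hc
    exact ⟨hpq, hc⟩

lemma exists_minimal_not_col {k : ℕ} {E : Finset (V × V)} (hE : ¬ Col k E) :
    ∃ K ⊆ E, Minimal (fun K => ¬ Col k K) K := by
  obtain ⟨K, hKE, hK⟩ := exists_minimal_le_of_wellFoundedLT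
    (fun F : Finset (V × V) => ¬ Col k F) E hE
  exact ⟨K, hKE, hK⟩

lemma nonempty_of_not_col {k : ℕ} [NeZero k] {K : Finset (V × V)} (hK : ¬ Col k K) :
    K.Nonempty := by
  by_contra h
  rw [Finset.not_nonempty_iff_eq_empty] at h
  refine hK ⟨fun _ => 0, fun v hv => ?_⟩
  obtain ⟨w, _, hw⟩ := TransGen.tail'_iff.1 hv
  simp [h, Mono] at hw

/-! ### Extremal digraphs in terms of cuts -/

/-- Deleting `z` leaves a digraph whose underlying graph is connected. -/
def ConnOff (E : Finset (V × V)) (z : V) : Prop :=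
  ∀ S : Set V, (∀ p q, p ≠ z → q ≠ z → ((p, q) ∈ E ∨ (q, p) ∈ E) → p ∈ S → q ∈ S) →
    ∀ p q, p ≠ z → q ≠ z → p ∈ S → q ∈ S

/-- The reformulation of `k`-extremality in terms of cuts. -/
structure Core (k : ℕ) (E : Finset (V × V)) : Prop where
  loopless : ∀ v, (v, v) ∉ E
  not_col : ¬ Col k E
  separated : ∀ p q, p ≠ q → ∃ X : Set V, p ∈ X ∧ q ∉ X ∧ cut E X ≤ k
  strong : ∀ X : Set V, ∀ p ∈ X, ∀ q ∉ X, ∃ e ∈ E, e.1 ∈ X ∧ e.2 ∉ X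
  conn : ∀ z, ConnOff E z

namespace Core

variable {k : ℕ} {E : Finset (V × V)}

/-- If all cuts of `K ⊆ E` separating vertices of `K` have at least `k` arcs, then the remaining
arcs of `E` do not link vertices of `K`. -/
lemma eq_of_reach_sdiff (h : Core k E) {K' : Finset (V × V)} (hK' : K' ⊆ E) {S : Set V}
    (hc : ∀ X : Set V, (∃ p ∈ S, p ∈ X) → (∃ q ∈ S, q ∉ X) → k ≤ cut K' X)
    {p q : V} (hp : p ∈ S) (hq : q ∈ S) (hr : ReflTransGen (Step (E \ K')) p q) : p = q := by
  by_contra hne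
  obtain ⟨X, hpX, hqX, hX⟩ := h.separated p q hne
  obtain ⟨y, z, hyz, hy, hz, _, _⟩ := exists_leaving_of_reach hr hpX hqX
  have h1 := hc X ⟨p, hp, hpX⟩ ⟨q, hq, hqX⟩
  -- The cut `X` has at most `k` arcs and `K'` already supplies `k` of them; the crossing arc `yz`
  -- is one too many.
  have h2 : leaving K' X ⊂ leaving E X := by
    refine ⟨Finset.filter_subset_filter _ hK', fun hsub => ?_⟩
    have h3 := Finset.mem_sdiff.1 hyz
    have := hsub (mem_leaving.2 ⟨h3.1, hy, hz⟩)
    exact h3.2 (mem_leaving.1 this).1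
  have h3 := Finset.card_lt_card h2
  unfold cut at *
  omega

/-- A `k`-extremal digraph is arc-critical. -/
theorem eq_of_not_col [NeZero k] (h : Core k E) {K : Finset (V × V)} (hKE : K ⊆ E) (hK : ¬ Col k K) :
    K = E := by
  obtain ⟨M, hMK, hM⟩ := exists_minimal_not_col hK
  have hME := hMK.trans hKE
  suffices hs : M = E from le_antisymm hKE (hs ▸ hMK)
  have huniq : ∀ {p q : V}, p ∈ verts M → q ∈ verts M → ReflTransGen (Step (E \ M)) p q → p = q :=
    fun hp hq hr => h.eq_of_reach_sdiff hME (le_cut_of_minimal hM) hp hq hr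
  have hstep : ∀ {p q : V}, (p, q) ∈ E → p ∉ verts M ∨ q ∉ verts M → Step (E \ M) p q := by
    intro p q hpq hor
    refine Finset.mem_sdiff.2 ⟨hpq, fun hm => ?_⟩
    exact hor.elim (fun h => h (fst_mem_verts hm)) (fun h => h (snd_mem_verts hm))
  obtain ⟨e₀, he₀⟩ := nonempty_of_not_col hM.1
  have hne₀ : e₀.1 ≠ e₀.2 := fun heq => h.loopless e₀.1 (by
    have := hME he₀
    rwa [← Prod.mk.eta (p := e₀), ← heq] at this)
  have hout : ∀ y, ∃ q ∈ verts M, ReflTransGen (Step (E \ M)) y q := by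
    intro y
    by_contra hcon
    push Not at hcon
    obtain ⟨e, he, h1, h2⟩ := h.strong {z | ReflTransGen (Step (E \ M)) y z} y .refl e₀.1
      (hcon _ (fst_mem_verts he₀))
    refine h2 (h1.tail (hstep he (Or.inl fun hv => hcon _ hv h1)))
  have hin : ∀ y, ∃ p ∈ verts M, ReflTransGen (Step (E \ M)) p y := by
    intro y
    by_contra hcon
    push Not at hcon
    obtain ⟨e, he, h1, h2⟩ := h.strong {z | ReflTransGen (Step (E \ M)) z y}ᶜ e₀.1
      (hcon _ (fst_mem_verts he₀)) y (fun hh => hh .refl)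
    rw [Set.mem_compl_iff, not_not] at h2
    refine h1 (ReflTransGen.head (hstep he (Or.inr fun hv => hcon _ hv h2)) h2)
  -- Otherwise some arc `e` leaves `verts M`. The vertices outside `M` reached from `e.1` are then
  -- closed under adjacency away from `e.1`: by `hout` and `hin` every detour leads back to `M`, and
  -- by `huniq` it does so at `e.1`. So `e.1` would be a cutvertex.
  have hall : ∀ y, y ∈ verts M := by
    intro y
    by_contra hy
    obtain ⟨e, he, hp₀, hy₀⟩ := h.strong (verts M) e₀.1 (fst_mem_verts he₀) y hy
    have hclosed := h.conn e.1 {z | z ∉ verts M ∧ ReflTransGen (Step (E \ M)) e.1 z} (by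
      rintro p q hp hq hpq ⟨hpv, hpr⟩
      obtain ⟨r, hr, hpr'⟩ := hout p
      have hre : e.1 = r := huniq hp₀ hr (hpr.trans hpr')
      by_cases hqv : q ∈ verts M
      · exfalso
        rcases hpq with hpq | hpq
        · exact hq (huniq hp₀ hqv (hpr.tail (hstep hpq (Or.inl hpv)))).symm
        · have := huniq hqv hr (ReflTransGen.head (hstep hpq (Or.inr hpv)) hpr')
          exact hq (this.trans hre.symm)
      · refine ⟨hqv, ?_⟩
        rcases hpq with hpq | hpq
        · exact hpr.tail (hstep hpq (Or.inl hpv))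
        · obtain ⟨s, hs, hsq⟩ := hin q
          have := huniq hs hr (hsq.trans (ReflTransGen.head (hstep hpq (Or.inr hpv)) hpr'))
          rwa [this, ← hre] at hsq)
    have hne : e.2 ≠ e.1 := fun heq => hy₀ (heq ▸ hp₀)
    have hmem : e.2 ∈ {z | z ∉ verts M ∧ ReflTransGen (Step (E \ M)) e.1 z} :=
      ⟨hy₀, .single (hstep he (Or.inr hy₀))⟩
    by_cases h1 : e₀.1 = e.1
    · exact (hclosed e.2 e₀.2 hne (fun h2 => hne₀ (h1.trans h2.symm)) hmem).1 (snd_mem_verts he₀)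
    · exact (hclosed e.2 e₀.1 hne h1 hmem).1 (fst_mem_verts he₀)
  refine le_antisymm hME fun e he => ?_
  by_contra heM
  have := huniq (hall e.1) (hall e.2) (.single (Finset.mem_sdiff.2 ⟨he, heM⟩))
  exact h.loopless e.1 (by rwa [← Prod.mk.eta (p := e), ← this] at he)

lemma minimal [NeZero k] (h : Core k E) : Minimal (fun K => ¬ Col k K) E :=
  ⟨h.not_col, fun _ hK hKE => (h.eq_of_not_col hKE hK).ge⟩

lemma col_of_subset_of_notMem [NeZero k] (h : Core k E) {K : Finset (V × V)} (hKE : K ⊆ E) {e : V × V}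
    (he : e ∈ E) (heK : e ∉ K) : Col k K := by
  by_contra hK
  exact heK (h.eq_of_not_col hKE hK ▸ he)

lemma le_cut [NeZero k] (h : Core k E) {X : Set V} {p q : V} (hp : p ∈ X) (hq : q ∉ X) : k ≤ cut E X := by
  have hv : ∀ v w : V, v ≠ w → v ∈ verts E := fun v w hvw => by
    obtain ⟨e, he, h1, _⟩ := h.strong {v} v rfl w (fun h => hvw h.symm)
    exact ⟨e, he, Or.inl h1⟩
  have hpq : p ≠ q := fun h => hq (h ▸ hp)
  exact le_cut_of_minimal h.minimal X ⟨p, hv p q hpq, hp⟩ ⟨q, hv q p hpq.symm, hq⟩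

lemma excess_eq_zero [NeZero k] [Finite V] (h : Core k E) (X : Set V) : excess E X = 0 := by
  refine ArcSet.excess_eq_zero (S₀ := Set.univ) (k := k) (by simp) ?_ ?_ X
  · rintro X ⟨p, _, hp⟩ ⟨q, _, hq⟩
    exact h.le_cut hp hq
  · intro p _ q _ hpq
    exact h.separated p q hpq

/-- A minimal arc set without a `(k + 1)`-dicolouring would need at least `k + 1` arcs in a cut that
has at most `k`. -/
lemma col_succ (h : Core k E) : Col (k + 1) E := by
  by_contra hcon
  obtain ⟨K, hKE, hK⟩ := exists_minimal_not_col hcon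
  obtain ⟨e, he⟩ := nonempty_of_not_col hK.1
  have hne : e.1 ≠ e.2 := fun heq => h.loopless e.1 (by
    have := hKE he
    rwa [← Prod.mk.eta (p := e), ← heq] at this)
  obtain ⟨X, h1, h2, h3⟩ := h.separated _ _ hne
  have h4 := le_cut_of_minimal hK X ⟨_, fst_mem_verts he, h1⟩ ⟨_, snd_mem_verts he, h2⟩
  have h5 := cut_mono hKE X
  omega

end Core

/-! ### Translation of dicolourings, connectivity and extremality into cuts -/

/-- The arc set of a finite digraph. -/
noncomputable def arcs [Fintype V] (D : Digraph V) : Finset (V × V) :=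
  Finset.univ.filter fun e => D.Adj e.1 e.2

lemma mem_arcs [Fintype V] {D : Digraph V} {e : V × V} : e ∈ arcs D ↔ D.Adj e.1 e.2 := by
  simp [arcs]

lemma step_arcs [Fintype V] (D : Digraph V) : Step (arcs D) = D.Adj := by
  ext p q; exact mem_arcs

lemma reach_of_chain {R : V → V → Prop} {l : List V} {s t : V} (h : l.IsChain R)
    (hs : l.head? = some s) (ht : l.getLast? = some t) : ReflTransGen R s t := by
  induction l generalizing s with
  | nil => simp at hs
  | cons a l ih =>
    simp only [List.head?_cons, Option.some.injEq] at hs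
    subst hs
    cases l with
    | nil =>
      simp only [List.getLast?_singleton, Option.some.injEq] at ht
      subst ht
      exact .refl
    | cons b l =>
      rw [List.isChain_cons_cons] at h
      exact ReflTransGen.head h.1 (ih h.2 rfl (by simpa using ht))

lemma isAcyclic_iff (D : Digraph V) : D.IsAcyclic ↔ Acyc D.Adj := by
  constructor
  · intro h v hv
    obtain ⟨w, hvw, hwv⟩ := TransGen.head'_iff.1 hv
    obtain ⟨l, h1, h2, h3, h4⟩ := exists_nodup_chain hwv
    have hne : l ≠ [] := by rintro rfl; simp at h3
    refine h l ⟨hne, h1, h2, ?_⟩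
    rw [List.head?_eq_some_head hne, Option.some.injEq] at h3
    rw [List.getLast?_eq_some_getLast hne, Option.some.injEq] at h4
    rwa [h3, h4]
  · rintro h l ⟨hne, h1, h2, h3⟩
    have := reach_of_chain h2 (List.head?_eq_some_head hne) (List.getLast?_eq_some_getLast hne)
    exact h _ (TransGen.tail' this h3)

lemma isDicolouring_iff [Fintype V] (D : Digraph V) {k : ℕ} (φ : V → Fin k) :
    D.IsDicolouring φ ↔ Acyc (Mono (arcs D) φ) := by
  constructor
  · intro h v hv
    have := (isAcyclic_iff _).1 (h (φ v))
    have key : ∀ z, TransGen (Mono (arcs D) φ) v z → ∃ hz : φ z = φ v,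
        TransGen (D.induceOn {y | φ y = φ v}).Adj ⟨v, rfl⟩ ⟨z, hz⟩ := by
      intro z hz
      induction hz with
      | single h => exact ⟨h.2.symm, .single (mem_arcs.1 h.1)⟩
      | tail _ h ih =>
        obtain ⟨hy, ih⟩ := ih
        exact ⟨h.2.symm.trans hy, ih.tail (mem_arcs.1 h.1)⟩
    obtain ⟨_, h2⟩ := key v hv
    exact this _ h2
  · intro h i
    rw [isAcyclic_iff]
    refine h.lift Subtype.val fun p q hpq => ⟨mem_arcs.2 hpq, ?_⟩
    exact p.2.trans q.2.symm

lemma Col.succ {k : ℕ} {E : Finset (V × V)} (h : Col k E) : Col (k + 1) E := by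
  obtain ⟨φ, hφ⟩ := h
  exact ⟨_, hφ.comp_injective (Fin.castSucc_injective k)⟩

lemma Col.of_le {k m : ℕ} (hkm : k ≤ m) {E : Finset (V × V)} (h : Col k E) : Col m E := by
  induction hkm with
  | refl => exact h
  | step _ ih => exact ih.succ

lemma dichromaticNumber_eq_succ_iff [Fintype V] (D : Digraph V) (k : ℕ) :
    D.dichromaticNumber = k + 1 ↔ ¬ Col k (arcs D) ∧ Col (k + 1) (arcs D) := by
  have hset : {k : ℕ | ∃ φ : V → Fin k, D.IsDicolouring φ} = {k | Col k (arcs D)} := by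
    ext m
    exact exists_congr fun φ => isDicolouring_iff D φ
  rw [Digraph.dichromaticNumber, hset]
  constructor
  · intro h
    have hne : {k | Col k (arcs D)}.Nonempty := Nat.nonempty_of_sInf_eq_succ h
    refine ⟨fun hk => ?_, h ▸ Nat.sInf_mem hne⟩
    have := Nat.sInf_le (s := {k | Col k (arcs D)}) hk
    omega
  · rintro ⟨h1, h2⟩
    refine le_antisymm (Nat.sInf_le h2) (le_csInf ⟨_, h2⟩ fun m hm => ?_)
    by_contra hlt
    exact h1 (Col.of_le (by omega) hm)

lemma isStrong_iff [Fintype V] (D : Digraph V) :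
    D.IsStrong ↔ ∀ X : Set V, ∀ p ∈ X, ∀ q ∉ X, ∃ e ∈ arcs D, e.1 ∈ X ∧ e.2 ∉ X := by
  constructor
  · intro h X p hp q hq
    obtain ⟨l, _, h2, h3, h4⟩ := h p q
    obtain ⟨y, z, hyz, hy, hz, _⟩ := exists_leaving_of_reach (reach_of_chain h2 h3 h4) hp hq
    exact ⟨(y, z), mem_arcs.2 hyz, hy, hz⟩
  · intro h p q
    have : ReflTransGen (Step (arcs D)) p q := reach_of_cuts fun X hp hq => h X p hp q hq
    rw [step_arcs] at this
    exact exists_nodup_chain this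

lemma connOff_iff [Fintype V] (D : Digraph V) (v : V) :
    (D.toSimpleGraphInclusive.induce {z | z ≠ v}).Preconnected ↔ ConnOff (arcs D) v := by
  constructor
  · intro h S hS p q hp hq hpS
    have := (SimpleGraph.reachable_iff_reflTransGen _ _).1 (h ⟨p, hp⟩ ⟨q, hq⟩)
    have key : ∀ y, ReflTransGen (D.toSimpleGraphInclusive.induce {z | z ≠ v}).Adj ⟨p, hp⟩ y →
        (y : V) ∈ S := by
      intro y hy
      induction hy with
      | refl => exact hpS
      | @tail b c _ h ih =>
        refine hS b c b.2 c.2 ?_ ih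
        rw [mem_arcs, mem_arcs]
        exact h.2
    exact key _ this
  · rintro h ⟨p, hp⟩ ⟨q, hq⟩
    have := h {y | ∃ hy : y ≠ v, (D.toSimpleGraphInclusive.induce {z | z ≠ v}).Reachable
      ⟨p, hp⟩ ⟨y, hy⟩} (by
        rintro y z hy hz hyz ⟨_, hr⟩
        refine ⟨hz, ?_⟩
        by_cases hne : y = z
        · subst hne; exact hr
        · refine hr.trans (SimpleGraph.Adj.reachable ⟨hne, ?_⟩)
          rwa [mem_arcs, mem_arcs] at hyz) p q hp hq ⟨hp, .refl _⟩
    exact this.2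

lemma connected_of_isStrong [Nonempty V] (D : Digraph V) (h : D.IsStrong) :
    D.toSimpleGraphInclusive.Connected := by
  refine ⟨fun p q => ?_⟩
  obtain ⟨l, _, h2, h3, h4⟩ := h p q
  have := reach_of_chain h2 h3 h4
  clear h4
  induction this with
  | refl => exact .refl _
  | @tail b c _ h ih =>
    by_cases hbc : b = c
    · subst hbc; exact ih
    · exact ih.trans (SimpleGraph.Adj.reachable ⟨hbc, Or.inl h⟩)

lemma coe_arcsOf (l : List V) : (arcsOf l : Set (V × V)) = Digraph.pathArcs l := by
  ext e; simp [arcsOf, Digraph.pathArcs]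

lemma hasArcDisjointDipaths_of_le_cut [Fintype V] (D : Digraph V) {n : ℕ} {s t : V}
    (h : ∀ X : Set V, s ∈ X → t ∉ X → n ≤ cut (arcs D) X) : D.HasArcDisjointDipaths s t n := by
  obtain ⟨P, hP, hd⟩ := menger n (arcs D) s t h
  rw [step_arcs] at hP
  refine ⟨P, hP, fun i j hij => ?_⟩
  change Disjoint (Digraph.pathArcs (P i)) (Digraph.pathArcs (P j))
  rw [← coe_arcsOf, ← coe_arcsOf, Finset.disjoint_coe]
  exact hd hij

lemma le_cut_of_hasArcDisjointDipaths [Fintype V] (D : Digraph V) {n : ℕ} {s t : V}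
    (h : D.HasArcDisjointDipaths s t n) {X : Set V} (hs : s ∈ X) (ht : t ∉ X) :
    n ≤ cut (arcs D) X := by
  obtain ⟨P, hP, hd⟩ := h
  have key : ∀ i, ∃ e ∈ leaving (arcs D) X, e ∈ arcsOf (P i) := by
    intro i
    obtain ⟨h1, h2, h3, h4⟩ := hP i
    have h5 := excess_arcsOf h1 h3 h4 X
    simp only [hs, ht, if_true, if_false] at h5
    rw [excess_eq_cut_sub] at h5
    obtain ⟨e, he, he1, he2⟩ := exists_of_cut_pos (E := arcsOf (P i)) (X := X) (by omega)
    exact ⟨e, mem_leaving.2 ⟨mem_arcs.2 (mem_of_mem_arcsOf h2 he), he1, he2⟩, he⟩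
  choose f hf hfP using key
  have hinj : Function.Injective f := by
    intro i j hij
    by_contra hne
    have : Disjoint (Digraph.pathArcs (P i)) (Digraph.pathArcs (P j)) := hd hne
    rw [← coe_arcsOf, ← coe_arcsOf, Set.disjoint_left] at this
    exact this (hfP i) (hij ▸ hfP j)
  have := Finset.card_le_card_of_injOn (s := Finset.univ) f (fun i _ => hf i) hinj.injOn
  simpa [cut] using this

/-- On unbounded sets of naturals `sSup` is `0`, so boundedness is what gives the connectivity its
meaning. For `s = t` it fails: the one-vertex dipath has no arcs and may be repeated at will. -/
lemma bddAbove_hasArcDisjointDipaths [Fintype V] (D : Digraph V) {s t : V} (hst : s ≠ t) :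
    BddAbove {n : ℕ | D.HasArcDisjointDipaths s t n} :=
  ⟨cut (arcs D) {s}, fun _ hn => le_cut_of_hasArcDisjointDipaths D hn rfl fun h => hst h.symm⟩

lemma localArcConnectivity_le_iff [Fintype V] (D : Digraph V) {s t : V} (hst : s ≠ t) (k : ℕ) :
    D.localArcConnectivity s t ≤ k ↔ ∃ X : Set V, s ∈ X ∧ t ∉ X ∧ cut (arcs D) X ≤ k := by
  have h0 : D.HasArcDisjointDipaths s t 0 := ⟨fun i => i.elim0, fun i => i.elim0, fun i => i.elim0⟩
  constructor
  · intro h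
    by_contra hcon
    push Not at hcon
    have h1 := hasArcDisjointDipaths_of_le_cut D (n := k + 1) (s := s) (t := t) hcon
    have := le_csSup (bddAbove_hasArcDisjointDipaths D hst) h1
    unfold Digraph.localArcConnectivity at h
    omega
  · rintro ⟨X, hs, ht, hX⟩
    exact csSup_le ⟨0, h0⟩ fun n hn => (le_cut_of_hasArcDisjointDipaths D hn hs ht).trans hX

lemma le_localArcConnectivity [Fintype V] (D : Digraph V) {s t : V} (hst : s ≠ t) {k : ℕ}
    (h : ∀ X : Set V, s ∈ X → t ∉ X → k ≤ cut (arcs D) X) : k ≤ D.localArcConnectivity s t :=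
  le_csSup (bddAbove_hasArcDisjointDipaths D hst) (hasArcDisjointDipaths_of_le_cut D h)

lemma bddAbove_localArcConnectivity [Fintype V] (D : Digraph V) :
    BddAbove {n : ℕ | ∃ x y : V, x ≠ y ∧ n = D.localArcConnectivity x y} := by
  refine (Set.Finite.subset (Set.finite_range fun e : V × V =>
    D.localArcConnectivity e.1 e.2) ?_).bddAbove
  rintro n ⟨x, y, _, rfl⟩
  exact ⟨(x, y), rfl⟩

/-- Extremality in terms of cuts and of non-dicolourability. -/
theorem isExtremal_iff_core [Fintype V] {D : Digraph V} (hD : D.IsLoopless) {k : ℕ} [NeZero k] :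
    D.IsExtremal k ↔ Core k (arcs D) := by
  constructor
  · rintro ⟨⟨_, hb⟩, hs, hc, hk⟩
    have hl : D.maxLocalArcConnectivity = k := by omega
    rw [hk] at hc
    refine ⟨fun v hv => hD v (mem_arcs.1 hv), ((dichromaticNumber_eq_succ_iff D k).1 hc).1,
      fun p q hpq => ?_, (isStrong_iff D).1 hs, fun z => (connOff_iff D z).1 (hb z)⟩
    rw [← localArcConnectivity_le_iff D hpq, ← hl]
    exact le_csSup (bddAbove_localArcConnectivity D) ⟨p, q, hpq, rfl⟩
  · intro h
    obtain ⟨e, he⟩ := nonempty_of_not_col h.not_col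
    have hst := (isStrong_iff D).2 h.strong
    have : Nonempty V := ⟨e.1⟩
    have hloc : ∀ p q, p ≠ q → D.localArcConnectivity p q = k := fun p q hpq =>
      le_antisymm ((localArcConnectivity_le_iff D hpq k).2 (h.separated p q hpq))
        (le_localArcConnectivity D hpq fun X hp hq => h.le_cut hp hq)
    have hl : D.maxLocalArcConnectivity = k := by
      have hset : {n : ℕ | ∃ x y : V, x ≠ y ∧ n = D.localArcConnectivity x y} = {k} := by
        ext n
        constructor
        · rintro ⟨x, y, hxy, rfl⟩
          exact hloc x y hxy
        · rintro rfl
          have hne : e.1 ≠ e.2 := fun heq => h.loopless e.1 (by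
            rwa [← Prod.mk.eta (p := e), ← heq] at he)
          exact ⟨e.1, e.2, hne, (hloc _ _ hne).symm⟩
      rw [Digraph.maxLocalArcConnectivity, hset, csSup_singleton]
    refine ⟨⟨connected_of_isStrong D hst, fun v => (connOff_iff D v).2 (h.conn v)⟩, hst, ?_, ?_⟩
    · rw [hl]
      exact (dichromaticNumber_eq_succ_iff D k).2 ⟨h.not_col, h.col_succ⟩
    · rw [hl]

/-- Being extremal is invariant under isomorphism. -/
lemma Core.map {U : Type*} {k : ℕ} [Fintype U] [Fintype V] {D : Digraph U} {D' : Digraph V}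
    (e : D.Adj ≃r D'.Adj) (h : Core k (arcs D)) : Core k (arcs D') := by
  have harc : ∀ p q, (p, q) ∈ arcs D' ↔ (e.symm p, e.symm q) ∈ arcs D := fun p q => by
    rw [mem_arcs, mem_arcs]
    exact e.symm.map_rel_iff.symm
  refine ⟨fun v hv => h.loopless _ ((harc v v).1 hv), fun ⟨φ, hφ⟩ => h.not_col ⟨fun u => φ (e u),
    hφ.lift e fun p q hpq => ⟨by rw [harc]; simpa using hpq.1, hpq.2⟩⟩, fun p q hpq => ?_,
    fun X p hp q hq => ?_, fun z S hS p q hp hq hpS => ?_⟩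
  · obtain ⟨X, h1, h2, h3⟩ := h.separated (e.symm p) (e.symm q) (fun hh => hpq (e.symm.injective hh))
    refine ⟨e.symm ⁻¹' X, h1, h2, le_trans ?_ h3⟩
    refine Finset.card_le_card_of_injOn (fun a => (e.symm a.1, e.symm a.2)) (fun a ha => ?_) ?_
    · have := mem_leaving.1 ha
      exact mem_leaving.2 ⟨(harc a.1 a.2).1 this.1, this.2⟩
    · rintro ⟨a, b⟩ _ ⟨c, d⟩ _ hh
      simpa using hh
  · obtain ⟨a, ha, h1, h2⟩ := h.strong (e ⁻¹' X) (e.symm p) (by simpa using hp) (e.symm q)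
      (by simpa using hq)
    exact ⟨(e a.1, e a.2), by rw [harc]; simpa using ha, h1, h2⟩
  · have := h.conn (e.symm z) (e ⁻¹' S) (by
      intro a b ha hb hab haS
      refine hS (e a) (e b) (fun hh => ha (by simp [← hh])) (fun hh => hb (by simp [← hh])) ?_ haS
      rw [harc, harc]
      simpa using hab) (e.symm p) (e.symm q) (fun hh => hp (e.symm.injective hh))
      (fun hh => hq (e.symm.injective hh)) (by simpa using hpS)
    simpa using this

/-! ### Reversal -/

/-- The arc set with all arcs reversed. -/
noncomputable def rev (E : Finset (V × V)) : Finset (V × V) := E.image Prod.swap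

lemma mem_rev {E : Finset (V × V)} {p q : V} : (p, q) ∈ rev E ↔ (q, p) ∈ E := by
  simp only [rev, Finset.mem_image]
  constructor
  · rintro ⟨⟨a, b⟩, h, heq⟩
    simp only [Prod.swap_prod_mk, Prod.mk.injEq] at heq
    obtain ⟨rfl, rfl⟩ := heq
    exact h
  · exact fun h => ⟨(q, p), h, rfl⟩

lemma rev_rev (E : Finset (V × V)) : rev (rev E) = E := by
  ext ⟨p, q⟩; rw [mem_rev, mem_rev]

lemma cut_rev_le (E : Finset (V × V)) (X : Set V) : cut (rev E) X ≤ cut E Xᶜ := by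
  refine Finset.card_le_card_of_injOn Prod.swap (fun e he => ?_) Prod.swap_injective.injOn
  obtain ⟨p, q⟩ := e
  have := mem_leaving.1 he
  exact mem_leaving.2 ⟨mem_rev.1 this.1, this.2.2, fun h => h this.2.1⟩

lemma cut_rev (E : Finset (V × V)) (X : Set V) : cut (rev E) X = cut E Xᶜ := by
  refine le_antisymm (cut_rev_le E X) ?_
  have := cut_rev_le (rev E) Xᶜ
  rwa [rev_rev, compl_compl] at this

lemma Acyc.swap {α : Type*} {R : α → α → Prop} (h : Acyc R) : Acyc (Function.swap R) :=
  fun v hv => h v (transGen_swap.1 hv)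

lemma Acyc.rev {C : Type*} {E : Finset (V × V)} {φ : V → C} (h : Acyc (Mono E φ)) :
    Acyc (Mono (rev E) φ) :=
  h.swap.mono fun _ _ hpq => ⟨mem_rev.1 hpq.1, hpq.2.symm⟩

lemma restr_rev (E : Finset (V × V)) (X : Set V) : restr (rev E) X = rev (restr E X) := by
  ext ⟨p, q⟩
  rw [mem_rev, mem_restr, mem_restr, mem_rev]
  tauto

lemma reach_rev {C : Type*} {E : Finset (V × V)} {φ : V → C} {p q : V} :
    ReflTransGen (Mono (rev E) φ) p q ↔ ReflTransGen (Mono E φ) q p := by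
  rw [← reflTransGen_swap]
  have : Function.swap (Mono (rev E) φ) = Mono E φ := by
    ext a b
    simp only [Function.swap, Mono, mem_rev, eq_comm]
  rw [this]

lemma Core.rev {k : ℕ} {E : Finset (V × V)} (h : Core k E) : Core k (rev E) where
  loopless v hv := h.loopless v (mem_rev.1 hv)
  not_col := fun ⟨φ, hφ⟩ => h.not_col ⟨φ, by simpa [rev_rev] using hφ.rev⟩
  separated p q hpq := by
    obtain ⟨X, h1, h2, h3⟩ := h.separated q p hpq.symm
    exact ⟨Xᶜ, h2, fun hh => hh h1, by rwa [cut_rev, compl_compl]⟩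
  strong X p hp q hq := by
    obtain ⟨⟨a, b⟩, he, h1, h2⟩ := h.strong Xᶜ q hq p (fun hh => hh hp)
    exact ⟨(b, a), mem_rev.2 he, not_not.1 h2, h1⟩
  conn z S hS := h.conn z S fun p q hp hq hpq => hS p q hp hq (by
    rw [mem_rev, mem_rev]; exact hpq.symm)

/-- A transposition of colours preserves monochromatic arcs; this makes colourings of the two sides
agree at `x`. -/
lemma exists_col_eq {k : ℕ} (E : Finset (V × V)) (g : V → Fin k) (x : V) (c : Fin k) :
    ∃ g' : V → Fin k, g' x = c ∧ Mono E g' = Mono E g := by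
  refine ⟨fun y => Equiv.swap (g x) c (g y), by simp, ?_⟩
  ext p q
  simp [Mono]

/-! ### Splittings at a vertex and two opposite arcs -/

/-- The vertex set is the union of `A` and `C`, which share the vertex `x` only; the only arcs
between `A \ {x}` and `C \ {x}` are `tu` and `vw`; the vertices `t`, `w` are linked inside
`A \ {x}`, and so are `u`, `v` inside `C \ {x}`. -/
structure Split (E : Finset (V × V)) (A C : Set V) (x t u v w : V) : Prop where
  union : ∀ y, y ∈ A ∨ y ∈ C
  inter : ∀ y ∈ A, y ∈ C → y = x
  x_mem_A : x ∈ A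
  x_mem_C : x ∈ C
  t_mem : t ∈ A
  t_ne : t ≠ x
  w_mem : w ∈ A
  w_ne : w ≠ x
  u_mem : u ∈ C
  u_ne : u ≠ x
  v_mem : v ∈ C
  v_ne : v ≠ x
  arc_AC : ∀ y ∈ A, y ≠ x → ∀ z ∈ C, z ≠ x → ((y, z) ∈ E ↔ y = t ∧ z = u)
  arc_CA : ∀ z ∈ C, z ≠ x → ∀ y ∈ A, y ≠ x → ((z, y) ∈ E ↔ z = v ∧ y = w)
  conn_A : ∀ S : Set V, (∀ y z, y ∈ A → y ≠ x → z ∈ A → z ≠ x → ((y, z) ∈ E ∨ (z, y) ∈ E) →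
    y ∈ S → z ∈ S) → (t ∈ S ↔ w ∈ S)
  conn_C : ∀ S : Set V, (∀ y z, y ∈ C → y ≠ x → z ∈ C → z ≠ x → ((y, z) ∈ E ∨ (z, y) ∈ E) →
    y ∈ S → z ∈ S) → (u ∈ S ↔ v ∈ S)

namespace Split

variable {E : Finset (V × V)} {A C : Set V} {x t u v w : V}

lemma swap (h : Split E A C x t u v w) : Split E C A x v w t u where
  union y := (h.union y).symm
  inter y h1 h2 := h.inter y h2 h1
  x_mem_A := h.x_mem_C
  x_mem_C := h.x_mem_A
  t_mem := h.v_mem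
  t_ne := h.v_ne
  w_mem := h.u_mem
  w_ne := h.u_ne
  u_mem := h.w_mem
  u_ne := h.w_ne
  v_mem := h.t_mem
  v_ne := h.t_ne
  arc_AC := h.arc_CA
  arc_CA := h.arc_AC
  conn_A S hS := (h.conn_C S hS).symm
  conn_C S hS := (h.conn_A S hS).symm

/-- Reversal makes `tu` go from `C` to `A`, so the sides change places. Together with `swap` this
provides the symmetries used below. -/
lemma rev (h : Split E A C x t u v w) : Split (rev E) C A x u t w v where
  union y := (h.union y).symm
  inter y h1 h2 := h.inter y h2 h1
  x_mem_A := h.x_mem_C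
  x_mem_C := h.x_mem_A
  t_mem := h.u_mem
  t_ne := h.u_ne
  w_mem := h.v_mem
  w_ne := h.v_ne
  u_mem := h.t_mem
  u_ne := h.t_ne
  v_mem := h.w_mem
  v_ne := h.w_ne
  arc_AC y hy hyx z hz hzx := by rw [mem_rev, h.arc_AC z hz hzx y hy hyx, and_comm]
  arc_CA y hy hyx z hz hzx := by rw [mem_rev, h.arc_CA z hz hzx y hy hyx, and_comm]
  conn_A S hS := h.conn_C S fun y z h1 h2 h3 h4 h5 => hS y z h1 h2 h3 h4 (by
    rw [mem_rev, mem_rev]; exact h5.symm)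
  conn_C S hS := h.conn_A S fun y z h1 h2 h3 h4 h5 => hS y z h1 h2 h3 h4 (by
    rw [mem_rev, mem_rev]; exact h5.symm)

lemma notMem_C (h : Split E A C x t u v w) {y : V} (hy : y ∈ A) (hyx : y ≠ x) : y ∉ C :=
  fun hc => hyx (h.inter y hy hc)

lemma notMem_A (h : Split E A C x t u v w) {y : V} (hy : y ∈ C) (hyx : y ≠ x) : y ∉ A :=
  fun hc => hyx (h.inter y hc hy)

lemma tu_mem (h : Split E A C x t u v w) : (t, u) ∈ E :=
  (h.arc_AC t h.t_mem h.t_ne u h.u_mem h.u_ne).2 ⟨rfl, rfl⟩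

lemma vw_mem (h : Split E A C x t u v w) : (v, w) ∈ E :=
  (h.arc_CA v h.v_mem h.v_ne w h.w_mem h.w_ne).2 ⟨rfl, rfl⟩

lemma arc_cases (h : Split E A C x t u v w) {p q : V} (hpq : (p, q) ∈ E) :
    (p ∈ A ∧ q ∈ A) ∨ (p ∈ C ∧ q ∈ C) ∨ (p = t ∧ q = u) ∨ (p = v ∧ q = w) := by
  by_cases hpx : p = x
  · subst hpx
    rcases h.union q with hq | hq
    exacts [Or.inl ⟨h.x_mem_A, hq⟩, Or.inr (Or.inl ⟨h.x_mem_C, hq⟩)]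
  by_cases hqx : q = x
  · subst hqx
    rcases h.union p with hp | hp
    exacts [Or.inl ⟨hp, h.x_mem_A⟩, Or.inr (Or.inl ⟨hp, h.x_mem_C⟩)]
  rcases h.union p with hp | hp <;> rcases h.union q with hq | hq
  · exact Or.inl ⟨hp, hq⟩
  · exact Or.inr (Or.inr (Or.inl ((h.arc_AC p hp hpx q hq hqx).1 hpq)))
  · exact Or.inr (Or.inr (Or.inr ((h.arc_CA p hp hpx q hq hqx).1 hpq)))
  · exact Or.inr (Or.inl ⟨hp, hq⟩)

/-- Reachability in the union of a relation on `A` and a relation on `C`. -/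
lemma reach_glue {R S : V → V → Prop} (h : Split E A C x t u v w)
    (hR : ∀ p q, R p q → p ∈ A ∧ q ∈ A) (hS : ∀ p q, S p q → p ∈ C ∧ q ∈ C)
    (hRa : Acyc R) (hSa : Acyc S) :
    (∀ y z, y ∈ A → y ≠ x → z ∈ A → z ≠ x → ReflTransGen (fun a b => R a b ∨ S a b) y z →
      ReflTransGen R y z) ∧
    (∀ y z, y ∈ A → y ≠ x → z ∈ C → z ≠ x → ReflTransGen (fun a b => R a b ∨ S a b) y z →
      ReflTransGen R y x ∧ ReflTransGen S x z) := by
  constructor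
  · intro y z hy hyx hz hzx hr
    rcases reflTransGen_iff_eq_or_transGen.1 hr with rfl | hr
    · exact .refl
    rcases transGen_glue h.inter hR hS hRa hSa hr with h' | h' | h' | h'
    · exact h'.2.2.to_reflTransGen
    · exact absurd h'.1 (h.notMem_C hy hyx)
    · exact absurd h'.2.1 (h.notMem_C hz hzx)
    · exact absurd h'.1 (h.notMem_C hy hyx)
  · intro y z hy hyx hz hzx hr
    rcases reflTransGen_iff_eq_or_transGen.1 hr with rfl | hr
    · exact absurd hz (h.notMem_C hy hyx)
    rcases transGen_glue h.inter hR hS hRa hSa hr with h' | h' | h' | h'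
    · exact absurd h'.2.1 (h.notMem_A hz hzx)
    · exact absurd h'.1 (h.notMem_C hy hyx)
    · exact ⟨h'.2.2.1.to_reflTransGen, h'.2.2.2.to_reflTransGen⟩
    · exact absurd h'.1 (h.notMem_C hy hyx)

/-- Without `tu`, a monochromatic cycle would have to use `vw` and return from `w` to `v` through
`x`. -/
lemma acyc_erase {K : Type*} (h : Split E A C x t u v w) {f : V → K}
    (hA : Acyc (Mono (restr E A) f)) (hC : Acyc (Mono (restr E C) f))
    (hWV : ¬ (ReflTransGen (Mono (restr E A) f) w x ∧ ReflTransGen (Mono (restr E C) f) x v)) :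
    Acyc (Mono (E.erase (t, u)) f) := by
  have hR : ∀ p q, Mono (restr E A) f p q → p ∈ A ∧ q ∈ A := fun p q hpq => (mem_restr.1 hpq.1).2
  have hS : ∀ p q, Mono (restr E C) f p q → p ∈ C ∧ q ∈ C := fun p q hpq => (mem_restr.1 hpq.1).2
  have h0 := hA.glue h.inter hR hS hC
  have h1 := h0.add_arc (p := v) (q := w) (fun hr => hWV
    ((h.reach_glue hR hS hA hC).2 w v h.w_mem h.w_ne h.v_mem h.v_ne hr))
  refine h1.mono ?_
  rintro p q ⟨hpq, hc⟩
  rw [Finset.mem_erase] at hpq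
  rcases h.arc_cases hpq.2 with h' | h' | ⟨rfl, rfl⟩ | h'
  · exact Or.inl (Or.inl ⟨mem_restr.2 ⟨hpq.2, h'⟩, hc⟩)
  · exact Or.inl (Or.inr ⟨mem_restr.2 ⟨hpq.2, h'⟩, hc⟩)
  · exact absurd rfl hpq.1
  · exact Or.inr h'

/-- Colourings of the two sides that agree in `x` create a monochromatic cycle through one of the
two arcs joining the sides. -/
lemma reach_of_not_col {k : ℕ} (h : Split E A C x t u v w) (hE : ¬ Col k E) {f g : V → Fin k}
    (hfg : f x = g x) (hA : Acyc (Mono (restr E A) f)) (hC : Acyc (Mono (restr E C) g)) :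
    (ReflTransGen (Mono (restr E A) f) x t ∧ ReflTransGen (Mono (restr E C) g) u x) ∨
    (ReflTransGen (Mono (restr E A) f) w x ∧ ReflTransGen (Mono (restr E C) g) x v) ∨
    (ReflTransGen (Mono (restr E A) f) w t ∧ ReflTransGen (Mono (restr E C) g) u v ∧
      f t = g u) := by
  by_contra hcon
  push Not at hcon
  obtain ⟨hTU, hWV, hMN⟩ := hcon
  have hR : ∀ p q, Mono (restr E A) f p q → p ∈ A ∧ q ∈ A := fun p q hpq => (mem_restr.1 hpq.1).2
  have hS : ∀ p q, Mono (restr E C) g p q → p ∈ C ∧ q ∈ C := fun p q hpq => (mem_restr.1 hpq.1).2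
  have hglue := h.reach_glue hR hS hA hC
  have hglue' := h.swap.reach_glue hS hR hC hA
  have hor : (fun a b => Mono (restr E C) g a b ∨ Mono (restr E A) f a b) =
      fun a b => Mono (restr E A) f a b ∨ Mono (restr E C) g a b := by
    ext a b; exact or_comm
  rw [hor] at hglue'
  have h0 := hA.glue h.inter hR hS hC
  -- The glued sides are acyclic. The arcs `tu` and `vw` are added one after the other; either
  -- closes a cycle only if its head already reaches its tail, which is what the three negated
  -- alternatives exclude.
  have h1 := h0.add_arc (p := t) (q := u) (fun hr => by
    obtain ⟨h1, h2⟩ := hglue'.2 u t h.u_mem h.u_ne h.t_mem h.t_ne hr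
    exact hTU h2 h1)
  set φ : V → Fin k := fun y => if y ∈ A then f y else g y with hφ
  have hφA : ∀ y ∈ A, φ y = f y := fun y hy => by simp [hφ, hy]
  have hφC : ∀ y ∈ C, φ y = g y := fun y hy => by
    by_cases hyA : y ∈ A
    · rw [hφA y hyA, h.inter y hyA hy, hfg]
    · simp [hφ, hyA]
  have hmono : ∀ p q, Mono E φ p q → (Mono (restr E A) f p q ∨ Mono (restr E C) g p q) ∨
      (p = t ∧ q = u ∧ f t = g u) ∨ (p = v ∧ q = w ∧ g v = f w) := by
    rintro p q ⟨hpq, hc⟩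
    rcases h.arc_cases hpq with ⟨hp, hq⟩ | ⟨hp, hq⟩ | ⟨rfl, rfl⟩ | ⟨rfl, rfl⟩
    · rw [hφA p hp, hφA q hq] at hc
      exact Or.inl (Or.inl ⟨mem_restr.2 ⟨hpq, hp, hq⟩, hc⟩)
    · rw [hφC p hp, hφC q hq] at hc
      exact Or.inl (Or.inr ⟨mem_restr.2 ⟨hpq, hp, hq⟩, hc⟩)
    · rw [hφA _ h.t_mem, hφC _ h.u_mem] at hc
      exact Or.inr (Or.inl ⟨rfl, rfl, hc⟩)
    · rw [hφA _ h.w_mem, hφC _ h.v_mem] at hc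
      exact Or.inr (Or.inr ⟨rfl, rfl, hc⟩)
  by_cases hvw : g v = f w
  · have h2 := h1.add_arc (p := v) (q := w) (fun hr => by
      rcases reach_add_arc hr with hr | ⟨hr1, hr2⟩
      · obtain ⟨h1, h2⟩ := hglue.2 w v h.w_mem h.w_ne h.v_mem h.v_ne hr
        exact hWV h1 h2
      · have h3 := hglue.1 w t h.w_mem h.w_ne h.t_mem h.t_ne hr1
        have h4 := hglue'.1 u v h.u_mem h.u_ne h.v_mem h.v_ne hr2
        refine hMN h3 h4 ?_
        rw [← reach_congr (fun p q hpq => hpq.2) h3, ← hvw, reach_congr (fun p q hpq => hpq.2) h4])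
    refine hE ⟨φ, h2.mono fun p q hpq => ?_⟩
    rcases hmono p q hpq with h' | ⟨h', h'', _⟩ | ⟨h', h'', _⟩
    exacts [Or.inl (Or.inl h'), Or.inl (Or.inr ⟨h', h''⟩), Or.inr ⟨h', h''⟩]
  · refine hE ⟨φ, h1.mono fun p q hpq => ?_⟩
    rcases hmono p q hpq with h' | ⟨h', h'', _⟩ | ⟨_, _, h'⟩
    exacts [Or.inl h', Or.inr ⟨h', h''⟩, absurd h' hvw]

variable {k : ℕ} [NeZero k]

/-- Otherwise the set reached from `u` inside `C` could be left only by `vw`, a cut of fewer than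
`k` arcs. -/
lemma reach_u_x (h : Split E A C x t u v w) (hE : Core k E) (hk : 2 ≤ k) :
    ReflTransGen (Step (restr E C)) u x := by
  by_contra hcon
  have hsub : ∀ y, ReflTransGen (Step (restr E C)) u y → y ∈ C ∧ y ≠ x := by
    intro y hy
    refine ⟨?_, fun hyx => hcon (hyx ▸ hy)⟩
    rcases ReflTransGen.cases_tail hy with rfl | ⟨z, _, hz⟩
    · exact h.u_mem
    · exact (mem_restr.1 hz).2.2
  have h1 := hE.le_cut (X := {y | ReflTransGen (Step (restr E C)) u y}) (p := u) (q := x) .refl hcon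
  have h2 : leaving E {y | ReflTransGen (Step (restr E C)) u y} ⊆ {(v, w)} := by
    rintro ⟨p, q⟩ he
    obtain ⟨hpq, hp, hq⟩ := mem_leaving.1 he
    obtain ⟨hpC, hpx⟩ := hsub p hp
    have hqC : q ∉ C := fun hqC => hq (ReflTransGen.tail hp (mem_restr.2 ⟨hpq, hpC, hqC⟩))
    have hqA := (h.union q).resolve_right hqC
    have := (h.arc_CA p hpC hpx q hqA (fun hh => hqC (hh ▸ h.x_mem_C))).1 hpq
    simp [this.1, this.2]
  have h3 := Finset.card_le_card h2
  rw [Finset.card_singleton] at h3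
  unfold cut at h1
  omega

/-- One side has a colouring without a monochromatic path from `x` to `t`. -/
theorem exists_col_not_reach [Finite V] (h : Split E A C x t u v w) (hE : Core k E)
    (hk : 2 ≤ k) : ∃ g : V → Fin k, Acyc (Mono (restr E A) g) ∧
      ¬ ReflTransGen (Mono (restr E A) g) x t := by
  by_contra hcon
  push Not at hcon
  have htuA : (t, u) ∉ restr E A := fun hh => h.notMem_A h.u_mem h.u_ne (mem_restr.1 hh).2.2
  -- If every dicolouring of the side has a monochromatic path from `x` to `t`, the additional arc
  -- `tx` always closes a cycle.
  have hG : ¬ Col k (insert (t, x) (restr E A)) := by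
    rintro ⟨g, hg⟩
    have hgA : Acyc (Mono (restr E A) g) :=
      hg.mono fun p q hpq => ⟨Finset.mem_insert_of_mem hpq.1, hpq.2⟩
    have hr := hcon g hgA
    have hc := reach_congr (fun p q hpq => hpq.2) hr
    have hr' : ReflTransGen (Mono (insert (t, x) (restr E A)) g) x t :=
      ReflTransGen.mono (fun p q hpq => ⟨Finset.mem_insert_of_mem hpq.1, hpq.2⟩) x t hr
    exact hg x (TransGen.tail' hr' ⟨Finset.mem_insert_self _ _, hc.symm⟩)
  obtain ⟨K, hKG, hK⟩ := exists_minimal_not_col hG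
  have hAcol : Col k (restr E A) := hE.col_of_subset_of_notMem (restr_subset E A) h.tu_mem htuA
  have htxK : (t, x) ∈ K := by
    by_contra hh
    refine hK.1 (hAcol.mono fun e he => ?_)
    rcases Finset.mem_insert.1 (hKG he) with rfl | he'
    exacts [absurd he hh, he']
  obtain ⟨P, hPC, hP⟩ := exists_path_arcs (h.reach_u_x hE hk)
  set K₀ := K.erase (t, x) with hK₀
  have hK₀A : K₀ ⊆ restr E A := fun e he => by
    rw [hK₀, Finset.mem_erase] at he
    exact (Finset.mem_insert.1 (hKG he.2)).resolve_left he.1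
  have htuP : (t, u) ∉ P := fun hh => h.notMem_C h.t_mem h.t_ne (mem_restr.1 (hPC hh)).2.1
  -- The virtual arc `tx` is realised inside `E` by a path through `u` and the side `C`. It has the
  -- same excess as `tx`, so replacing `tx` by it does not decrease any cut of `K`.
  set Q := insert (t, u) P with hQ
  have hQE : Q ⊆ E := by
    rw [hQ, Finset.insert_subset_iff]
    exact ⟨h.tu_mem, hPC.trans (restr_subset E C)⟩
  have hQex : ∀ X : Set V, excess Q X = (if t ∈ X then 1 else 0) - (if x ∈ X then 1 else 0) := by
    intro X
    have := hP X
    rw [excess] at this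
    rw [hQ, excess, Finset.sum_insert htuP, this]
    ring
  have hdisj : Disjoint K₀ Q := by
    rw [Finset.disjoint_left]
    rintro ⟨p, q⟩ he heQ
    have h1 := mem_restr.1 (hK₀A he)
    rcases Finset.mem_insert.1 heQ with heq | heP
    · exact htuA (heq ▸ hK₀A he)
    · have h2 := mem_restr.1 (hPC heP)
      have hp := h.inter p h1.2.1 h2.2.1
      have hq := h.inter q h1.2.2 h2.2.2
      subst hp
      subst hq
      exact hE.loopless _ h1.1
  set K' := K₀ ∪ Q with hK'
  have hK'E : K' ⊆ E := Finset.union_subset (hK₀A.trans (restr_subset E A)) hQE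
  have hcut : ∀ X : Set V, cut K X ≤ cut K' X := by
    intro X
    have h1 : cut K' X = cut K₀ X + cut Q X := by
      rw [cut_eq_sum, cut_eq_sum, cut_eq_sum, hK', Finset.sum_union hdisj]
    have h2 : cut K X = cut K₀ X + if t ∈ X ∧ x ∉ X then 1 else 0 := by
      rw [cut_eq_sum, cut_eq_sum, hK₀, Finset.sum_erase_add _ _ htxK]
    have h3 := hQex X
    rw [excess_eq_cut_sub] at h3
    split_ifs at h2 with h4
    · simp only [h4.1, h4.2, if_true, if_false] at h3
      omega
    · omega
  have hKcut := le_cut_of_minimal hK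
  have hKex : ∀ X : Set V, excess K X = 0 :=
    ArcSet.excess_eq_zero (S₀ := verts K) (k := k)
      (fun e he => ⟨fst_mem_verts he, snd_mem_verts he⟩) hKcut (fun p _ q _ hpq => by
        obtain ⟨X, h1, h2, h3⟩ := hE.separated p q hpq
        exact ⟨X, h1, h2, (hcut X).trans ((cut_mono hK'E X).trans h3)⟩)
  have hK'ex : ∀ X : Set V, excess K' X = 0 := by
    intro X
    have h1 : excess K' X = excess K₀ X + excess Q X := by
      rw [excess, excess, excess, hK', Finset.sum_union hdisj]
    have h2 : excess K X = excess K₀ X + ((if t ∈ X then 1 else 0) - (if x ∈ X then 1 else 0)) := by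
      rw [excess, excess, hK₀, Finset.sum_erase_add _ _ htxK]
    rw [h1, hQex, ← h2, hKex]
  -- `F` is a difference of balanced arc sets. A set that no arc of `F` leaves is thus entered by
  -- none, so reachability in `F` is symmetric; moreover `F` links no two vertices of `K`.
  set F := E \ K' with hF
  have hFex : ∀ X : Set V, excess F X = 0 := fun X => by
    rw [hF, excess_sdiff_arcs hK'E, hE.excess_eq_zero, hK'ex, sub_zero]
  have hFsymm : ∀ X : Set V, (∀ e ∈ F, e.1 ∈ X → e.2 ∈ X) → ∀ e ∈ F, e.2 ∈ X → e.1 ∈ X := by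
    intro X hX e he h2
    have h1 := hFex X
    have h3 : cut F X = 0 := by
      by_contra hh
      obtain ⟨e, he, h4, h5⟩ := exists_of_cut_pos (Nat.pos_of_ne_zero hh)
      exact h5 (hX e he h4)
    rw [excess_eq_cut_sub, h3] at h1
    by_contra h4
    exact cut_eq_zero (E := F) (X := Xᶜ) (by omega) he h4 h2
  have huniq : ∀ {p q : V}, p ∈ verts K → q ∈ verts K → ReflTransGen (Step F) p q → p = q :=
    fun hp hq hr => hE.eq_of_reach_sdiff hK'E
      (fun X h1 h2 => (hKcut X h1 h2).trans (hcut X)) hp hq hr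
  have hxK : x ∈ verts K := snd_mem_verts htxK
  have htK : t ∈ verts K := fst_mem_verts htxK
  have hvwF : (v, w) ∈ F := by
    refine Finset.mem_sdiff.2 ⟨h.vw_mem, fun hh => ?_⟩
    rcases Finset.mem_union.1 hh with hh | hh
    · exact h.notMem_A h.v_mem h.v_ne (mem_restr.1 (hK₀A hh)).2.1
    · rcases Finset.mem_insert.1 hh with hh | hh
      · rw [Prod.mk.injEq] at hh
        exact h.notMem_A h.v_mem h.v_ne (hh.1 ▸ h.t_mem)
      · exact h.notMem_C h.w_mem h.w_ne (mem_restr.1 (hPC hh)).2.2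
  have htuF : (t, u) ∉ F := fun hh =>
    (Finset.mem_sdiff.1 hh).2 (Finset.mem_union_right _ (Finset.mem_insert_self _ _))
  -- Otherwise the part of `A` reached from `w` is never left, `tu` being absent from `F`, and hence
  -- never entered; but `vw` enters it.
  have hwx : ReflTransGen (Step F) w x := by
    by_contra hwx
    have := hFsymm ({y | ReflTransGen (Step F) w y} ∩ A) (by
      rintro ⟨p, q⟩ he ⟨hp, hpA⟩
      have hq : ReflTransGen (Step F) w q := ReflTransGen.tail hp he
      refine ⟨hq, ?_⟩
      by_contra hqA
      have hqC := (h.union q).resolve_left hqA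
      have hpx : p ≠ x := fun hh => hwx (hh ▸ hp)
      have hqx : q ≠ x := fun hh => hwx (hh ▸ hq)
      obtain ⟨rfl, rfl⟩ := (h.arc_AC p hpA hpx q hqC hqx).1 (Finset.mem_sdiff.1 he).1
      exact htuF he) (v, w) hvwF ⟨.refl, h.w_mem⟩
    exact h.notMem_A h.v_mem h.v_ne this.2
  have hSin := hFsymm {y | ReflTransGen (Step F) x y} (fun e he h1 => ReflTransGen.tail h1 he)
  have hxw : ReflTransGen (Step F) x w := by
    by_contra hxw
    obtain ⟨p, q, hpq, hp, hq, _⟩ := exists_leaving_of_reach hwx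
      (X := {y | ReflTransGen (Step F) x y}ᶜ) hxw (fun hh => hh .refl)
    exact hp (hSin (p, q) hpq (not_not.1 hq))
  -- A vertex of `A \ {x}` reached from `x` is not in `verts K`, so all its arcs inside `A` belong
  -- to `F`. The linking of `t` and `w` then carries reachability from `w` to `t`, although `t` and
  -- `x` both lie in `verts K`.
  have hconn := h.conn_A {y | ReflTransGen (Step F) x y} (by
    intro y z hy hyx hz hzx hyz hyS
    have hyK : y ∉ verts K := fun hyK => hyx (huniq hxK hyK hyS).symm
    have hmem : ∀ e ∈ E, (e.1 = y ∨ e.2 = y) → e.1 ∈ A → e.2 ∈ A → e ∈ F := by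
      intro e he hey h1 h2
      refine Finset.mem_sdiff.2 ⟨he, fun hh => ?_⟩
      rcases Finset.mem_union.1 hh with hh | hh
      · exact hyK ⟨e, Finset.mem_of_mem_erase hh, hey⟩
      · rcases Finset.mem_insert.1 hh with rfl | hh
        · exact h.notMem_A h.u_mem h.u_ne h2
        · have h3 := (mem_restr.1 (hPC hh)).2
          rcases hey with rfl | rfl
          exacts [h.notMem_C hy hyx h3.1, h.notMem_C hy hyx h3.2]
    rcases hyz with hyz | hyz
    · exact ReflTransGen.tail hyS (hmem (y, z) hyz (Or.inl rfl) hy hz)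
    · exact hSin (z, y) (hmem (z, y) hyz (Or.inr rfl) hz hy) hyS)
  exact h.t_ne (huniq hxK htK (hconn.2 hxw)).symm

/-- Tight sets avoiding `x` lie on one side. -/
lemma exists_tight (h : Split E A C x t u v w) (hE : Core k E) (hk : 3 ≤ k) {y : V} (hy : y ∈ A)
    (hyx : y ≠ x) : ∃ Y ⊆ A, x ∉ Y ∧ y ∈ Y ∧ cut E Yᶜ ≤ k := by
  obtain ⟨X, hxX, hyX, hX⟩ := hE.separated x y hyx.symm
  refine ⟨Xᶜ, fun z hz => ?_, fun hh => hh hxX, hyX, by rwa [compl_compl]⟩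
  by_contra hzA
  have hzC := (h.union z).resolve_left hzA
  have h1 := hE.le_cut (X := (Xᶜ ∩ A)ᶜ) (p := x) (q := y) (fun hh => hh.1 hxX) (fun hh => hh ⟨hyX, hy⟩)
  have h2 := hE.le_cut (X := (Xᶜ ∩ C)ᶜ) (p := x) (q := z) (fun hh => hh.1 hxX) (fun hh => hh ⟨hz, hzC⟩)
  have hne : ∀ q, q ∈ Xᶜ → q ≠ x := fun q hq hh => hq (hh ▸ hxX)
  -- Apart from `vw` and `tu`, the arcs entering `Xᶜ ∩ A` and those entering `Xᶜ ∩ C` are different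
  -- arcs leaving `X`. With both pieces nonempty, `2(k - 1) ≤ k`, which fails for `k ≥ 3`.
  have hsub1 : (leaving E (Xᶜ ∩ A)ᶜ).erase (v, w) ⊆ (leaving E X).filter (fun e => e.2 ∈ A) := by
    rintro ⟨p, q⟩ he
    rw [Finset.mem_erase, mem_leaving] at he
    obtain ⟨hne', hpq, hp, hq⟩ := he
    rw [Set.mem_compl_iff, not_not] at hq
    rw [Finset.mem_filter, mem_leaving]
    refine ⟨⟨hpq, ?_, hq.1⟩, hq.2⟩
    by_contra hpX
    have hpA : p ∉ A := fun hpA => hp ⟨hpX, hpA⟩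
    have := (h.arc_CA p ((h.union p).resolve_left hpA) (hne p hpX) q hq.2 (hne q hq.1)).1 hpq
    exact hne' (by rw [this.1, this.2])
  have hsub2 : (leaving E (Xᶜ ∩ C)ᶜ).erase (t, u) ⊆ (leaving E X).filter (fun e => ¬ e.2 ∈ A) := by
    rintro ⟨p, q⟩ he
    rw [Finset.mem_erase, mem_leaving] at he
    obtain ⟨hne', hpq, hp, hq⟩ := he
    rw [Set.mem_compl_iff, not_not] at hq
    rw [Finset.mem_filter, mem_leaving]
    refine ⟨⟨hpq, ?_, hq.1⟩, h.notMem_A hq.2 (hne q hq.1)⟩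
    by_contra hpX
    have hpC : p ∉ C := fun hpC => hp ⟨hpX, hpC⟩
    have := (h.arc_AC p ((h.union p).resolve_right hpC) (hne p hpX) q hq.2 (hne q hq.1)).1 hpq
    exact hne' (by rw [this.1, this.2])
  have h3 := Finset.card_le_card hsub1
  have h4 := Finset.card_le_card hsub2
  have h5 := Finset.card_filter_add_card_filter_not (s := leaving E X) (fun e : V × V => e.2 ∈ A)
  have h6 := Finset.pred_card_le_card_erase (s := leaving E (Xᶜ ∩ A)ᶜ) (a := (v, w))
  have h7 := Finset.pred_card_le_card_erase (s := leaving E (Xᶜ ∩ C)ᶜ) (a := (t, u))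
  unfold cut at h1 h2 hX
  omega

/-- The monochromatic path from `x` to `t` is traced backwards through tight sets `Y ⊆ A` avoiding
`x`. Only one monochromatic arc enters such a `Y`, so the path from `x` and a path from `w` into `Y`
enter by the same arc, and `w` reaches its tail. Continuing with a tight set around that tail, one
arrives at `x`, which these sets avoid. -/
lemma false_of_unique_entry (h : Split E A C x t u v w) (hE : Core k E) (hk : 3 ≤ k)
    {f : V → Fin k} (hA : Acyc (Mono (restr E A) f)) (htu : Acyc (Mono (E.erase (t, u)) f))
    (hT : ReflTransGen (Mono (restr E A) f) x t) (hM : ReflTransGen (Mono (restr E A) f) w t)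
    (hW : ¬ ReflTransGen (Mono (restr E A) f) w x) (hvw : f v = f w) : False := by
  have key : ∀ p, ReflTransGen (Mono (restr E A) f) x p → ∀ Y ⊆ A, x ∉ Y → p ∈ Y → cut E Yᶜ ≤ k →
      Acyc (Mono (restr E Yᶜ) f) → (∃ y ∈ Y, ReflTransGen (Mono (restr E A) f) w y) → False := by
    intro p hp
    induction hp with
    | refl => exact fun Y _ hx hx' _ _ _ => hx hx'
    | @tail p' p _ hpp ih =>
      rintro Y hYA hxY hpY hcut hac ⟨y, hyY, hwy⟩
      by_cases hp' : p' ∈ Y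
      · exact ih Y hYA hxY hp' hcut hac ⟨y, hyY, hwy⟩
      have hYac : Acyc (Mono (restr E Yᶜᶜ) f) := hA.mono fun a b hab => by
        have := mem_restr.1 hab.1
        rw [compl_compl] at this
        exact ⟨mem_restr.2 ⟨this.1, hYA this.2.1, hYA this.2.2⟩, hab.2⟩
      have hpE := mem_restr.1 hpp.1
      have huniq : ∀ a b, (a, b) ∈ E → f a = f b → a ∉ Y → b ∈ Y → a = p' := by
        intro a b hab hc ha hb
        have := eq_of_mono_leaving hE.not_col hac hYac hcut (e := (a, b)) (e' := (p', p))
          (mem_leaving.2 ⟨hab, ha, fun hh => hh hb⟩)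
          (mem_leaving.2 ⟨hpE.1, hp', fun hh => hh hpY⟩) hc hpp.2
        exact congrArg Prod.fst this
      have hwY : w ∉ Y := fun hwY => by
        have := huniq v w h.vw_mem hvw (fun hv => h.notMem_A h.v_mem h.v_ne (hYA hv)) hwY
        exact h.notMem_A h.v_mem h.v_ne (this ▸ hpE.2.1)
      obtain ⟨a, b, hab, ha, hb, hwa, _⟩ := exists_leaving_of_reach hwy (X := Yᶜ) hwY
        (fun hh => hh hyY)
      obtain rfl := huniq a b (mem_restr.1 hab.1).1 hab.2 ha (not_not.1 hb)
      have hax : a ≠ x := fun hh => hW (hh ▸ hwa)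
      obtain ⟨Y', hY'A, hxY', haY', hcut'⟩ := h.exists_tight hE hk hpE.2.1 hax
      -- The only monochromatic arc into `Y` starts at `a ∈ Y'`; outside `Y'` no monochromatic arc
      -- passes from `Yᶜ` to `Y`.
      refine ih Y' hY'A hxY' haY' hcut' (Acyc.of_closed (X := Yᶜ) ?_ ?_ ?_) ⟨a, haY', hwa⟩
      · rintro c d hcd hc hd
        have := mem_restr.1 hcd.1
        exact this.2.1 (huniq c d this.1 hcd.2 hc hd ▸ haY')
      · exact hac.mono fun c d hcd => ⟨mem_restr.2 ⟨(mem_restr.1 hcd.1.1).1, hcd.2⟩, hcd.1.2⟩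
      · exact hYac.mono fun c d hcd => ⟨mem_restr.2 ⟨(mem_restr.1 hcd.1.1).1, hcd.2⟩, hcd.1.2⟩
  obtain ⟨Y, hYA, hxY, htY, hcut⟩ := h.exists_tight hE hk h.t_mem h.t_ne
  refine key t hT Y hYA hxY htY hcut (htu.mono fun c d hcd => ⟨?_, hcd.2⟩) ⟨t, htY, hM⟩
  have := mem_restr.1 hcd.1
  refine Finset.mem_erase.2 ⟨fun hh => ?_, this.1⟩
  rw [Prod.mk.injEq] at hh
  exact this.2.1 (hh.1 ▸ htY)

/-- Recolouring one side so that the cycle by `tu` through `x` disappears forces another cycle, and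
this gives `v` and `w` the colour of `x`. The tracing argument then applies to `E` or to its
reversal, according to which half of the cycle by `vw` is missing. -/
lemma reach_aux [Finite V] (h : Split E A C x t u v w) (hE : Core k E) (hk : 3 ≤ k)
    {f : V → Fin k} (hA : Acyc (Mono (restr E A) f)) (hC : Acyc (Mono (restr E C) f))
    (hT : ReflTransGen (Mono (restr E A) f) x t) (hU : ReflTransGen (Mono (restr E C) f) u x)
    (hWV : ¬ (ReflTransGen (Mono (restr E A) f) w x ∧ ReflTransGen (Mono (restr E C) f) x v)) :
    False := by
  have hcol : ∀ {X : Set V} {p q : V}, ReflTransGen (Mono (restr E X) f) p q → f p = f q :=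
    fun hr => reach_congr (fun p q hpq => hpq.2) hr
  have h1 : ReflTransGen (Mono (restr E C) f) x v ∨ ReflTransGen (Mono (restr E C) f) u v := by
    obtain ⟨g, hg, hgT⟩ := h.exists_col_not_reach hE (by omega)
    obtain ⟨g', hgx, hg'⟩ := exists_col_eq (restr E A) g x (f x)
    rw [← hg'] at hg hgT
    rcases h.reach_of_not_col hE.not_col hgx hg hC with h' | h' | h'
    exacts [absurd h'.1 hgT, Or.inl h'.2, Or.inr h'.2.1]
  have h2 : ReflTransGen (Mono (restr E A) f) w x ∨ ReflTransGen (Mono (restr E A) f) w t := by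
    obtain ⟨g, hg, hgT⟩ := h.rev.exists_col_not_reach hE.rev (by omega)
    rw [restr_rev] at hg hgT
    rw [reach_rev] at hgT
    have hg := hg.rev
    rw [rev_rev] at hg
    obtain ⟨g', hgx, hg'⟩ := exists_col_eq (restr E C) g x (f x)
    rw [← hg'] at hg hgT
    rcases h.reach_of_not_col hE.not_col hgx.symm hA hg with h' | h' | h'
    exacts [absurd h'.2 hgT, Or.inl h'.1, Or.inr h'.1]
  have hfv : f v = f x := h1.elim (fun hr => (hcol hr).symm)
    (fun hr => (hcol hr).symm.trans (hcol hU))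
  have hfw : f w = f x := h2.elim (fun hr => hcol hr) (fun hr => (hcol hr).trans (hcol hT).symm)
  have htu := h.acyc_erase hA hC hWV
  by_cases hW : ReflTransGen (Mono (restr E A) f) w x
  · have hV : ¬ ReflTransGen (Mono (restr E C) f) x v := fun hV => hWV ⟨hW, hV⟩
    have hN := h1.resolve_left hV
    refine h.rev.false_of_unique_entry hE.rev hk (f := f) ?_ ?_ ?_ ?_ ?_ (hfw.trans hfv.symm)
    · rw [restr_rev]; exact hC.rev
    · refine htu.rev.mono fun p q hpq => ⟨?_, hpq.2⟩
      have := Finset.mem_erase.1 hpq.1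
      rw [mem_rev, Finset.mem_erase]
      refine ⟨fun hh => this.1 ?_, mem_rev.1 this.2⟩
      rw [Prod.mk.injEq] at hh ⊢
      exact ⟨hh.2, hh.1⟩
    · rw [restr_rev, reach_rev]; exact hU
    · rw [restr_rev, reach_rev]; exact hN
    · rw [restr_rev, reach_rev]; exact hV
  · exact h.false_of_unique_entry hE hk hA htu hT (h2.resolve_left hW) hW (hfv.trans hfw.symm)

/-- In a split extremal digraph, any colouring of the two sides creates monochromatic cycles which
remain when the vertex `x` is split into two vertices joined by no path. -/
theorem reach_of_core [Finite V] (h : Split E A C x t u v w) (hE : Core k E) (hk : 3 ≤ k)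
    {f : V → Fin k} (hA : Acyc (Mono (restr E A) f)) (hC : Acyc (Mono (restr E C) f)) :
    ((ReflTransGen (Mono (restr E A) f) x t ∧ ReflTransGen (Mono (restr E C) f) u x) ∧
      ReflTransGen (Mono (restr E A) f) w x ∧ ReflTransGen (Mono (restr E C) f) x v) ∨
    (ReflTransGen (Mono (restr E A) f) w t ∧ ReflTransGen (Mono (restr E C) f) u v ∧
      f t = f u) := by
  rcases h.reach_of_not_col hE.not_col rfl hA hC with h1 | h1 | h1
  · by_contra hcon
    push Not at hcon
    exact h.reach_aux hE hk hA hC h1.1 h1.2 fun h2 => hcon.1 h1 h2.1 h2.2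
  · by_contra hcon
    push Not at hcon
    exact h.swap.reach_aux hE hk hC hA h1.2 h1.1 fun h2 => hcon.1 ⟨h2.2, h2.1⟩ h1.1 h1.2
  · exact Or.inr h1

end Split

/-! ### Joins of arc sets and the maps between a join and its parts -/

variable {W : Type*}

/-- Two disjoint sets whose entering arcs, with one exception each, all leave `X`. -/
lemma cut_add_cut_le {E : Finset (V × V)} {X Y Z : Set V} {e f : V × V} (hd : Disjoint Y Z)
    (hY : ∀ g ∈ leaving E Yᶜ, g = e ∨ g ∈ leaving E X)
    (hZ : ∀ g ∈ leaving E Zᶜ, g = f ∨ g ∈ leaving E X) :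
    cut E Yᶜ + cut E Zᶜ ≤ cut E X + 2 := by
  have h1 : (leaving E Yᶜ).erase e ⊆ leaving E X := fun g hg =>
    (hY g (Finset.mem_of_mem_erase hg)).resolve_left (Finset.ne_of_mem_erase hg)
  have h2 : (leaving E Zᶜ).erase f ⊆ leaving E X := fun g hg =>
    (hZ g (Finset.mem_of_mem_erase hg)).resolve_left (Finset.ne_of_mem_erase hg)
  have h3 : Disjoint ((leaving E Yᶜ).erase e) ((leaving E Zᶜ).erase f) := by
    rw [Finset.disjoint_left]
    intro g hg hg'
    have h4 := (mem_leaving.1 (Finset.mem_of_mem_erase hg)).2.2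
    have h5 := (mem_leaving.1 (Finset.mem_of_mem_erase hg')).2.2
    exact Set.disjoint_left.1 hd (not_not.1 h4) (not_not.1 h5)
  have h4 := Finset.card_le_card (Finset.union_subset h1 h2)
  rw [Finset.card_union_of_disjoint h3] at h4
  have h6 := Finset.pred_card_le_card_erase (s := leaving E Yᶜ) (a := e)
  have h7 := Finset.pred_card_le_card_erase (s := leaving E Zᶜ) (a := f)
  unfold cut
  omega

/-- `ED` is the parallel Hajós join of `EA` and `EB`. -/
structure Join (EA : Finset (V × V)) (EB : Finset (W × W)) (A C : Set V) (x t u v w : V)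
    (a b : W) (ED : Finset (({y : V // y ≠ x} ⊕ W) × ({y : V // y ≠ x} ⊕ W))) : Prop where
  split : Split EA A C x t u v w
  loopless_A : ∀ y, (y, y) ∉ EA
  loopless_B : ∀ p, (p, p) ∉ EB
  ab_mem : (a, b) ∈ EB
  ba_mem : (b, a) ∈ EB
  inl_inl : ∀ y z, (Sum.inl y, Sum.inl z) ∈ ED ↔ (y.1, z.1) ∈ EA
  inl_inr : ∀ y q, (Sum.inl y, Sum.inr q) ∈ ED ↔
    (y.1, x) ∈ EA ∧ (y.1 ∈ A ∧ q = a ∨ y.1 ∈ C ∧ q = b)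
  inr_inl : ∀ p z, (Sum.inr p, Sum.inl z) ∈ ED ↔
    (x, z.1) ∈ EA ∧ (z.1 ∈ A ∧ p = a ∨ z.1 ∈ C ∧ p = b)
  inr_inr : ∀ p q, (Sum.inr p, Sum.inr q) ∈ ED ↔
    (p, q) ∈ EB ∧ ¬ (p = a ∧ q = b) ∧ ¬ (p = b ∧ q = a)

/-- The projection collapsing the copy of `EB` to `x`. -/
def proj {x : V} : {y : V // y ≠ x} ⊕ W → V := Sum.elim Subtype.val fun _ => x

/-- The embedding sending `x` to `c`. -/
noncomputable def emb (x : V) (c : W) (y : V) : {y : V // y ≠ x} ⊕ W :=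
  if h : y = x then Sum.inr c else Sum.inl ⟨y, h⟩

@[simp] lemma proj_inl {x : V} (y : {y : V // y ≠ x}) : proj (W := W) (Sum.inl y) = y.1 := rfl

@[simp] lemma proj_inr {x : V} (p : W) : proj (x := x) (Sum.inr p) = x := rfl

@[simp] lemma emb_self (x : V) (c : W) : emb x c x = Sum.inr c := by simp [emb]

lemma emb_of_ne {x : V} (c : W) {y : V} (h : y ≠ x) : emb x c y = Sum.inl ⟨y, h⟩ := by
  simp [emb, h]

lemma emb_inl {x : V} (c : W) (y : {y : V // y ≠ x}) : emb x c y.1 = Sum.inl y :=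
  emb_of_ne c y.2

lemma proj_emb (x : V) (c : W) (y : V) : proj (emb x c y) = y := by
  by_cases h : y = x
  · subst h; simp
  · rw [emb_of_ne c h]; rfl

namespace Join

variable {EA : Finset (V × V)} {EB : Finset (W × W)} {A C : Set V} {x t u v w : V} {a b : W}
  {ED : Finset (({y : V // y ≠ x} ⊕ W) × ({y : V // y ≠ x} ⊕ W))}

lemma swap (h : Join EA EB A C x t u v w a b ED) : Join EA EB C A x v w t u b a ED where
  split := h.split.swap
  loopless_A := h.loopless_A
  loopless_B := h.loopless_B
  ab_mem := h.ba_mem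
  ba_mem := h.ab_mem
  inl_inl := h.inl_inl
  inl_inr y q := by rw [h.inl_inr, or_comm]
  inr_inl y q := by rw [h.inr_inl, or_comm]
  inr_inr p q := by rw [h.inr_inr, and_comm (a := ¬ (p = a ∧ q = b))]

lemma a_ne_b (h : Join EA EB A C x t u v w a b ED) : a ≠ b := fun hh =>
  h.loopless_B a (by have := h.ab_mem; rwa [← hh] at this)

lemma inl_inr_of_mem_A (h : Join EA EB A C x t u v w a b ED) {y : {y : V // y ≠ x}} {q : W}
    (hy : y.1 ∈ A) : (Sum.inl y, Sum.inr q) ∈ ED ↔ (y.1, x) ∈ EA ∧ q = a := by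
  rw [h.inl_inr]
  have := h.split.notMem_C hy y.2
  tauto

lemma inr_inl_of_mem_A (h : Join EA EB A C x t u v w a b ED) {y : {y : V // y ≠ x}} {q : W}
    (hy : y.1 ∈ A) : (Sum.inr q, Sum.inl y) ∈ ED ↔ (x, y.1) ∈ EA ∧ q = a := by
  rw [h.inr_inl]
  have := h.split.notMem_C hy y.2
  tauto

lemma inl_inr_of_mem_C (h : Join EA EB A C x t u v w a b ED) {y : {y : V // y ≠ x}} {q : W}
    (hy : y.1 ∈ C) : (Sum.inl y, Sum.inr q) ∈ ED ↔ (y.1, x) ∈ EA ∧ q = b :=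
  h.swap.inl_inr_of_mem_A hy

lemma inr_inl_of_mem_C (h : Join EA EB A C x t u v w a b ED) {y : {y : V // y ≠ x}} {q : W}
    (hy : y.1 ∈ C) : (Sum.inr q, Sum.inl y) ∈ ED ↔ (x, y.1) ∈ EA ∧ q = b :=
  h.swap.inr_inl_of_mem_A hy

lemma emb_mem_of_A (h : Join EA EB A C x t u v w a b ED) {p q : V} (hpq : (p, q) ∈ EA)
    (hp : p ∈ A) (hq : q ∈ A) : (emb x a p, emb x a q) ∈ ED := by
  by_cases hpx : p = x
  · subst hpx
    have hqx : q ≠ p := fun hh => h.loopless_A p (hh ▸ hpq)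
    rw [emb_self, emb_of_ne a hqx]
    exact (h.inr_inl_of_mem_A hq).2 ⟨hpq, rfl⟩
  · by_cases hqx : q = x
    · subst hqx
      rw [emb_self, emb_of_ne a hpx]
      exact (h.inl_inr_of_mem_A hp).2 ⟨hpq, rfl⟩
    · rw [emb_of_ne a hpx, emb_of_ne a hqx]
      exact (h.inl_inl _ _).2 hpq

lemma emb_mem_of_C (h : Join EA EB A C x t u v w a b ED) {p q : V} (hpq : (p, q) ∈ EA)
    (hp : p ∈ C) (hq : q ∈ C) : (emb x b p, emb x b q) ∈ ED := h.swap.emb_mem_of_A hpq hp hq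

lemma tu_mem (h : Join EA EB A C x t u v w a b ED) (c d : W) : (emb x c t, emb x d u) ∈ ED := by
  rw [emb_of_ne c h.split.t_ne, emb_of_ne d h.split.u_ne]
  exact (h.inl_inl _ _).2 h.split.tu_mem

lemma vw_mem (h : Join EA EB A C x t u v w a b ED) (c d : W) : (emb x c v, emb x d w) ∈ ED :=
  h.swap.tu_mem c d

/-- Every arc of `EA` lifts to the join. -/
lemma exists_lift (h : Join EA EB A C x t u v w a b ED) {p q : V} (hpq : (p, q) ∈ EA) :
    ∃ c, (c = a ∨ c = b) ∧ (emb x c p, emb x c q) ∈ ED := by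
  rcases h.split.arc_cases hpq with h' | h' | ⟨rfl, rfl⟩ | ⟨rfl, rfl⟩
  · exact ⟨a, Or.inl rfl, h.emb_mem_of_A hpq h'.1 h'.2⟩
  · exact ⟨b, Or.inr rfl, h.emb_mem_of_C hpq h'.1 h'.2⟩
  · exact ⟨a, Or.inl rfl, h.tu_mem a a⟩
  · exact ⟨a, Or.inl rfl, h.vw_mem a a⟩

/-- An arc of the join with an end outside the copy of `EB` projects to an arc of `EA`. -/
lemma proj_mem (h : Join EA EB A C x t u v w a b ED) {p q : {y : V // y ≠ x} ⊕ W}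
    (hpq : (p, q) ∈ ED) (hne : ¬ (p.isRight ∧ q.isRight)) : (proj p, proj q) ∈ EA := by
  rcases p with y | p <;> rcases q with z | q
  · exact (h.inl_inl _ _).1 hpq
  · exact ((h.inl_inr _ _).1 hpq).1
  · exact ((h.inr_inl _ _).1 hpq).1
  · simp at hne

/-- Cuts of the join that do not separate `a` from `b`. -/
lemma cut_emb_le (h : Join EA EB A C x t u v w a b ED) {X : Set ({y : V // y ≠ x} ⊕ W)}
    (hab : Sum.inr a ∈ X ↔ Sum.inr b ∈ X) : cut EA {y | emb x a y ∈ X} ≤ cut ED X := by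
  have key : ∀ e : V × V, ∃ c : W, (c = a ∨ c = b) ∧
      (e ∈ EA → (emb x c e.1, emb x c e.2) ∈ ED) := by
    rintro ⟨p, q⟩
    by_cases hpq : (p, q) ∈ EA
    · obtain ⟨c, h1, h2⟩ := h.exists_lift hpq
      exact ⟨c, h1, fun _ => h2⟩
    · exact ⟨a, Or.inl rfl, fun hh => absurd hh hpq⟩
  choose c hc hcE using key
  have hX : ∀ d, (d = a ∨ d = b) → ∀ y, emb x d y ∈ X ↔ emb x a y ∈ X := by
    rintro d (rfl | rfl) y
    · exact Iff.rfl
    · by_cases hy : y = x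
      · subst hy; rw [emb_self, emb_self, hab]
      · rw [emb_of_ne _ hy, emb_of_ne _ hy]
  refine Finset.card_le_card_of_injOn (fun e => (emb x (c e) e.1, emb x (c e) e.2))
    (fun e he => ?_) (fun e _ f _ hef => ?_)
  · have he := mem_leaving.1 he
    refine mem_leaving.2 ⟨hcE e he.1, ?_⟩
    simp only [hX (c e) (hc e)]
    exact he.2
  · rw [Prod.mk.injEq] at hef
    have h1 := congrArg proj hef.1
    have h2 := congrArg proj hef.2
    rw [proj_emb, proj_emb] at h1 h2
    exact Prod.ext h1 h2

/-- Collapsing the copy of `EB` is injective on the arcs that cross: whether such an arc is attached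
at `a` or at `b` is determined by the side of its other end. -/
lemma cut_preimage_proj_le (h : Join EA EB A C x t u v w a b ED) (X : Set V) :
    cut ED (proj ⁻¹' X) ≤ cut EA X := by
  have inj : ∀ (p p' q : {y : V // y ≠ x} ⊕ W), (p, q) ∈ ED → (p', q) ∈ ED → proj p = proj p' →
      proj p ≠ proj q → p = p' := by
    rintro (y | p) (y' | p') q h1 h2 h3 h4
    · rw [Subtype.ext (show y.1 = y'.1 from h3)]
    · exact absurd h3 y.2
    · exact absurd h3.symm y'.2
    · rcases q with z | q
      · rcases h.split.union z.1 with hz | hz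
        · rw [((h.inr_inl_of_mem_A hz).1 h1).2, ((h.inr_inl_of_mem_A hz).1 h2).2]
        · rw [((h.inr_inl_of_mem_C hz).1 h1).2, ((h.inr_inl_of_mem_C hz).1 h2).2]
      · exact absurd rfl h4
  have inj' : ∀ (p q q' : {y : V // y ≠ x} ⊕ W), (p, q) ∈ ED → (p, q') ∈ ED → proj q = proj q' →
      proj p ≠ proj q → q = q' := by
    rintro p (y | q) (y' | q') h1 h2 h3 h4
    · rw [Subtype.ext (show y.1 = y'.1 from h3)]
    · exact absurd h3 y.2
    · exact absurd h3.symm y'.2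
    · rcases p with z | p
      · rcases h.split.union z.1 with hz | hz
        · rw [((h.inl_inr_of_mem_A hz).1 h1).2, ((h.inl_inr_of_mem_A hz).1 h2).2]
        · rw [((h.inl_inr_of_mem_C hz).1 h1).2, ((h.inl_inr_of_mem_C hz).1 h2).2]
      · exact absurd rfl h4
  have hne : ∀ p q : {y : V // y ≠ x} ⊕ W, proj p ∈ X → proj q ∉ X → proj p ≠ proj q :=
    fun p q hp hq hh => hq (hh ▸ hp)
  refine Finset.card_le_card_of_injOn (fun e => (proj e.1, proj e.2)) ?_ ?_
  · rintro ⟨p, q⟩ he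
    obtain ⟨h1, h2, h3⟩ := mem_leaving.1 he
    refine mem_leaving.2 ⟨h.proj_mem h1 ?_, h2, h3⟩
    rintro ⟨hp, hq⟩
    obtain ⟨p, rfl⟩ := Sum.isRight_iff.1 hp
    obtain ⟨q, rfl⟩ := Sum.isRight_iff.1 hq
    exact h3 h2
  · rintro ⟨p, q⟩ he ⟨p', q'⟩ he' hh
    obtain ⟨h1, h2, h3⟩ := mem_leaving.1 he
    obtain ⟨h1', h2', h3'⟩ := mem_leaving.1 he'
    rw [Prod.mk.injEq] at hh
    simp only [Set.mem_preimage] at h2 h3 h2' h3'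
    have hq : q = q' := by
      rcases q with y | q
      · rcases q' with y' | q'
        · rw [Subtype.ext (show y.1 = y'.1 from hh.2)]
        · exact absurd hh.2 y.2
      · rcases q' with y' | q'
        · exact absurd hh.2.symm y'.2
        · rcases p with y | p
          · rcases p' with y' | p'
            · obtain rfl := Subtype.ext (show y.1 = y'.1 from hh.1)
              exact inj' _ _ _ h1 h1' hh.2 (hne _ _ h2 h3)
            · exact absurd hh.1 y.2
          · exact absurd h2 h3
    subst hq
    rw [inj p p' q h1 h1' hh.1 (hne _ _ h2 h3)]

end Join

/-! ### Extremal parts give an extremal join -/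

namespace Join

variable {EA : Finset (V × V)} {EB : Finset (W × W)} {A C : Set V} {x t u v w : V} {a b : W}
  {ED : Finset (({y : V // y ≠ x} ⊕ W) × ({y : V // y ≠ x} ⊕ W))} {k : ℕ}

lemma loopless_D (h : Join EA EB A C x t u v w a b ED) : ∀ p, (p, p) ∉ ED := by
  rintro (y | p) hp
  · exact h.loopless_A _ ((h.inl_inl _ _).1 hp)
  · exact h.loopless_B _ ((h.inr_inr _ _).1 hp).1

/-- If `a` and `b` have different colours, the digon is irrelevant and `EB` is coloured. Otherwise
the monochromatic paths of `Split.reach_of_core` lift to the sides of the join and close up through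
`tu` and `vw`. -/
lemma not_col_of_core (h : Join EA EB A C x t u v w a b ED) [Finite V] [NeZero k] (hk : 3 ≤ k)
    (hA : Core k EA) (hB : ¬ Col k EB) : ¬ Col k ED := by
  rintro ⟨φ, hφ⟩
  by_cases hab : φ (Sum.inr a) = φ (Sum.inr b)
  · set f : V → Fin k := fun y => φ (emb x a y) with hf
    have hfb : ∀ y, f y = φ (emb x b y) := fun y => by
      by_cases hy : y = x
      · subst hy; rw [hf]; simp [hab]
      · rw [hf]; simp [emb_of_ne _ hy]
    have hlA : ∀ p q, Mono (restr EA A) f p q → Mono ED φ (emb x a p) (emb x a q) :=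
      fun p q hpq => ⟨h.emb_mem_of_A (mem_restr.1 hpq.1).1 (mem_restr.1 hpq.1).2.1
        (mem_restr.1 hpq.1).2.2, hpq.2⟩
    have hlC : ∀ p q, Mono (restr EA C) f p q → Mono ED φ (emb x b p) (emb x b q) :=
      fun p q hpq => ⟨h.emb_mem_of_C (mem_restr.1 hpq.1).1 (mem_restr.1 hpq.1).2.1
        (mem_restr.1 hpq.1).2.2, by rw [← hfb, ← hfb]; exact hpq.2⟩
    have hcol : ∀ {X : Set V} {p q : V}, ReflTransGen (Mono (restr EA X) f) p q → f p = f q :=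
      fun hr => reach_congr (fun p q hpq => hpq.2) hr
    have htu : f t = f u → TransGen (Mono ED φ) (emb x a t) (emb x b u) := fun hc =>
      .single ⟨h.tu_mem a b, by rw [← hfb]; exact hc⟩
    have hvw : f v = f w → TransGen (Mono ED φ) (emb x b v) (emb x a w) := fun hc =>
      .single ⟨h.vw_mem b a, by rw [← hfb]; exact hc⟩
    rcases h.split.reach_of_core hA hk (hφ.lift _ hlA) (hφ.lift _ hlC) with
      ⟨⟨hT, hU⟩, hW, hV⟩ | ⟨hM, hN, hc⟩
    · have h1 := ReflTransGen.lift _ hlA _ _ hT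
      have h2 := ReflTransGen.lift _ hlC _ _ hU
      have h3 := ReflTransGen.lift _ hlA _ _ hW
      have h4 := ReflTransGen.lift _ hlC _ _ hV
      have h5 := (TransGen.trans_right h1 (htu ((hcol hT).symm.trans (hcol hU).symm))).trans_left h2
      have h6 := (TransGen.trans_right h4 (hvw ((hcol hV).symm.trans (hcol hW).symm))).trans_left h3
      simp only [emb_self] at h5 h6
      exact hφ _ (h5.trans h6)
    · have h1 := ReflTransGen.lift _ hlA _ _ hM
      have h2 := ReflTransGen.lift _ hlC _ _ hN
      have h3 := (TransGen.trans_right h1 (htu hc)).trans_left h2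
      exact hφ _ (h3.trans (hvw (by rw [hcol hM, hc, hcol hN])))
  · refine hB ⟨fun p => φ (Sum.inr p), hφ.lift Sum.inr ?_⟩
    rintro p q ⟨hpq, hc⟩
    refine ⟨(h.inr_inr _ _).2 ⟨hpq, ?_, ?_⟩, hc⟩
    · rintro ⟨rfl, rfl⟩; exact hab hc
    · rintro ⟨rfl, rfl⟩; exact hab hc.symm

/-- Only the two arcs of the digon are lost, so a cut of three arcs keeps one. -/
lemma exists_leaving_of_two_lt (h : Join EA EB A C x t u v w a b ED) {X : Set W}
    (hX : 2 < cut EB X) :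
    ∃ p q, (Sum.inr p, Sum.inr q) ∈ ED ∧ p ∈ X ∧ q ∉ X := by
  by_contra hcon
  push Not at hcon
  have : leaving EB X ⊆ {(a, b), (b, a)} := by
    rintro ⟨p, q⟩ he
    obtain ⟨hpq, hp, hq⟩ := mem_leaving.1 he
    by_contra hne
    refine hq (hcon p q ((h.inr_inr _ _).2 ⟨hpq, ?_, ?_⟩) hp)
    · rintro ⟨rfl, rfl⟩; simp at hne
    · rintro ⟨rfl, rfl⟩; simp at hne
  have := (Finset.card_le_card this).trans Finset.card_le_two
  unfold cut at hX
  omega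

/-- If all vertices of `EB` are on the same side of `X`, so are a vertex and its image. -/
lemma emb_proj_mem_iff {X : Set ({y : V // y ≠ x} ⊕ W)}
    (hX : ∀ p q : W, Sum.inr p ∈ X ↔ Sum.inr q ∈ X) (c : W) (p : {y : V // y ≠ x} ⊕ W) :
    emb x c (proj p) ∈ X ↔ p ∈ X := by
  rcases p with y | d
  · rw [proj_inl, emb_inl]
  · rw [proj_inr, emb_self]; exact hX _ _

lemma strong_of_core (h : Join EA EB A C x t u v w a b ED) [NeZero k] (hk : 3 ≤ k)
    (hA : Core k EA) (hB : Core k EB) (X : Set ({y : V // y ≠ x} ⊕ W)) (p) (hp : p ∈ X) (q)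
    (hq : q ∉ X) : ∃ e ∈ ED, e.1 ∈ X ∧ e.2 ∉ X := by
  by_cases hX : ∀ p q : W, Sum.inr p ∈ X ↔ Sum.inr q ∈ X
  · obtain ⟨⟨y, z⟩, he, hy, hz⟩ := hA.strong {y | emb x a y ∈ X} (proj p)
      ((emb_proj_mem_iff hX a p).2 hp) (proj q) (fun hh => hq ((emb_proj_mem_iff hX a q).1 hh))
    obtain ⟨c, _, hc⟩ := h.exists_lift he
    refine ⟨_, hc, ?_, ?_⟩
    · rw [← emb_proj_mem_iff hX a, proj_emb]; exact hy
    · rw [← emb_proj_mem_iff hX a, proj_emb]; exact hz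
  · obtain ⟨p, q, hp, hq⟩ : ∃ p q : W, Sum.inr p ∈ X ∧ Sum.inr q ∉ X := by
      push Not at hX
      obtain ⟨p, q, hh | hh⟩ := hX
      exacts [⟨p, q, hh⟩, ⟨q, p, hh.2, hh.1⟩]
    have := hB.le_cut (X := {p | Sum.inr p ∈ X}) (p := p) (q := q) hp hq
    obtain ⟨p', q', he, hp', hq'⟩ := h.exists_leaving_of_two_lt (X := {p | Sum.inr p ∈ X}) (by omega)
    exact ⟨_, he, hp', hq'⟩

/-- The retraction of the join onto `EB` sending one side to `a` and the other one to `b`. -/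
noncomputable def retract (A : Set V) (x : V) (a b : W) : {y : V // y ≠ x} ⊕ W → W :=
  Sum.elim (fun y => if y.1 ∈ A then a else b) id

/-- Collapsing the sides onto `a` and `b` sends `tu` and `vw` to the deleted arcs `ab` and `ba` and
contracts all other arcs of the sides, so crossing arcs are mapped injectively. -/
lemma cut_preimage_retract_le (h : Join EA EB A C x t u v w a b ED) (X : Set W) :
    cut ED (retract A x a b ⁻¹' X) ≤ cut EB X := by
  have hab := h.a_ne_b
  have rA : ∀ y : {y : V // y ≠ x}, y.1 ∈ A → retract A x a b (Sum.inl y) = a := fun y hy => by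
    simp [retract, hy]
  have rC : ∀ y : {y : V // y ≠ x}, y.1 ∈ C → retract A x a b (Sum.inl y) = b := fun y hy => by
    simp [retract, h.split.notMem_A hy y.2]
  have rW : ∀ p : W, retract A x a b (Sum.inr p : {y : V // y ≠ x} ⊕ W) = p := fun p => rfl
  have key : ∀ p q : {y : V // y ≠ x} ⊕ W, (p, q) ∈ ED →
      retract A x a b p ≠ retract A x a b q →
      (p = emb x a t ∧ q = emb x a u ∧ retract A x a b p = a ∧ retract A x a b q = b) ∨
      (p = emb x a v ∧ q = emb x a w ∧ retract A x a b p = b ∧ retract A x a b q = a) ∨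
      (∃ p' q', p = Sum.inr p' ∧ q = Sum.inr q' ∧ (p', q') ∈ EB ∧
        ¬ (p' = a ∧ q' = b) ∧ ¬ (p' = b ∧ q' = a)) := by
    rintro (y | p) (z | q) hpq hne
    · have hyz := (h.inl_inl _ _).1 hpq
      rcases h.split.union y.1 with hy | hy <;> rcases h.split.union z.1 with hz | hz
      · rw [rA y hy, rA z hz] at hne; exact absurd rfl hne
      · left
        obtain ⟨h1, h2⟩ := (h.split.arc_AC _ hy y.2 _ hz z.2).1 hyz
        rw [← h1, ← h2, emb_inl, emb_inl, rA y hy, rC z hz]; simp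
      · right; left
        obtain ⟨h1, h2⟩ := (h.split.arc_CA _ hy y.2 _ hz z.2).1 hyz
        rw [← h1, ← h2, emb_inl, emb_inl, rC y hy, rA z hz]; simp
      · rw [rC y hy, rC z hz] at hne; exact absurd rfl hne
    · rcases h.split.union y.1 with hy | hy
      · have := ((h.inl_inr_of_mem_A hy).1 hpq).2
        rw [rA y hy, rW] at hne; exact absurd this.symm hne
      · have := ((h.inl_inr_of_mem_C hy).1 hpq).2
        rw [rC y hy, rW] at hne; exact absurd this.symm hne
    · rcases h.split.union z.1 with hz | hz
      · have := ((h.inr_inl_of_mem_A hz).1 hpq).2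
        rw [rA z hz, rW] at hne; exact absurd this hne
      · have := ((h.inr_inl_of_mem_C hz).1 hpq).2
        rw [rC z hz, rW] at hne; exact absurd this hne
    · right; right
      exact ⟨p, q, rfl, rfl, (h.inr_inr _ _).1 hpq⟩
  refine Finset.card_le_card_of_injOn (fun e => (retract A x a b e.1, retract A x a b e.2)) ?_ ?_
  · rintro ⟨p, q⟩ he
    obtain ⟨h1, h2, h3⟩ := mem_leaving.1 he
    refine mem_leaving.2 ⟨?_, h2, h3⟩
    rcases key p q h1 (fun hh => h3 (show retract A x a b q ∈ X from hh ▸ h2)) with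
      ⟨_, _, hp, hq⟩ | ⟨_, _, hp, hq⟩ | ⟨p', q', rfl, rfl, hpq, _⟩
    · simp only [hp, hq]; exact h.ab_mem
    · simp only [hp, hq]; exact h.ba_mem
    · exact hpq
  · rintro ⟨p, q⟩ he ⟨p', q'⟩ he' hh
    obtain ⟨h1, h2, h3⟩ := mem_leaving.1 he
    obtain ⟨h1', h2', h3'⟩ := mem_leaving.1 he'
    rw [Prod.mk.injEq] at hh
    simp only at hh
    rcases key p q h1 (fun hh => h3 (show retract A x a b q ∈ X from hh ▸ h2)) with
        ⟨e1, e2, hp, hq⟩ | ⟨e1, e2, hp, hq⟩ | ⟨c, d, rfl, rfl, hpq, n1, n2⟩ <;>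
      rcases key p' q' h1' (fun hh => h3' (show retract A x a b q' ∈ X from hh ▸ h2')) with
        ⟨e1', e2', hp', hq'⟩ | ⟨e1', e2', hp', hq'⟩ | ⟨c', d', rfl, rfl, hpq', n1', n2'⟩
    · rw [e1, e2, e1', e2']
    · rw [hp, hp'] at hh; exact absurd hh.1 hab
    · rw [hp, hq] at hh; exact absurd ⟨hh.1.symm, hh.2.symm⟩ n1'
    · rw [hp, hp'] at hh; exact absurd hh.1.symm hab
    · rw [e1, e2, e1', e2']
    · rw [hp, hq] at hh; exact absurd ⟨hh.1.symm, hh.2.symm⟩ n2'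
    · rw [hp', hq'] at hh; exact absurd hh n1
    · rw [hp', hq'] at hh; exact absurd hh n2
    · rw [rW, rW, rW, rW] at hh; rw [hh.1, hh.2]

lemma separated_of_core (h : Join EA EB A C x t u v w a b ED)
    (hA : Core k EA) (hB : Core k EB) (p q : {y : V // y ≠ x} ⊕ W) (hpq : p ≠ q) :
    ∃ X : Set ({y : V // y ≠ x} ⊕ W), p ∈ X ∧ q ∉ X ∧ cut ED X ≤ k := by
  by_cases hπ : proj p = proj q
  · rcases p with y | p <;> rcases q with z | q
    · exact absurd (by rw [Subtype.ext (show y.1 = z.1 from hπ)]) hpq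
    · exact absurd hπ y.2
    · exact absurd hπ.symm z.2
    · obtain ⟨X, h1, h2, h3⟩ := hB.separated p q (fun hh => hpq (by rw [hh]))
      exact ⟨_, h1, h2, (h.cut_preimage_retract_le X).trans h3⟩
  · obtain ⟨X, h1, h2, h3⟩ := hA.separated _ _ hπ
    exact ⟨_, h1, h2, (h.cut_preimage_proj_le X).trans h3⟩

end Join

namespace Split

variable {E : Finset (V × V)} {A C : Set V} {x t u v w : V} {k : ℕ}

/-- The side `A \ {x}` is connected. -/
lemma mem_of_closed (h : Split E A C x t u v w) (hE : Core k E) {S : Set V}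
    (hS : ∀ y z, y ∈ A → y ≠ x → z ∈ A → z ≠ x → ((y, z) ∈ E ∨ (z, y) ∈ E) → y ∈ S → z ∈ S)
    {y z : V} (hy : y ∈ A) (hyx : y ≠ x) (hz : z ∈ A) (hzx : z ≠ x) (hyS : y ∈ S) : z ∈ S := by
  have htw := h.conn_A S hS
  -- The rest is attached to `A \ {x}` only at `t` and `w`, which `S` does not separate. So `S` is
  -- enlarged by everything outside `A`, or cut down to `A`, and stays closed.
  by_cases ht : t ∈ S
  · refine hE.conn x {y | y ∈ A → y ∈ S} (fun p q hp hq hpq hpS hqA => ?_) t z h.t_ne hzx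
      (fun _ => ht) hz
    rcases h.union p with hpA | hpC
    · exact hS p q hpA hp hqA hq hpq (hpS hpA)
    · rcases hpq with hpq | hpq
      · rw [((h.arc_CA p hpC hp q hqA hq).1 hpq).2]; exact htw.1 ht
      · rw [((h.arc_AC q hqA hq p hpC hp).1 hpq).1]; exact ht
  · refine absurd (hE.conn x {y | y ∈ A ∧ y ∈ S} (fun p q hp hq hpq hpS => ?_) y t hyx h.t_ne
      ⟨hy, hyS⟩).2 ht
    rcases h.union q with hqA | hqC
    · exact ⟨hqA, hS p q hpS.1 hp hqA hq hpq hpS.2⟩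
    · exfalso
      rcases hpq with hpq | hpq
      · exact ht (((h.arc_AC p hpS.1 hp q hqC hq).1 hpq).1 ▸ hpS.2)
      · exact ht (htw.2 (((h.arc_CA q hqC hq p hpS.1 hp).1 hpq).2 ▸ hpS.2))

lemma exists_nbr (h : Split E A C x t u v w) [NeZero k] (hE : Core k E) (hk : 2 ≤ k) :
    ∃ y ∈ A, y ≠ x ∧ (y, x) ∈ E := by
  rcases ReflTransGen.cases_tail (h.swap.reach_u_x hE hk) with hh | ⟨y, _, hy⟩
  · exact absurd hh.symm h.w_ne
  · have := mem_restr.1 hy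
    exact ⟨y, this.2.1, fun hh => hE.loopless x (by have := this.1; rwa [hh] at this), this.1⟩

end Split

namespace Join

variable {EA : Finset (V × V)} {EB : Finset (W × W)} {A C : Set V} {x t u v w : V} {a b : W}
  {ED : Finset (({y : V // y ≠ x} ⊕ W) × ({y : V // y ≠ x} ⊕ W))} {k : ℕ}

lemma side_mem_iff (h : Join EA EB A C x t u v w a b ED) (hA : Core k EA)
    {S : Set ({y : V // y ≠ x} ⊕ W)}
    (hS : ∀ y z : {y : V // y ≠ x}, y.1 ∈ A → z.1 ∈ A →
      ((Sum.inl y, Sum.inl z) ∈ ED ∨ (Sum.inl z, Sum.inl y) ∈ ED) → Sum.inl y ∈ S → Sum.inl z ∈ S)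
    {y z : {y : V // y ≠ x}} (hy : y.1 ∈ A) (hz : z.1 ∈ A) : Sum.inl y ∈ S ↔ Sum.inl z ∈ S := by
  have key : ∀ y z : {y : V // y ≠ x}, y.1 ∈ A → z.1 ∈ A → Sum.inl y ∈ S → Sum.inl z ∈ S := by
    intro y z hy hz hyS
    obtain ⟨_, hz'⟩ := h.split.mem_of_closed hA (S := {y | ∃ hy : y ≠ x, Sum.inl ⟨y, hy⟩ ∈ S})
      (fun p q hp hpx hq hqx hpq ⟨_, hpS⟩ => ⟨hqx, hS ⟨p, hpx⟩ ⟨q, hqx⟩ hp hq (by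
        rwa [h.inl_inl, h.inl_inl]) hpS⟩) hy y.2 hz z.2 ⟨y.2, hyS⟩
    exact hz'
  exact ⟨key y z hy hz, key z y hz hy⟩

/-- Each side is connected without `x`, and `tu` joins the two. Both `a` and `b` have a neighbour in
their side, so a detour through the sides replaces the missing digon. -/
lemma connOff_inr (h : Join EA EB A C x t u v w a b ED) [NeZero k] (hk : 3 ≤ k)
    (hA : Core k EA) (hB : Core k EB) (z : W) : ConnOff ED (Sum.inr z) := by
  intro S hS
  have hinl : ∀ y, (Sum.inl y : {y : V // y ≠ x} ⊕ W) ≠ Sum.inr z := fun y hh => by cases hh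
  have hinr : ∀ p, p ≠ z → (Sum.inr p : {y : V // y ≠ x} ⊕ W) ≠ Sum.inr z := fun p hp hh =>
    hp (Sum.inr.inj hh)
  have hiff : ∀ p q, p ≠ Sum.inr z → q ≠ Sum.inr z → ((p, q) ∈ ED ∨ (q, p) ∈ ED) →
      (p ∈ S ↔ q ∈ S) := fun p q hp hq hpq => ⟨hS p q hp hq hpq, hS q p hq hp hpq.symm⟩
  have htA : ∀ y : {y : V // y ≠ x}, y.1 ∈ A → (Sum.inl y ∈ S ↔ emb x a t ∈ S) := fun y hy => by
    rw [emb_of_ne a h.split.t_ne]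
    exact h.side_mem_iff hA (fun y z _ _ => hS _ _ (hinl y) (hinl z)) hy h.split.t_mem
  have htu : emb x a t ∈ S ↔ emb x a u ∈ S := by
    refine hiff _ _ ?_ ?_ (Or.inl (h.tu_mem a a))
    · rw [emb_of_ne a h.split.t_ne]; exact hinl _
    · rw [emb_of_ne a h.split.u_ne]; exact hinl _
  have hinlS : ∀ y : {y : V // y ≠ x}, Sum.inl y ∈ S ↔ emb x a t ∈ S := by
    intro y
    rcases h.split.union y.1 with hy | hy
    · exact htA y hy
    · rw [htu, emb_of_ne a h.split.u_ne]
      exact h.swap.side_mem_iff hA (fun y z _ _ => hS _ _ (hinl y) (hinl z)) hy h.split.u_mem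
  have haS : a ≠ z → (Sum.inr a ∈ S ↔ emb x a t ∈ S) := by
    intro haz
    obtain ⟨y, hy, hyx, hyE⟩ := h.split.exists_nbr hA (by omega)
    rw [← hinlS ⟨y, hyx⟩]
    exact hiff _ _ (hinr a haz) (hinl _) (Or.inr ((h.inl_inr_of_mem_A hy).2 ⟨hyE, rfl⟩))
  have hbS : b ≠ z → (Sum.inr b ∈ S ↔ emb x a t ∈ S) := by
    intro hbz
    obtain ⟨y, hy, hyx, hyE⟩ := h.split.swap.exists_nbr hA (by omega)
    rw [← hinlS ⟨y, hyx⟩]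
    exact hiff _ _ (hinr b hbz) (hinl _) (Or.inr ((h.inl_inr_of_mem_C hy).2 ⟨hyE, rfl⟩))
  have hBconn := hB.conn z {p | Sum.inr p ∈ S} (by
    intro p q hp hq hpq hpS
    by_cases h1 : p = a ∧ q = b
    · obtain ⟨rfl, rfl⟩ := h1
      exact (hbS hq).2 ((haS hp).1 hpS)
    · by_cases h2 : p = b ∧ q = a
      · obtain ⟨rfl, rfl⟩ := h2
        exact (haS hq).2 ((hbS hp).1 hpS)
      · refine hS _ _ (hinr p hp) (hinr q hq) ?_ hpS
        rw [h.inr_inr, h.inr_inr]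
        exact hpq.imp (fun hh => ⟨hh, h1, h2⟩)
          (fun hh => ⟨hh, fun h3 => h2 h3.symm, fun h3 => h1 h3.symm⟩))
  have hinrS : ∀ p, p ≠ z → (Sum.inr p ∈ S ↔ emb x a t ∈ S) := by
    intro p hp
    obtain ⟨c, hc, hcS⟩ : ∃ c, c ≠ z ∧ (Sum.inr c ∈ S ↔ emb x a t ∈ S) := by
      by_cases haz : a = z
      · have hbz : b ≠ z := fun hbz => h.a_ne_b (haz.trans hbz.symm)
        exact ⟨b, hbz, hbS hbz⟩
      · exact ⟨a, haz, haS haz⟩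
    rw [← hcS]
    exact ⟨hBconn p c hp hc, hBconn c p hc hp⟩
  have hall : ∀ p, p ≠ Sum.inr z → (p ∈ S ↔ emb x a t ∈ S) := by
    rintro (y | p) hp
    · exact hinlS y
    · exact hinrS p fun hh => hp (by rw [hh])
  intro p q hp hq hpS
  exact (hall q hq).2 ((hall p hp).1 hpS)

/-- The copy of `EB` stays connected because its cuts have at least three arcs; it can be collapsed
to `x`. -/
lemma connOff_inl (h : Join EA EB A C x t u v w a b ED) [NeZero k] (hk : 3 ≤ k)
    (hA : Core k EA) (hB : Core k EB) (z : {y : V // y ≠ x}) : ConnOff ED (Sum.inl z) := by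
  intro S hS
  have hinr : ∀ p, (Sum.inr p : {y : V // y ≠ x} ⊕ W) ≠ Sum.inl z := fun y hh => by cases hh
  have hW : ∀ p q : W, Sum.inr p ∈ S → Sum.inr q ∈ S := by
    intro p q hp
    by_contra hq
    have := hB.le_cut (X := {p | Sum.inr p ∈ S}) (p := p) (q := q) hp hq
    obtain ⟨p', q', he, hp', hq'⟩ := h.exists_leaving_of_two_lt (X := {p | Sum.inr p ∈ S}) (by omega)
    exact hq' (hS _ _ (hinr p') (hinr q') (Or.inl he) hp')
  have hX : ∀ p q : W, Sum.inr p ∈ S ↔ Sum.inr q ∈ S := fun p q => ⟨hW p q, hW q p⟩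
  have hne : ∀ c y, y ≠ z.1 → (emb x c y : {y : V // y ≠ x} ⊕ W) ≠ Sum.inl z := by
    intro c y hy hh
    have := congrArg proj hh
    rw [proj_emb] at this
    exact hy this
  have hAconn := hA.conn z.1 {y | emb x a y ∈ S} (by
    intro p q hp hq hpq hpS
    have hpS' : ∀ c, emb x c p ∈ S := fun c => by
      rw [← emb_proj_mem_iff hX a, proj_emb]; exact hpS
    have hqS' : ∀ c, emb x c q ∈ S → emb x a q ∈ S := fun c hc => by
      rw [← emb_proj_mem_iff hX a, proj_emb] at hc; exact hc
    rcases hpq with hpq | hpq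
    · obtain ⟨c, _, hc⟩ := h.exists_lift hpq
      exact hqS' c (hS _ _ (hne c p hp) (hne c q hq) (Or.inl hc) (hpS' c))
    · obtain ⟨c, _, hc⟩ := h.exists_lift hpq
      exact hqS' c (hS _ _ (hne c p hp) (hne c q hq) (Or.inr hc) (hpS' c)))
  have hproj : ∀ p : {y : V // y ≠ x} ⊕ W, p ≠ Sum.inl z → proj p ≠ z.1 := by
    rintro (y | p) hp hh
    · exact hp (by rw [Subtype.ext (show y.1 = z.1 from hh)])
    · exact z.2 hh.symm
  intro p q hp hq hpS
  rw [← emb_proj_mem_iff hX a] at hpS ⊢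
  exact hAconn _ _ (hproj p hp) (hproj q hq) hpS

theorem core_join (h : Join EA EB A C x t u v w a b ED) [Finite V] [NeZero k] (hk : 3 ≤ k)
    (hA : Core k EA) (hB : Core k EB) : Core k ED where
  loopless := h.loopless_D
  not_col := h.not_col_of_core hk hA hB.not_col
  separated := h.separated_of_core hA hB
  strong := h.strong_of_core hk hA hB
  conn z := by
    rcases z with z | z
    exacts [h.connOff_inl hk hA hB z, h.connOff_inr hk hA hB z]

end Join

/-! ### An extremal join has extremal parts -/

lemma exists_perm_two {α : Type*} {p q r s : α} (hpq : p ≠ q) (hrs : r ≠ s) :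
    ∃ σ : Equiv.Perm α, σ p = r ∧ σ q = s := by
  refine ⟨(Equiv.swap p r).trans (Equiv.swap (Equiv.swap p r q) s), ?_, by simp⟩
  rw [Equiv.trans_apply, Equiv.swap_apply_left]
  refine Equiv.swap_apply_of_ne_of_ne (fun hh => hpq ?_) hrs
  have : Equiv.swap p r p = Equiv.swap p r q := by rw [Equiv.swap_apply_left]; exact hh
  exact (Equiv.swap p r).injective this

lemma exists_ne_ne {k : ℕ} (hk : 3 ≤ k) (i j : Fin k) : ∃ c : Fin k, c ≠ i ∧ c ≠ j := by
  by_contra hcon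
  push Not at hcon
  have : (Finset.univ : Finset (Fin k)) ⊆ {i, j} := fun c _ => by
    by_cases hc : c = i
    · simp [hc]
    · simp [hcon c hc]
  have := (Finset.card_le_card this).trans Finset.card_le_two
  rw [Finset.card_univ, Fintype.card_fin] at this
  omega

lemma reach_closed {α : Type*} {R : α → α → Prop} {X : Set α} (hX : ∀ p q, R p q → p ∈ X → q ∈ X)
    {p q : α} (h : ReflTransGen R p q) (hp : p ∈ X) : q ∈ X := by
  induction h with
  | refl => exact hp
  | tail _ h ih => exact hX _ _ h ih

namespace Join

variable {EA : Finset (V × V)} {EB : Finset (W × W)} {A C : Set V} {x t u v w : V} {a b : W}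
  {ED : Finset (({y : V // y ≠ x} ⊕ W) × ({y : V // y ≠ x} ⊕ W))} {k : ℕ}

/-! ### Colourings -/

/-- The arcs of the join inside the copy of `EB`. -/
noncomputable def inner {α : Type*} (ED : Finset ((α ⊕ W) × (α ⊕ W))) : Finset ((α ⊕ W) × (α ⊕ W)) :=
  ED.filter fun e => e.1.isRight ∧ e.2.isRight

lemma mem_inner {α : Type*} {ED : Finset ((α ⊕ W) × (α ⊕ W))} {e : (α ⊕ W) × (α ⊕ W)} :
    e ∈ inner ED ↔ e ∈ ED ∧ e.1.isRight ∧ e.2.isRight := Finset.mem_filter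

/-- The arcs of the join outside the copy of `EB`. -/
noncomputable def outer {α : Type*} (ED : Finset ((α ⊕ W) × (α ⊕ W))) : Finset ((α ⊕ W) × (α ⊕ W)) :=
  ED.filter fun e => ¬ (e.1.isRight ∧ e.2.isRight)

lemma mem_outer {α : Type*} {ED : Finset ((α ⊕ W) × (α ⊕ W))} {e : (α ⊕ W) × (α ⊕ W)} :
    e ∈ outer ED ↔ e ∈ ED ∧ ¬ (e.1.isRight ∧ e.2.isRight) := Finset.mem_filter

lemma acyc_of_inner_outer (h : Join EA EB A C x t u v w a b ED) {φ : {y : V // y ≠ x} ⊕ W → Fin k}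
    (ho : Acyc (Mono (outer ED) φ)) (hi : Acyc (Mono (inner ED) φ))
    (hab : ¬ TransGen (Mono (outer ED) φ) (Sum.inr a) (Sum.inr b))
    (hba : ¬ TransGen (Mono (outer ED) φ) (Sum.inr b) (Sum.inr a)) : Acyc (Mono ED φ) := by
  refine (Acyc.glue_two (A := {p | p.isRight → p = Sum.inr a ∨ p = Sum.inr b})
    (B := {p | p.isRight}) (fun y h1 h2 => h1 h2) ?_ ?_ ho hi hab hba).mono ?_
  · rintro p q ⟨hpq, _⟩
    obtain ⟨hpq, hne⟩ := mem_outer.1 hpq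
    rcases p with y | p <;> rcases q with z | q
    · exact ⟨fun hh => by simp at hh, fun hh => by simp at hh⟩
    · refine ⟨fun hh => by simp at hh, fun _ => ?_⟩
      exact ((h.inl_inr _ _).1 hpq).2.imp (fun hh => by rw [hh.2]) (fun hh => by rw [hh.2])
    · refine ⟨fun _ => ?_, fun hh => by simp at hh⟩
      exact ((h.inr_inl _ _).1 hpq).2.imp (fun hh => by rw [hh.2]) (fun hh => by rw [hh.2])
    · simp at hne
  · rintro p q ⟨hpq, _⟩
    exact (mem_inner.1 hpq).2
  · rintro p q ⟨hpq, hc⟩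
    by_cases hr : p.isRight ∧ q.isRight
    · exact Or.inr ⟨mem_inner.2 ⟨hpq, hr⟩, hc⟩
    · exact Or.inl ⟨mem_outer.2 ⟨hpq, hr⟩, hc⟩

lemma acyc_inner (h : Join EA EB A C x t u v w a b ED) {φ : {y : V // y ≠ x} ⊕ W → Fin k}
    (hφ : Acyc (Mono EB fun p => φ (Sum.inr p))) : Acyc (Mono (inner ED) φ) := by
  refine hφ.lift (Sum.elim (fun _ => a) id) ?_
  rintro p q ⟨hpq, hc⟩
  obtain ⟨hpq, hp, hq⟩ := mem_inner.1 hpq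
  obtain ⟨p, rfl⟩ := Sum.isRight_iff.1 hp
  obtain ⟨q, rfl⟩ := Sum.isRight_iff.1 hq
  exact ⟨((h.inr_inr _ _).1 hpq).1, hc⟩

lemma acyc_EB_of_ne (h : Join EA EB A C x t u v w a b ED) {φ : {y : V // y ≠ x} ⊕ W → Fin k}
    (hφ : Acyc (Mono (inner ED) φ)) (hab : φ (Sum.inr a) ≠ φ (Sum.inr b)) :
    Acyc (Mono EB fun p => φ (Sum.inr p)) := by
  refine hφ.lift Sum.inr ?_
  rintro p q ⟨hpq, hc⟩
  refine ⟨mem_inner.2 ⟨(h.inr_inr _ _).2 ⟨hpq, ?_, ?_⟩, rfl, rfl⟩, hc⟩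
  · rintro ⟨rfl, rfl⟩; exact hab hc
  · rintro ⟨rfl, rfl⟩; exact hab hc.symm

/-- The copy of the side `A` in the join. -/
def side (A : Set V) (x : V) (a : W) : Set ({y : V // y ≠ x} ⊕ W) :=
  {p | Sum.elim (fun y => y.1 ∈ A) (fun q => q = a) p}

lemma outer_cases (h : Join EA EB A C x t u v w a b ED) {p q : {y : V // y ≠ x} ⊕ W}
    (hpq : (p, q) ∈ outer ED) : (p ∈ side A x a ∧ q ∈ side A x a) ∨
      (p ∈ side C x b ∧ q ∈ side C x b) ∨
      (p = emb x a t ∧ q = emb x a u) ∨ (p = emb x a v ∧ q = emb x a w) := by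
  obtain ⟨hpq, hne⟩ := mem_outer.1 hpq
  rcases p with y | p <;> rcases q with z | q
  · rcases h.split.arc_cases ((h.inl_inl _ _).1 hpq) with h' | h' | h' | h'
    · exact Or.inl h'
    · exact Or.inr (Or.inl h')
    · rw [← h'.1, ← h'.2, emb_inl, emb_inl]; simp
    · rw [← h'.1, ← h'.2, emb_inl, emb_inl]; simp
  · rcases ((h.inl_inr _ _).1 hpq).2 with h' | h'
    · exact Or.inl h'
    · exact Or.inr (Or.inl h')
  · rcases ((h.inr_inl _ _).1 hpq).2 with h' | h'
    · exact Or.inl ⟨h'.2, h'.1⟩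
    · exact Or.inr (Or.inl ⟨h'.2, h'.1⟩)
  · simp at hne

lemma side_disjoint (h : Join EA EB A C x t u v w a b ED) {p : {y : V // y ≠ x} ⊕ W}
    (hp : p ∈ side A x a) : p ∉ side C x b := by
  rcases p with y | p
  · exact h.split.notMem_C hp y.2
  · intro hb
    exact h.a_ne_b ((show p = a from hp).symm.trans (show p = b from hb))

/-- The sides have a colouring in which `a` and `b` get different colours. -/
lemma exists_col_outer (h : Join EA EB A C x t u v w a b ED) [NeZero k] (hk : 3 ≤ k)
    (hD : Core k ED) : ∃ φ : {y : V // y ≠ x} ⊕ W → Fin k, Acyc (Mono (outer ED) φ) ∧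
      φ (Sum.inr a) ≠ φ (Sum.inr b) := by
  have htA : emb x a t ∈ side A x a := by
    rw [emb_of_ne a h.split.t_ne]; exact h.split.t_mem
  have hwA : emb x a w ∈ side A x a := by
    rw [emb_of_ne a h.split.w_ne]; exact h.split.w_mem
  have huC : emb x a u ∈ side C x b := by
    rw [emb_of_ne a h.split.u_ne]; exact h.split.u_mem
  have hvC : emb x a v ∈ side C x b := by
    rw [emb_of_ne a h.split.v_ne]; exact h.split.v_mem
  obtain ⟨f, hf⟩ := hD.col_of_subset_of_notMem (restr_subset ED (side A x a)) (h.tu_mem a a)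
    (fun hh => h.side_disjoint (mem_restr.1 hh).2.2 huC)
  obtain ⟨g, hg⟩ := hD.col_of_subset_of_notMem (restr_subset ED (side C x b)) (h.tu_mem a a)
    (fun hh => h.side_disjoint htA (mem_restr.1 hh).2.1)
  -- The sides are disjoint in the join, so the colours on `C` may be permuted: `b` gets a colour
  -- `β` other than that of `a`, and `tu` becomes bichromatic, after which `vw` closes no cycle. `β`
  -- avoids the colour of `t` too, in case `u` has the colour of `b`.
  obtain ⟨β, hβ1, hβ2⟩ := exists_ne_ne hk (f (Sum.inr a)) (f (emb x a t))
  obtain ⟨σ, hσ1, hσ2⟩ : ∃ σ : Equiv.Perm (Fin k), σ (g (Sum.inr b)) = β ∧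
      σ (g (emb x a u)) ≠ f (emb x a t) := by
    by_cases hc : g (Sum.inr b) = g (emb x a u)
    · exact ⟨Equiv.swap (g (Sum.inr b)) β, by simp, by rw [← hc]; simpa using hβ2⟩
    · obtain ⟨δ, hδ1, hδ2⟩ := exists_ne_ne hk β (f (emb x a t))
      obtain ⟨σ, h1, h2⟩ := exists_perm_two hc hδ1.symm
      exact ⟨σ, h1, by rwa [h2]⟩
  have hg' := hg.comp_injective σ.injective
  set φ : {y : V // y ≠ x} ⊕ W → Fin k := fun p => if p ∈ side A x a then f p else σ (g p) with hφ
  have hφA : ∀ p ∈ side A x a, φ p = f p := fun p hp => by simp [hφ, hp]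
  have hφC : ∀ p ∈ side C x b, φ p = σ (g p) := fun p hp => by
    have : p ∉ side A x a := fun hh => h.side_disjoint hh hp
    simp [hφ, this]
  have hR : ∀ p q, Mono (restr ED (side A x a)) f p q → p ∈ side A x a ∧ q ∈ side A x a :=
    fun p q hpq => (mem_restr.1 hpq.1).2
  have hS : ∀ p q, Mono (restr ED (side C x b)) (fun p => σ (g p)) p q →
      p ∈ side C x b ∧ q ∈ side C x b := fun p q hpq => (mem_restr.1 hpq.1).2
  have h0 := hf.glue (x := Sum.inr a) (fun y hy hy' => absurd hy' (h.side_disjoint hy)) hR hS hg'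
  have h1 := h0.add_arc (p := emb x a v) (q := emb x a w) (fun hr => by
    have := reach_closed (X := side A x a) (fun p q hpq hp => hpq.elim (fun hh => (hR _ _ hh).2)
      (fun hh => absurd (hS _ _ hh).1 (h.side_disjoint hp))) hr hwA
    exact h.side_disjoint this hvC)
  refine ⟨φ, h1.mono ?_, ?_⟩
  · rintro p q ⟨hpq, hc⟩
    have hpqD := (mem_outer.1 hpq).1
    rcases h.outer_cases hpq with ⟨hp, hq⟩ | ⟨hp, hq⟩ | ⟨rfl, rfl⟩ | h'
    · rw [hφA p hp, hφA q hq] at hc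
      exact Or.inl (Or.inl ⟨mem_restr.2 ⟨hpqD, hp, hq⟩, hc⟩)
    · rw [hφC p hp, hφC q hq] at hc
      exact Or.inl (Or.inr ⟨mem_restr.2 ⟨hpqD, hp, hq⟩, hc⟩)
    · rw [hφA _ htA, hφC _ huC] at hc
      exact absurd hc.symm hσ2
    · exact Or.inr h'
  · rw [hφA _ (show Sum.inr a ∈ side A x a from rfl), hφC _ (show Sum.inr b ∈ side C x b from rfl),
      hσ1]
    exact hβ1.symm

/-- The digon forces different colours on `a` and `b`, so a colouring of `EB` can be permuted to
match the outer one; no monochromatic path links `a` and `b`. -/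
lemma not_col_EB (h : Join EA EB A C x t u v w a b ED) [NeZero k] (hk : 3 ≤ k)
    (hD : Core k ED) : ¬ Col k EB := by
  rintro ⟨g, hg⟩
  obtain ⟨φ, hφ, hab⟩ := h.exists_col_outer hk hD
  have hgab : g a ≠ g b := fun hc => hg a ((TransGen.single ⟨h.ab_mem, hc⟩).tail ⟨h.ba_mem, hc.symm⟩)
  obtain ⟨σ, ha, hb⟩ := exists_perm_two hgab hab
  set ψ : {y : V // y ≠ x} ⊕ W → Fin k := fun p => Sum.elim (fun y => φ (Sum.inl y))
    (fun q => σ (g q)) p with hψ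
  have hψo : ∀ p q, Mono (outer ED) ψ p q → Mono (outer ED) φ p q := by
    have key : ∀ p q : {y : V // y ≠ x} ⊕ W, ((p, q) ∈ ED ∨ (q, p) ∈ ED) →
        ¬ (p.isRight ∧ q.isRight) → ψ p = φ p := by
      rintro (y | p) q hpq hne
      · rfl
      · rcases q with z | q
        · have : p = a ∨ p = b := by
            rcases hpq with hpq | hpq
            · exact ((h.inr_inl _ _).1 hpq).2.imp And.right And.right
            · exact ((h.inl_inr _ _).1 hpq).2.imp And.right And.right
          rcases this with rfl | rfl
          exacts [ha, hb]
        · simp at hne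
    rintro p q ⟨hpq, hc⟩
    have hm := mem_outer.1 hpq
    refine ⟨hpq, ?_⟩
    rw [← key p q (Or.inl hm.1) hm.2, ← key q p (Or.inr hm.1) fun hh => hm.2 hh.symm]
    exact hc
  have hψab : ψ (Sum.inr a) ≠ ψ (Sum.inr b) := by
    simp only [hψ, Sum.elim_inr]
    rw [ha, hb]; exact hab
  refine hD.not_col ⟨ψ, h.acyc_of_inner_outer (hφ.mono hψo)
    (h.acyc_inner (hg.comp_injective σ.injective)) (fun hr => ?_) (fun hr => ?_)⟩
  · exact hψab (reach_congr (fun p q hpq => hpq.2) hr.to_reflTransGen)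
  · exact hψab (reach_congr (fun p q hpq => hpq.2) hr.to_reflTransGen).symm

/-- By criticality the inner arcs have a colouring, and `a`, `b` agree in it because `EB` has none.
Pasted with a colouring of `EA`, a monochromatic outer path between `a` and `b` would project to a
closed walk at `x`. -/
lemma not_col_EA (h : Join EA EB A C x t u v w a b ED) [NeZero k] (hD : Core k ED)
    (hB : ¬ Col k EB) : ¬ Col k EA := by
  rintro ⟨f, hf⟩
  obtain ⟨g, hg⟩ := hD.col_of_subset_of_notMem (K := inner ED) (Finset.filter_subset _ _)
    (h.tu_mem a a) (fun hh => by
      have := (mem_inner.1 hh).2.1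
      rw [emb_of_ne a h.split.t_ne] at this
      simp at this)
  have hgab : g (Sum.inr a) = g (Sum.inr b) := by
    by_contra hab
    exact hB ⟨_, h.acyc_EB_of_ne hg hab⟩
  obtain ⟨g', hg'a, hg'⟩ : ∃ σ : Equiv.Perm (Fin k), σ (g (Sum.inr a)) = f x ∧
      Acyc (Mono (inner ED) fun p => σ (g p)) :=
    ⟨Equiv.swap (g (Sum.inr a)) (f x), by simp, hg.comp_injective (Equiv.injective _)⟩
  set ψ : {y : V // y ≠ x} ⊕ W → Fin k := fun p => Sum.elim (fun y => f y.1)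
    (fun q => g' (g (Sum.inr q))) p with hψ
  have hψi : ∀ p q, Mono (inner ED) ψ p q → Mono (inner ED) (fun p => g' (g p)) p q := by
    rintro p q ⟨hpq, hc⟩
    obtain ⟨_, hp, hq⟩ := mem_inner.1 hpq
    obtain ⟨p, rfl⟩ := Sum.isRight_iff.1 hp
    obtain ⟨q, rfl⟩ := Sum.isRight_iff.1 hq
    exact ⟨hpq, hc⟩
  have hψo : ∀ p q, Mono (outer ED) ψ p q → Mono EA f (proj p) (proj q) := by
    have key : ∀ p q : {y : V // y ≠ x} ⊕ W, ((p, q) ∈ ED ∨ (q, p) ∈ ED) →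
        ¬ (p.isRight ∧ q.isRight) → ψ p = f (proj p) := by
      rintro (y | p) q hpq hne
      · rfl
      · rcases q with z | q
        · have : p = a ∨ p = b := by
            rcases hpq with hpq | hpq
            · exact ((h.inr_inl _ _).1 hpq).2.imp And.right And.right
            · exact ((h.inl_inr _ _).1 hpq).2.imp And.right And.right
          rw [proj_inr, ← hg'a]
          rcases this with rfl | rfl
          exacts [rfl, congrArg g' hgab.symm]
        · simp at hne
    rintro p q ⟨hpq, hc⟩
    have hm := mem_outer.1 hpq
    refine ⟨h.proj_mem hm.1 hm.2, ?_⟩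
    rw [← key p q (Or.inl hm.1) hm.2, ← key q p (Or.inr hm.1) fun hh => hm.2 hh.symm]
    exact hc
  exact hD.not_col ⟨ψ, h.acyc_of_inner_outer (hf.lift proj hψo) (hg'.mono hψi)
    (fun hr => hf x (TransGen.lift proj hψo (Sum.inr a) (Sum.inr b) hr))
    (fun hr => hf x (TransGen.lift proj hψo (Sum.inr b) (Sum.inr a) hr))⟩

/-! ### Cuts separating `a` from `b` -/

/-- At least `k` arcs leave the part of `X` in `C \ {x}`; except for `vw` they are outer arcs
leaving `X`, since `b ∉ X`. -/
lemma le_outer_of_mem_C (h : Join EA EB A C x t u v w a b ED) [NeZero k] (hD : Core k ED)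
    {X : Set ({y : V // y ≠ x} ⊕ W)} (hb : Sum.inr b ∉ X) {y : {y : V // y ≠ x}} (hy : y.1 ∈ C)
    (hyX : Sum.inl y ∈ X) : k ≤ cut (outer ED) X + 1 := by
  have h1 := hD.le_cut (X := X ∩ {p | ∃ y : {y : V // y ≠ x}, y.1 ∈ C ∧ p = Sum.inl y})
    (p := Sum.inl y) (q := Sum.inr b) ⟨hyX, y, hy, rfl⟩ (fun hh => hb hh.1)
  have h2 : (leaving ED (X ∩ {p | ∃ y : {y : V // y ≠ x}, y.1 ∈ C ∧ p = Sum.inl y})).erase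
      (emb x a v, emb x a w) ⊆ leaving (outer ED) X := by
    rintro ⟨p, q⟩ he
    rw [Finset.mem_erase, mem_leaving] at he
    obtain ⟨hne, hpq, ⟨hp, y, hy, rfl⟩, hq⟩ := he
    refine mem_leaving.2 ⟨mem_outer.2 ⟨hpq, by simp⟩, hp, fun hqX => ?_⟩
    rcases q with z | q
    · have hz : z.1 ∉ C := fun hz => hq ⟨hqX, z, hz, rfl⟩
      have := (h.split.arc_CA y.1 hy y.2 z.1 ((h.split.union _).resolve_right hz) z.2).1
        ((h.inl_inl _ _).1 hpq)
      refine hne ?_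
      rw [← this.1, ← this.2, emb_inl, emb_inl]
    · rw [((h.inl_inr_of_mem_C hy).1 hpq).2] at hqX
      exact hb hqX
  have h3 := Finset.card_le_card h2
  have h4 := Finset.pred_card_le_card_erase (a := (emb x a v, emb x a w)) (s :=
    leaving ED (X ∩ {p | ∃ y : {y : V // y ≠ x}, y.1 ∈ C ∧ p = Sum.inl y}))
  unfold cut at *
  omega

lemma le_outer_of_notMem_A (h : Join EA EB A C x t u v w a b ED) [NeZero k] (hD : Core k ED)
    {X : Set ({y : V // y ≠ x} ⊕ W)} (ha : Sum.inr a ∈ X) {y : {y : V // y ≠ x}} (hy : y.1 ∈ A)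
    (hyX : Sum.inl y ∉ X) : k ≤ cut (outer ED) X + 1 := by
  have h1 := hD.le_cut (X := (Xᶜ ∩ {p | ∃ y : {y : V // y ≠ x}, y.1 ∈ A ∧ p = Sum.inl y})ᶜ)
    (p := Sum.inr a) (q := Sum.inl y) (fun hh => hh.1 ha) (fun hh => hh ⟨hyX, y, hy, rfl⟩)
  have h2 : (leaving ED (Xᶜ ∩ {p | ∃ y : {y : V // y ≠ x}, y.1 ∈ A ∧ p = Sum.inl y})ᶜ).erase
      (emb x a v, emb x a w) ⊆ leaving (outer ED) X := by
    rintro ⟨p, q⟩ he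
    rw [Finset.mem_erase, mem_leaving] at he
    obtain ⟨hne, hpq, hp, hq⟩ := he
    obtain ⟨hq, y, hy, rfl⟩ := not_not.1 hq
    refine mem_leaving.2 ⟨mem_outer.2 ⟨hpq, by simp⟩, ?_, hq⟩
    by_contra hpX
    rcases p with z | p
    · have hz : z.1 ∉ A := fun hz => hp ⟨hpX, z, hz, rfl⟩
      have := (h.split.arc_CA z.1 ((h.split.union _).resolve_left hz) z.2 y.1 hy y.2).1
        ((h.inl_inl _ _).1 hpq)
      refine hne ?_
      rw [← this.1, ← this.2, emb_inl, emb_inl]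
    · simp only at hpX
      rw [((h.inr_inl_of_mem_A hy).1 hpq).2] at hpX
      exact hpX ha
  have h3 := Finset.card_le_card h2
  have h4 := Finset.pred_card_le_card_erase (a := (emb x a v, emb x a w)) (s :=
    leaving ED (Xᶜ ∩ {p | ∃ y : {y : V // y ≠ x}, y.1 ∈ A ∧ p = Sum.inl y})ᶜ)
  unfold cut at *
  omega

lemma cut_inner_add_outer (ED : Finset (({y : V // y ≠ x} ⊕ W) × ({y : V // y ≠ x} ⊕ W)))
    (X : Set ({y : V // y ≠ x} ⊕ W)) : cut (inner ED) X + cut (outer ED) X = cut ED X := by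
  rw [cut_eq_sum, cut_eq_sum, cut_eq_sum, inner, outer, Finset.sum_filter_add_sum_filter_not]

lemma outer_pos (h : Join EA EB A C x t u v w a b ED) [NeZero k] (hk : 2 ≤ k) (hD : Core k ED)
    {X : Set ({y : V // y ≠ x} ⊕ W)} (ha : Sum.inr a ∈ X) (hb : Sum.inr b ∉ X) :
    0 < cut (outer ED) X := by
  have ht := emb_of_ne a h.split.t_ne
  have hu := emb_of_ne a h.split.u_ne
  by_cases htX : emb x a t ∈ X
  · by_cases huX : emb x a u ∈ X
    · rw [hu] at huX
      have := h.le_outer_of_mem_C hD hb h.split.u_mem huX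
      omega
    · refine cut_pos_of_mem (mem_outer.2 ⟨h.tu_mem a a, ?_⟩) htX huX
      rw [ht]; simp
  · rw [ht] at htX
    have := h.le_outer_of_notMem_A hD ha h.split.t_mem htX
    omega

/-- When the outer part of `X` is replaced by the side `A`, the only outer arc leaving the new set
is `tu`. -/
lemma le_inner (h : Join EA EB A C x t u v w a b ED) [NeZero k] (hD : Core k ED)
    {X : Set ({y : V // y ≠ x} ⊕ W)} (ha : Sum.inr a ∈ X) (hb : Sum.inr b ∉ X) :
    k ≤ cut (inner ED) X + 1 := by
  set Z : Set ({y : V // y ≠ x} ⊕ W) :=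
    {p | Sum.elim (fun y => y.1 ∈ A) (fun q => Sum.inr q ∈ X) p} with hZ
  have h1 := hD.le_cut (X := Z) (p := Sum.inr a) (q := Sum.inr b) ha hb
  have h2 : (leaving ED Z).erase (emb x a t, emb x a u) ⊆ leaving (inner ED) X := by
    rintro ⟨p, q⟩ he
    rw [Finset.mem_erase, mem_leaving] at he
    obtain ⟨hne, hpq, hp, hq⟩ := he
    rcases p with y | p <;> rcases q with z | q
    · have hz : z.1 ∉ A := hq
      have := (h.split.arc_AC y.1 hp y.2 z.1 ((h.split.union _).resolve_left hz) z.2).1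
        ((h.inl_inl _ _).1 hpq)
      refine absurd ?_ hne
      rw [← this.1, ← this.2, emb_inl, emb_inl]
    · have := ((h.inl_inr_of_mem_A hp).1 hpq).2
      rw [this] at hq
      exact absurd ha hq
    · have hz : z.1 ∉ A := hq
      have := ((h.inr_inl_of_mem_C ((h.split.union _).resolve_left hz)).1 hpq).2
      rw [this] at hp
      exact absurd hp hb
    · exact mem_leaving.2 ⟨mem_inner.2 ⟨hpq, rfl, rfl⟩, hp, hq⟩
  have h3 := Finset.card_le_card h2
  have h4 := Finset.pred_card_le_card_erase (a := (emb x a t, emb x a u)) (s := leaving ED Z)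
  unfold cut at *
  omega

/-- A tight set containing `a` but not `b` contains one side and is disjoint from the other one. -/
lemma side_of_tight (h : Join EA EB A C x t u v w a b ED) [NeZero k] (hk : 3 ≤ k)
    (hD : Core k ED) {X : Set ({y : V // y ≠ x} ⊕ W)} (hX : cut ED X ≤ k)
    (ha : Sum.inr a ∈ X) (hb : Sum.inr b ∉ X) (y : {y : V // y ≠ x}) :
    (y.1 ∈ A → Sum.inl y ∈ X) ∧ (y.1 ∈ C → Sum.inl y ∉ X) := by
  -- A vertex on the wrong side would give `k - 1` inner and `k - 1` outer arcs, more than `k` in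
  -- total.
  have h1 := h.le_inner hD ha hb
  have h2 := cut_inner_add_outer ED X
  constructor
  · intro hy
    by_contra hyX
    have := h.le_outer_of_notMem_A hD ha hy hyX
    omega
  · intro hy hyX
    have := h.le_outer_of_mem_C hD hb hy hyX
    omega

/-! ### The two parts of an extremal join are extremal -/

/-- If `X` separates `a` from `b`, the digon arc counted in `EB` is paid for by an outer arc leaving
`X`. -/
lemma cut_inr_le (h : Join EA EB A C x t u v w a b ED) [NeZero k] (hk : 2 ≤ k) (hD : Core k ED)
    (X : Set ({y : V // y ≠ x} ⊕ W)) : cut EB {p | Sum.inr p ∈ X} ≤ cut ED X := by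
  have key : ∀ F ⊆ leaving EB {p | Sum.inr p ∈ X}, (a, b) ∉ F → (b, a) ∉ F →
      F.card ≤ cut (inner ED) X := by
    intro F hF hab hba
    refine Finset.card_le_card_of_injOn (fun e => (Sum.inr e.1, Sum.inr e.2)) ?_ ?_
    · rintro ⟨p, q⟩ he
      obtain ⟨h1, h2⟩ := mem_leaving.1 (hF he)
      refine mem_leaving.2 ⟨mem_inner.2 ⟨(h.inr_inr _ _).2 ⟨h1, ?_, ?_⟩, rfl, rfl⟩, h2⟩
      · rintro ⟨rfl, rfl⟩; exact hab he
      · rintro ⟨rfl, rfl⟩; exact hba he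
    · rintro ⟨p, q⟩ _ ⟨p', q'⟩ _ hh
      simpa using hh
  have hsum := cut_inner_add_outer ED X
  by_cases ha : Sum.inr a ∈ X <;> by_cases hb : Sum.inr b ∈ X
  · have := key _ subset_rfl (fun hh => (mem_leaving.1 hh).2.2 hb)
      (fun hh => (mem_leaving.1 hh).2.2 ha)
    unfold cut at *
    omega
  · have h1 := key ((leaving EB {p | Sum.inr p ∈ X}).erase (a, b)) (Finset.erase_subset _ _)
      (Finset.notMem_erase _ _) (fun hh => (mem_leaving.1 (Finset.mem_of_mem_erase hh)).2.2 ha)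
    have h2 := h.outer_pos hk hD ha hb
    have h3 := Finset.pred_card_le_card_erase (a := (a, b)) (s := leaving EB {p | Sum.inr p ∈ X})
    unfold cut at *
    omega
  · have h1 := key ((leaving EB {p | Sum.inr p ∈ X}).erase (b, a)) (Finset.erase_subset _ _)
      (fun hh => (mem_leaving.1 (Finset.mem_of_mem_erase hh)).2.2 hb) (Finset.notMem_erase _ _)
    have h2 := h.swap.outer_pos hk hD hb ha
    have h3 := Finset.pred_card_le_card_erase (a := (b, a)) (s := leaving EB {p | Sum.inr p ∈ X})
    unfold cut at *
    omega
  · have := key _ subset_rfl (fun hh => ha (mem_leaving.1 hh).2.1)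
      (fun hh => hb (mem_leaving.1 hh).2.1)
    unfold cut at *
    omega

/-- All vertices outside `EB` are put on the same side of `S` as `a`; the adjacency of `a` and `b`
in `EB` then accounts for every outer arc. -/
lemma connOff_EB (h : Join EA EB A C x t u v w a b ED) (hD : Core k ED) {z : W} (hz : a ≠ z) :
    ConnOff EB z := by
  intro S hS p q hp hq hpS
  have hinr : ∀ p, p ≠ z → (Sum.inr p : {y : V // y ≠ x} ⊕ W) ≠ Sum.inr z := fun p hp hh =>
    hp (Sum.inr.inj hh)
  have hab : b ≠ z → (a ∈ S ↔ b ∈ S) := fun hb =>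
    ⟨hS a b hz hb (Or.inl h.ab_mem), hS b a hb hz (Or.inr h.ab_mem)⟩
  have hor : ∀ c, c ≠ z → (c = a ∨ c = b) → (a ∈ S ↔ c ∈ S) := by
    rintro c hc (rfl | rfl)
    exacts [Iff.rfl, hab hc]
  refine hD.conn (Sum.inr z) {p | Sum.elim (fun _ => a ∈ S) (fun p => p ∈ S) p} ?_
    (Sum.inr p) (Sum.inr q) (hinr p hp) (hinr q hq) hpS
  have hne : ∀ c, (Sum.inr c : {y : V // y ≠ x} ⊕ W) ≠ Sum.inr z → c ≠ z := fun c hc hh =>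
    hc (by rw [hh])
  rintro (y | p) (y' | q) hp hq hpq hpS
  · exact hpS
  · refine (hor q (hne q hq) ?_).1 hpS
    rcases hpq with hpq | hpq
    · exact ((h.inl_inr _ _).1 hpq).2.imp And.right And.right
    · exact ((h.inr_inl _ _).1 hpq).2.imp And.right And.right
  · refine (hor p (hne p hp) ?_).2 hpS
    rcases hpq with hpq | hpq
    · exact ((h.inr_inl _ _).1 hpq).2.imp And.right And.right
    · exact ((h.inl_inr _ _).1 hpq).2.imp And.right And.right
  · exact hS p q (hne p hp) (hne q hq)
      (hpq.imp (fun hh => ((h.inr_inr _ _).1 hh).1) (fun hh => ((h.inr_inr _ _).1 hh).1)) hpS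

theorem core_EB (h : Join EA EB A C x t u v w a b ED) [NeZero k] (hk : 3 ≤ k)
    (hD : Core k ED) : Core k EB where
  loopless := h.loopless_B
  not_col := h.not_col_EB hk hD
  separated p q hpq := by
    obtain ⟨X, h1, h2, h3⟩ := hD.separated (Sum.inr p) (Sum.inr q) (fun hh => hpq (Sum.inr.inj hh))
    exact ⟨_, h1, h2, (h.cut_inr_le (by omega) hD X).trans h3⟩
  strong X p hp q hq := by
    -- If `a` and `b` are together, the vertices outside `EB` join them and any crossing arc is
    -- inner; otherwise an arc of the digon crosses.
    by_cases ha : a ∈ X <;> by_cases hb : b ∈ X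
    · obtain ⟨⟨c, d⟩, he, h1, h2⟩ := hD.strong {p | Sum.elim (fun _ => True) (fun p => p ∈ X) p}
        (Sum.inr p) hp (Sum.inr q) hq
      rcases d with y | d
      · exact absurd trivial h2
      rcases c with y | c
      · rcases ((h.inl_inr _ _).1 he).2 with ⟨_, rfl⟩ | ⟨_, rfl⟩
        exacts [absurd ha h2, absurd hb h2]
      · exact ⟨_, ((h.inr_inr _ _).1 he).1, h1, h2⟩
    · exact ⟨_, h.ab_mem, ha, hb⟩
    · exact ⟨_, h.ba_mem, hb, ha⟩
    · obtain ⟨⟨c, d⟩, he, h1, h2⟩ := hD.strong {p | Sum.elim (fun _ => False) (fun p => p ∈ X) p}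
        (Sum.inr p) hp (Sum.inr q) hq
      rcases c with y | c
      · exact h1.elim
      rcases d with y | d
      · rcases ((h.inr_inl _ _).1 he).2 with ⟨_, rfl⟩ | ⟨_, rfl⟩
        exacts [absurd h1 ha, absurd h1 hb]
      · exact ⟨_, ((h.inr_inr _ _).1 he).1, h1, h2⟩
  conn z := by
    by_cases hz : a = z
    · exact h.swap.connOff_EB hD fun hb => h.a_ne_b (hz.trans hb.symm)
    · exact h.connOff_EB hD hz

/-- The part of `S` in `A \ {x}` would be attached to the rest of the join at `a` only, making `a` a
cutvertex. -/
lemma notMem_of_closed (h : Join EA EB A C x t u v w a b ED) (hD : Core k ED) {S : Set V}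
    (hS : ∀ p q, p ≠ x → q ≠ x → ((p, q) ∈ EA ∨ (q, p) ∈ EA) → p ∈ S → q ∈ S) (ht : t ∉ S)
    (hw : w ∉ S) {y : V} (hy : y ∈ A) (hyx : y ≠ x) : y ∉ S := by
  intro hyS
  refine hD.conn (Sum.inr a) {p | Sum.elim (fun y => y.1 ∈ A ∧ y.1 ∈ S) (fun _ => False) p} ?_
    (Sum.inl ⟨y, hyx⟩) (Sum.inr b) (fun hh => by cases hh)
    (fun hh => h.a_ne_b (Sum.inr.inj hh).symm) ⟨hy, hyS⟩
  rintro (p | p) (q | q) hp hq hpq hpS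
  · rw [h.inl_inl, h.inl_inl] at hpq
    refine ⟨?_, hS _ _ p.2 q.2 hpq hpS.2⟩
    by_contra hqA
    have hqC := (h.split.union _).resolve_left hqA
    rcases hpq with hpq | hpq
    · exact ht (((h.split.arc_AC _ hpS.1 p.2 _ hqC q.2).1 hpq).1 ▸ hpS.2)
    · exact hw (((h.split.arc_CA _ hqC q.2 _ hpS.1 p.2).1 hpq).2 ▸ hpS.2)
  · refine hq ?_
    rw [h.inl_inr_of_mem_A hpS.1, h.inr_inl_of_mem_A hpS.1] at hpq
    rw [hpq.elim And.right And.right]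
  · exact hpS.elim
  · exact hpS.elim

lemma connOff_EA (h : Join EA EB A C x t u v w a b ED) (hD : Core k ED) (z : V) :
    ConnOff EA z := by
  by_cases hz : z = x
  · subst hz
    -- The arc `tu` and the links inside the sides keep `t`, `u`, `v`, `w` together, so a closed set
    -- missing `t` misses all four.
    have key : ∀ S : Set V, (∀ p q, p ≠ z → q ≠ z → ((p, q) ∈ EA ∨ (q, p) ∈ EA) → p ∈ S → q ∈ S) →
        t ∉ S → ∀ y, y ≠ z → y ∉ S := by
      intro S hS ht y hy
      have hw : w ∉ S := fun hw => ht ((h.split.conn_A S fun p q _ hp _ hq => hS p q hp hq).2 hw)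
      have hu : u ∉ S := fun hu => ht (hS u t h.split.u_ne h.split.t_ne (Or.inr h.split.tu_mem) hu)
      have hv : v ∉ S := fun hv => hu ((h.split.conn_C S fun p q _ hp _ hq => hS p q hp hq).2 hv)
      rcases h.split.union y with hyA | hyC
      · exact h.notMem_of_closed hD hS ht hw hyA hy
      · exact h.swap.notMem_of_closed hD hS hv hu hyC hy
    intro S hS p q hp hq hpS
    by_contra hqS
    have ht : t ∈ S := by
      by_contra ht
      exact key S hS ht p hp hpS
    refine key Sᶜ (fun c d hc hd hcd hcS hdS => hcS (hS d c hd hc hcd.symm hdS)) (fun hh => hh ht)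
      q hq hqS
  · intro S hS p q hp hq hpS
    have hne : ∀ p, p ≠ z → (emb x a p : {y : V // y ≠ x} ⊕ W) ≠ Sum.inl ⟨z, hz⟩ := by
      intro p hp hh
      have := congrArg proj hh
      rw [proj_emb] at this
      exact hp this
    have := hD.conn (Sum.inl ⟨z, hz⟩) (proj ⁻¹' S) (by
      intro c d hc hd hcd hcS
      have hproj : ∀ c : {y : V // y ≠ x} ⊕ W, c ≠ Sum.inl ⟨z, hz⟩ → proj c ≠ z := by
        rintro (y | c) hc hh
        · exact hc (by rw [← (Subtype.ext (show y.1 = z from hh) : y = ⟨z, hz⟩)])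
        · exact hz hh.symm
      by_cases hr : c.isRight ∧ d.isRight
      · obtain ⟨c, rfl⟩ := Sum.isRight_iff.1 hr.1
        obtain ⟨d, rfl⟩ := Sum.isRight_iff.1 hr.2
        exact hcS
      · exact hS _ _ (hproj c hc) (hproj d hd) (hcd.imp (fun hh => h.proj_mem hh hr)
          (fun hh => h.proj_mem hh fun h' => hr h'.symm)) hcS)
      (emb x a p) (emb x a q) (hne p hp) (hne q hq) (by rwa [Set.mem_preimage, proj_emb])
    rwa [Set.mem_preimage, proj_emb] at this

/-- Vertices of `C` are separated from both `a` and `b` by tight sets. -/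
lemma exists_tight_in (h : Join EA EB A C x t u v w a b ED) [NeZero k] (hk : 3 ≤ k)
    (hD : Core k ED) {q : {y : V // y ≠ x}} (hq : q.1 ∈ C) : ∃ X : Set ({y : V // y ≠ x} ⊕ W),
      Sum.inr a ∈ X ∧ Sum.inr b ∈ X ∧ Sum.inl q ∉ X ∧ cut ED X ≤ k := by
  obtain ⟨X, h1, h2, h3⟩ := hD.separated (Sum.inr b) (Sum.inl q) (fun hh => by cases hh)
  refine ⟨X, ?_, h1, h2, h3⟩
  -- A tight set containing `b` but not `a` contains all of `C \ {x}`, hence `q`.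
  by_contra ha
  exact h2 ((h.swap.side_of_tight hk hD h3 h1 ha q).1 hq)

lemma exists_tight_out (h : Join EA EB A C x t u v w a b ED) [NeZero k] (hk : 3 ≤ k)
    (hD : Core k ED) {p : {y : V // y ≠ x}} (hp : p.1 ∈ A) : ∃ X : Set ({y : V // y ≠ x} ⊕ W),
      Sum.inl p ∈ X ∧ Sum.inr a ∉ X ∧ Sum.inr b ∉ X ∧ cut ED X ≤ k := by
  obtain ⟨X, h1, h2, h3⟩ := hD.separated (Sum.inl p) (Sum.inr a) (fun hh => by cases hh)
  refine ⟨X, h1, h2, ?_, h3⟩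
  intro hb
  exact (h.swap.side_of_tight hk hD h3 hb h2 p).2 hp h1

/-- Two vertices of the sides are separated by a tight set not separating `a` from `b`. -/
lemma exists_tight_of_mem_A (h : Join EA EB A C x t u v w a b ED) [NeZero k] (hk : 3 ≤ k)
    (hD : Core k ED) {p q : {y : V // y ≠ x}} (hpq : p ≠ q) (hp : p.1 ∈ A) :
    ∃ X : Set ({y : V // y ≠ x} ⊕ W),
      Sum.inl p ∈ X ∧ Sum.inl q ∉ X ∧ (Sum.inr a ∈ X ↔ Sum.inr b ∈ X) ∧ cut ED X ≤ k := by
  obtain ⟨X, h1, h2, h3⟩ := hD.separated (Sum.inl p) (Sum.inl q) (fun hh => hpq (Sum.inl.inj hh))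
  by_cases hab : Sum.inr a ∈ X ↔ Sum.inr b ∈ X
  · exact ⟨X, h1, h2, hab, h3⟩
  by_cases ha : Sum.inr a ∈ X
  · have hb : Sum.inr b ∉ X := fun hb => hab ⟨fun _ => hb, fun _ => ha⟩
    -- Now `X` contains the side `A`, so `q` is in `C`. A tight `Y` around `a` and `b` that misses
    -- `q` must contain `p`: otherwise its complement meets both sides and `2k ≤ k + 2`.
    have hq : q.1 ∈ C := (h.split.union _).resolve_left fun hq =>
      h2 ((h.side_of_tight hk hD h3 ha hb q).1 hq)
    obtain ⟨Y, haY, hbY, hqY, hY⟩ := h.exists_tight_in hk hD hq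
    by_cases hpY : Sum.inl p ∈ Y
    · exact ⟨Y, hpY, hqY, iff_of_true haY hbY, hY⟩
    exfalso
    set S : Set V → Set ({y : V // y ≠ x} ⊕ W) := fun B =>
      Yᶜ ∩ {p | ∃ y : {y : V // y ≠ x}, y.1 ∈ B ∧ p = Sum.inl y} with hS
    have hd : Disjoint (S A) (S C) := by
      rw [Set.disjoint_left]
      rintro c ⟨_, y, hy, rfl⟩ ⟨_, y', hy', heq⟩
      obtain rfl := Sum.inl.inj heq
      exact h.split.notMem_C hy y.2 hy'
    have h4 := cut_add_cut_le (E := ED) (X := Y) (e := (emb x a v, emb x a w))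
      (f := (emb x a t, emb x a u)) hd (by
        rintro ⟨c, d⟩ he
        obtain ⟨hcd, hc, hd⟩ := mem_leaving.1 he
        obtain ⟨hdY, y, hy, rfl⟩ := not_not.1 hd
        by_cases hcY : c ∈ Y
        · exact Or.inr (mem_leaving.2 ⟨hcd, hcY, hdY⟩)
        rcases c with z | c
        · have hz : z.1 ∉ A := fun hz => hc ⟨hcY, z, hz, rfl⟩
          have := (h.split.arc_CA z.1 ((h.split.union _).resolve_left hz) z.2 y.1 hy y.2).1
            ((h.inl_inl _ _).1 hcd)
          left
          rw [← this.1, ← this.2, emb_inl, emb_inl]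
        · rw [((h.inr_inl_of_mem_A hy).1 hcd).2] at hcY
          exact absurd haY hcY) (by
        rintro ⟨c, d⟩ he
        obtain ⟨hcd, hc, hd⟩ := mem_leaving.1 he
        obtain ⟨hdY, y, hy, rfl⟩ := not_not.1 hd
        by_cases hcY : c ∈ Y
        · exact Or.inr (mem_leaving.2 ⟨hcd, hcY, hdY⟩)
        rcases c with z | c
        · have hz : z.1 ∉ C := fun hz => hc ⟨hcY, z, hz, rfl⟩
          have := (h.split.arc_AC z.1 ((h.split.union _).resolve_right hz) z.2 y.1 hy y.2).1
            ((h.inl_inl _ _).1 hcd)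
          left
          rw [← this.1, ← this.2, emb_inl, emb_inl]
        · rw [((h.inr_inl_of_mem_C hy).1 hcd).2] at hcY
          exact absurd hbY hcY)
    have h5 := hD.le_cut (X := (S A)ᶜ) (p := Sum.inr a) (q := Sum.inl p) (fun hh => hh.1 haY)
      (fun hh => hh ⟨hpY, p, hp, rfl⟩)
    have h6 := hD.le_cut (X := (S C)ᶜ) (p := Sum.inr a) (q := Sum.inl q) (fun hh => hh.1 haY)
      (fun hh => hh ⟨hqY, q, hq, rfl⟩)
    omega
  · have hb : Sum.inr b ∈ X := by
      by_contra hb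
      exact hab (iff_of_false ha hb)
    exact absurd h1 ((h.swap.side_of_tight hk hD h3 hb ha p).2 hp)

theorem core_EA (h : Join EA EB A C x t u v w a b ED) [NeZero k] (hk : 3 ≤ k)
    (hD : Core k ED) : Core k EA where
  loopless := h.loopless_A
  not_col := h.not_col_EA hD (h.not_col_EB hk hD)
  separated p q hpq := by
    -- Only cuts that keep `a` and `b` together descend to `EA`, where both become `x`.
    suffices hs : ∃ X : Set ({y : V // y ≠ x} ⊕ W), emb x a p ∈ X ∧ emb x a q ∉ X ∧
        (Sum.inr a ∈ X ↔ Sum.inr b ∈ X) ∧ cut ED X ≤ k by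
      obtain ⟨X, h1, h2, h3, h4⟩ := hs
      exact ⟨_, h1, h2, (h.cut_emb_le h3).trans h4⟩
    by_cases hpx : p = x
    · subst hpx
      rw [emb_self, emb_of_ne a hpq.symm]
      rcases h.split.union q with hq | hq
      · obtain ⟨X, h1, h2, h3, h4⟩ := h.swap.exists_tight_in hk hD (q := ⟨q, hpq.symm⟩) hq
        exact ⟨X, h2, h3, iff_of_true h2 h1, h4⟩
      · obtain ⟨X, h1, h2, h3, h4⟩ := h.exists_tight_in hk hD (q := ⟨q, hpq.symm⟩) hq
        exact ⟨X, h1, h3, iff_of_true h1 h2, h4⟩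
    · by_cases hqx : q = x
      · subst hqx
        rw [emb_self, emb_of_ne a hpx]
        rcases h.split.union p with hp | hp
        · obtain ⟨X, h1, h2, h3, h4⟩ := h.exists_tight_out hk hD (p := ⟨p, hpx⟩) hp
          exact ⟨X, h1, h2, iff_of_false h2 h3, h4⟩
        · obtain ⟨X, h1, h2, h3, h4⟩ := h.swap.exists_tight_out hk hD (p := ⟨p, hpx⟩) hp
          exact ⟨X, h1, h3, iff_of_false h3 h2, h4⟩
      · rw [emb_of_ne a hpx, emb_of_ne a hqx]
        have hne : (⟨p, hpx⟩ : {y : V // y ≠ x}) ≠ ⟨q, hqx⟩ := fun hh =>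
          hpq (congrArg Subtype.val hh)
        rcases h.split.union p with hp | hp
        · exact h.exists_tight_of_mem_A hk hD hne hp
        · obtain ⟨X, h1, h2, h3, h4⟩ := h.swap.exists_tight_of_mem_A hk hD hne hp
          exact ⟨X, h1, h2, h3.symm, h4⟩
  strong X p hp q hq := by
    obtain ⟨⟨c, d⟩, he, h1, h2⟩ := hD.strong (proj ⁻¹' X) (emb x a p) (by
      rwa [Set.mem_preimage, proj_emb]) (emb x a q) (by rwa [Set.mem_preimage, proj_emb])
    refine ⟨_, h.proj_mem he fun hr => ?_, h1, h2⟩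
    obtain ⟨c, rfl⟩ := Sum.isRight_iff.1 hr.1
    obtain ⟨d, rfl⟩ := Sum.isRight_iff.1 hr.2
    exact h2 h1
  conn := h.connOff_EA hD

/-- A join is extremal if and only if both its parts are. -/
theorem core_iff (h : Join EA EB A C x t u v w a b ED) [Finite V] [NeZero k] (hk : 3 ≤ k) :
    Core k ED ↔ Core k EA ∧ Core k EB :=
  ⟨fun hD => ⟨h.core_EA hk hD, h.core_EB hk hD⟩, fun hh => h.core_join hk hh.1 hh.2⟩

end Join

/-! ### Parallel Hajós joins -/

lemma mem_iff_of_reachable [Fintype V] {D : Digraph V} {B : Set V} {s t : V} {hs : s ∈ B}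
    {ht : t ∈ B} (h : (D.toSimpleGraphInclusive.induce B).Reachable ⟨s, hs⟩ ⟨t, ht⟩) {S : Set V}
    (hS : ∀ y z, y ∈ B → z ∈ B → ((y, z) ∈ arcs D ∨ (z, y) ∈ arcs D) → y ∈ S → z ∈ S) :
    s ∈ S ↔ t ∈ S := by
  have key : ∀ y z : B, (D.toSimpleGraphInclusive.induce B).Reachable y z → y.1 ∈ S → z.1 ∈ S := by
    intro y z hyz hy
    rw [SimpleGraph.reachable_iff_reflTransGen] at hyz
    induction hyz with
    | refl => exact hy
    | @tail c d _ h ih =>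
      refine hS c d c.2 d.2 ?_ ih
      rw [mem_arcs, mem_arcs]
      exact h.2
  exact ⟨key _ _ h, key _ _ h.symm⟩

lemma join_of_data [Fintype V] [Fintype W] {DAC : Digraph V} {DB : Digraph W}
    (hAC : DAC.IsLoopless) (hB : DB.IsLoopless) (P : Digraph.ParallelHajosData DAC DB) :
    Join (arcs DAC) (arcs DB) P.A P.C P.x P.t P.u P.v P.w P.a P.b (arcs P.join) where
  split :=
    { union := fun y => by
        have : y ∈ P.A ∪ P.C := P.union_eq ▸ Set.mem_univ y
        exact this
      inter := fun y h1 h2 => by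
        have : y ∈ P.A ∩ P.C := ⟨h1, h2⟩
        rwa [P.inter_eq] at this
      x_mem_A := (show P.x ∈ P.A ∩ P.C by rw [P.inter_eq]; rfl).1
      x_mem_C := (show P.x ∈ P.A ∩ P.C by rw [P.inter_eq]; rfl).2
      t_mem := P.t_mem.1
      t_ne := P.t_mem.2
      w_mem := P.w_mem.1
      w_ne := P.w_mem.2
      u_mem := P.u_mem.1
      u_ne := P.u_mem.2
      v_mem := P.v_mem.1
      v_ne := P.v_mem.2
      arc_AC := fun y hy hyx z hz hzx => by
        rw [mem_arcs]; exact P.adj_A_C y ⟨hy, hyx⟩ z ⟨hz, hzx⟩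
      arc_CA := fun z hz hzx y hy hyx => by
        rw [mem_arcs]; exact P.adj_C_A z ⟨hz, hzx⟩ y ⟨hy, hyx⟩
      conn_A := fun S hS => mem_iff_of_reachable P.reachable_A fun y z hy hz =>
        hS y z hy.1 hy.2 hz.1 hz.2
      conn_C := fun S hS => mem_iff_of_reachable P.reachable_C fun y z hy hz =>
        hS y z hy.1 hy.2 hz.1 hz.2 }
  loopless_A y hy := hAC y (mem_arcs.1 hy)
  loopless_B p hp := hB p (mem_arcs.1 hp)
  ab_mem := mem_arcs.2 P.adj_ab
  ba_mem := mem_arcs.2 P.adj_ba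
  inl_inl y z := by rw [mem_arcs, mem_arcs]; exact Iff.rfl
  inl_inr y q := by rw [mem_arcs, mem_arcs]; exact Iff.rfl
  inr_inl p z := by rw [mem_arcs, mem_arcs]; exact Iff.rfl
  inr_inr p q := by rw [mem_arcs, mem_arcs]; exact Iff.rfl

end ArcSet

theorem lemma7p2 {U V W : Type*} [Finite U] [Finite V] [Finite W] (k : ℕ) (hk : 3 ≤ k)
    (D : Digraph U) (DAC : Digraph V) (DB : Digraph W)
    (hAC : DAC.IsLoopless) (hB : DB.IsLoopless) (hD : D.IsParallelHajosJoin DAC DB) :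
    D.IsExtremal k ↔ DAC.IsExtremal k ∧ DB.IsExtremal k := by
  obtain ⟨P, ⟨e⟩⟩ := hD
  classical
  have := Fintype.ofFinite U
  have := Fintype.ofFinite V
  have := Fintype.ofFinite W
  have : NeZero k := ⟨by omega⟩
  have hJ := ArcSet.join_of_data hAC hB P
  have hDl : D.IsLoopless := fun p hp =>
    hJ.loopless_D (e p) (ArcSet.mem_arcs.2 (e.map_rel_iff.2 hp))
  rw [ArcSet.isExtremal_iff_core hDl, ArcSet.isExtremal_iff_core hAC,
    ArcSet.isExtremal_iff_core hB, ← hJ.core_iff hk]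
  exact ⟨fun h => h.map e, fun h => h.map e.symm⟩
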